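/- Work on $\mathbb R^4$ with real-valued functions; $|\cdot|_p$ denotes the norm of $L^p(\mathbb R^4)$. Let $D^{1,2}(\mathbb R^4)$ be the completion of $C_0^\infty(\mathbb R^4)$ with respect to $|\nabla u|_2$ (realized as a subspace of $L^4(\mathbb R^4)$), and let $$S=\inf_{u\in D^{1,2}(\mathbb R^4)\setminus\{0\}}\frac{|\nabla u|_2^2}{|u|_4^2}$$ be the best Sobolev constant. Let $a,c>0$ and $b\in\mathbb R$. Put $$S_c=\Big\{u\in H^1(\mathbb R^4): u \text{ radial},\ \int_{\mathbb R^4}|u|^2\,dx=c\Big\},\qquad I_0(u)=\frac a2|\nabla u|_2^2+\frac b4|\nabla u|_2^4-\frac14|u|_4^4 .$$ For $u\in S_c$ and $s\in\mathbb R$ let $(s*u)(x)=e^{2s}u(e^sx)$ and $\Psi_u(s)=I_0(s*u)$. Define $$\mathcal P_0=\{u\in S_c:\ a|\nabla u|_2^2+b|\nabla u|_2^4-|u|_4^4=0\},\qquad \mathcal P_0^-=\{u\in\mathcal P_0:\ \Psi_u''(0)<0\}.$$ (1) If $b\ge S^{-2}$, then $\inf_{u\in S_c}I_0(u)=0$,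 and this infimum is not achieved, i.e. no $u\in S_c$ satisfies $I_0(u)=0$. (2) If $0<b<S^{-2}$, then $\inf_{u\in S_c}I_0(u)=-\infty$, and $$\inf_{u\in\mathcal P_0}I_0(u)=\inf_{u\in\mathcal P_0^-}I_0(u)=\Lambda:=\frac{a^2S^2}{4(1-bS^2)},$$ and the value $\Lambda$ is not achieved by $I_0$ on $\mathcal P_0$, nor on $\mathcal P_0^-$. -/

import Mathlib

open MeasureTheory Filter Topology
open scoped ContDiff ENNReal

namespace Kirchhoff

noncomputable section

/-- Four-dimensional Euclidean space. The critical Sobolev exponent is `2* = 4`. -/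
abbrev R4 : Type := EuclideanSpace ℝ (Fin 4)

/-- Test functions: `φ ∈ C₀^∞(ℝ⁴)`. -/
def IsTest (φ : R4 → ℝ) : Prop := ContDiff ℝ ∞ φ ∧ HasCompactSupport φ

/-- `g` is a weak gradient of `u`: both are locally integrable and
`∫ u ∂ᵢφ = - ∫ gᵢ φ` for every test function `φ` and every coordinate `i`. -/
def IsWeakGrad (u : R4 → ℝ) (g : R4 → R4) : Prop :=
  LocallyIntegrable u ∧ LocallyIntegrable g ∧
    ∀ φ : R4 → ℝ, IsTest φ → ∀ i : Fin 4,
      ∫ x, u x * fderiv ℝ φ x (EuclideanSpace.single i 1) = -∫ x, g x i * φ x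

/-- Weak gradients are unique up to null sets. -/
theorem IsWeakGrad.ae_eq {u : R4 → ℝ} {g h : R4 → R4}
    (hg : IsWeakGrad u g) (hh : IsWeakGrad u h) : g =ᵐ[volume] h := by
  have coord : ∀ {f : R4 → R4}, LocallyIntegrable f → ∀ i : Fin 4,
      LocallyIntegrable (fun x => f x i) := by
    intro f hf i x
    obtain ⟨s, hs, hi⟩ := hf x
    exact ⟨s, hs, (EuclideanSpace.proj i : R4 →L[ℝ] ℝ).integrable_comp hi⟩
  have h0 : ∀ i : Fin 4, ∀ᵐ x : R4, g x i = h x i := by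
    intro i
    refine ae_eq_of_integral_contDiff_smul_eq (coord hg.2.1 i) (coord hh.2.1 i) ?_
    intro φ hφ hc
    have e := (hg.2.2 φ ⟨hφ, hc⟩ i).symm.trans (hh.2.2 φ ⟨hφ, hc⟩ i)
    simpa [smul_eq_mul, mul_comm] using e
  filter_upwards [ae_all_iff.2 h0] with x hx
  ext i
  exact hx i

open Classical in
/-- The weak gradient `∇u` of `u` (unique up to null sets; `0` if there is none). -/
def weakGrad (u : R4 → ℝ) : R4 → R4 :=
  if h : ∃ g, IsWeakGrad u g then Classical.choose h else 0

/-- The norm `|∇u|₂`. -/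
def gradNorm (u : R4 → ℝ) : ℝ := lpNorm (weakGrad u) 2 volume

/-- The norm `|u|₄`. -/
def norm4 (u : R4 → ℝ) : ℝ := lpNorm u 4 volume

/-- `u ∈ H¹(ℝ⁴)`. -/
def MemH1 (u : R4 → ℝ) : Prop :=
  MemLp u 2 volume ∧ ∃ g, IsWeakGrad u g ∧ MemLp g 2 volume

/-- `u` is radial, `u(x) = u(|x|)`, as a class of functions modulo null sets. -/
def IsRadial (u : R4 → ℝ) : Prop := ∃ f : ℝ → ℝ, ∀ᵐ x : R4, u x = f ‖x‖

/-- `u ∈ D^{1,2}(ℝ⁴)`, the completion of `C₀^∞(ℝ⁴)` for `|∇φ|₂`, realized as a space of functions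
in `L⁴(ℝ⁴)`: `u` is the `L⁴`-limit of test functions whose gradients converge in `L²`, to `∇u`. -/
def MemD12 (u : R4 → ℝ) : Prop :=
  MemLp u 4 volume ∧ ∃ g, IsWeakGrad u g ∧ MemLp g 2 volume ∧
    ∃ φ : ℕ → R4 → ℝ, (∀ n, IsTest (φ n)) ∧
      Tendsto (fun n => eLpNorm (fun x => gradient (φ n) x - g x) 2 volume) atTop (𝓝 0) ∧
      Tendsto (fun n => eLpNorm (fun x => φ n x - u x) 4 volume) atTop (𝓝 0)

/-- The best Sobolev constant `S = inf |∇u|₂² / |u|₄²` over `u ∈ D^{1,2}(ℝ⁴) ∖ {0}`. -/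
def sobolevS : ℝ :=
  sInf {r : ℝ | ∃ u : R4 → ℝ, MemD12 u ∧ ¬ u =ᵐ[volume] 0 ∧ r = gradNorm u ^ 2 / norm4 u ^ 2}

/-- `S_c`: radial `H¹` functions of mass `∫ |u|² = c`. -/
def sphere (c : ℝ) : Set (R4 → ℝ) :=
  {u | MemH1 u ∧ IsRadial u ∧ ∫ x, |u x| ^ 2 = c}

/-- `I₀(u) = (a/2) |∇u|₂² + (b/4) |∇u|₂⁴ - (1/4) |u|₄⁴`. -/
def energy (a b : ℝ) (u : R4 → ℝ) : ℝ :=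
  a / 2 * gradNorm u ^ 2 + b / 4 * gradNorm u ^ 4 - 1 / 4 * norm4 u ^ 4

/-- `P₀(u) = a |∇u|₂² + b |∇u|₂⁴ - |u|₄⁴`. -/
def pohozaev (a b : ℝ) (u : R4 → ℝ) : ℝ :=
  a * gradNorm u ^ 2 + b * gradNorm u ^ 4 - norm4 u ^ 4

/-- The dilation `(s ∗ u)(x) = e^{(N/2) s} u(e^s x)`, with `N = 4`. -/
def dilate (s : ℝ) (u : R4 → ℝ) : R4 → ℝ :=
  fun x => Real.exp (2 * s) * u (Real.exp s • x)

/-- The fiber map `Ψ_u(s) = I₀(s ∗ u)`. -/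
def fiber (a b : ℝ) (u : R4 → ℝ) (s : ℝ) : ℝ := energy a b (dilate s u)

/-- The Pohozaev manifold `𝒫₀`. -/
def pohozaevSet (a b c : ℝ) : Set (R4 → ℝ) := {u | u ∈ sphere c ∧ pohozaev a b u = 0}

/-- `𝒫₀⁻`: those `u ∈ 𝒫₀` with `Ψ_u''(0) < 0`. -/
def pohozaevSetNeg (a b c : ℝ) : Set (R4 → ℝ) :=
  {u | u ∈ pohozaevSet a b c ∧ iteratedDeriv 2 (fiber a b u) 0 < 0}

/-- `Λ = a² S² / (4 (1 - b S²))`. -/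
def levelL (a b : ℝ) : ℝ := a ^ 2 * sobolevS ^ 2 / (4 * (1 - b * sobolevS ^ 2))

end

end Kirchhoff

namespace Kirchhoff

/-! Put X = |∇u|₂² and Y = |u|₄⁴. Then I₀ = aX/2 + (bX² - Y)/4 and 𝒫₀ is given by Y = aX + bX², so
the theorem is about which pairs (X, Y) occur on S_c. Two facts decide this.

(i) The Sobolev inequality is strict on H¹ ∖ {0}: S²Y < X² (`sharp_sobolev_strict`, `sobolevS_eq`).
If bS² ≥ 1, then bX² - Y > 0, hence I₀ > 0. If bS² < 1, then on 𝒫₀ one has I₀ = aX/4, and inserting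
Y = aX + bX² gives X > aS²/(1 - bS²), that is I₀ > Λ. Moreover Ψ_u''(0) = -2aX < 0 on 𝒫₀, so 𝒫₀⁻ =
𝒫₀.

(ii) The constant is approached by radial H¹ functions (`bubbleSeq`), and amplitude together with
dilation gives such a function mass c and turns (X, Y) into (tX, t²Y) for any t > 0
(`exists_mem_sphere`). Taking t → 0 gives infimum 0; taking t → ∞ on a function with bX² < Y gives
-∞; the t that lands on 𝒫₀ gives energy a²X²/(4(Y - bX²)), which tends to Λ.

Most of the work is (i). The sharp inequality is proved by mass transport (`sharp_sobolev_of_pos`):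
a triangular Knothe map T carries f⁴ to a multiple of the bubble density (1 + |y|²)⁻⁴; the
arithmetic-geometric mean inequality bounds its Jacobian by (div T / 4)⁴, and an integration by
parts followed by Young's inequality gives the constant 8√N, with N the mass of that density.
Density arguments carry it to H¹ and D^{1,2}.

Strictness is not read off from the equality cases of the transport. If u ∈ H¹ were extremal, the
first variation of |u| in the direction of a cutoff η_R would bound ∫|u|³η_R by a multiple of the L²
norm of u far out times |Δη_R|₂. In dimension four |Δη_R|₂ does not depend on R, and u ∈ L², so the
bound tends to 0 and u = 0. -/

/-! ### Distribution functions and monotone rearrangement on the line -/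

theorem hasDerivAt_setIntegral_Iic {q : ℝ → ℝ} (hc : Continuous q) (hi : Integrable q) (x : ℝ) :
    HasDerivAt (fun x => ∫ t in Set.Iic x, q t) (q x) x := by
  have h1 : (fun x => ∫ t in Set.Iic x, q t) =
      fun x => (∫ t in (0:ℝ)..x, q t) + ∫ t in Set.Iic 0, q t := by
    funext y
    rw [← intervalIntegral.integral_Iic_sub_Iic hi.integrableOn hi.integrableOn]
    ring
  rw [h1]
  exact (intervalIntegral.integral_hasDerivAt_right hi.intervalIntegrable
    hc.stronglyMeasurable.stronglyMeasurableAtFilter hc.continuousAt).add_const _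

/-- The distribution function of a positive continuous density, as an order isomorphism. -/
theorem exists_cdf_orderIso {q : ℝ → ℝ} (hc : Continuous q) (hp : ∀ x, 0 < q x)
    (hi : Integrable q) : ∃ e : ℝ ≃o Set.Ioo (0:ℝ) 1,
      ∀ x, (e x : ℝ) = (∫ t in Set.Iic x, q t) / ∫ t, q t := by
  have hM : 0 < ∫ t, q t := by
    rw [integral_pos_iff_support_of_nonneg (fun x => (hp x).le) hi]
    have : Function.support q = Set.univ := by
      ext x; simp [(hp x).ne']
    simp [this]
  set P : ℝ → ℝ := fun x => (∫ t in Set.Iic x, q t) / ∫ t, q t with hP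
  have hd : ∀ x, HasDerivAt P (q x / ∫ t, q t) x := fun x =>
    (hasDerivAt_setIntegral_Iic hc hi x).div_const _
  have hmono : StrictMono P := by
    apply strictMono_of_deriv_pos
    intro x
    rw [(hd x).deriv]
    exact div_pos (hp x) hM
  have hcont : Continuous P := continuous_iff_continuousAt.2 fun x => (hd x).continuousAt
  have htop : Tendsto P atTop (𝓝 1) := by
    have h := (tendsto_setIntegral_of_monotone (f := q) (μ := volume) (s := fun x : ℝ => Set.Iic x)
      (fun x => measurableSet_Iic) (fun a b h => Set.Iic_subset_Iic.2 h)
      hi.integrableOn).div_const (∫ t, q t)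
    have hU : (⋃ n : ℝ, Set.Iic n) = Set.univ := by
      ext x; simp only [Set.mem_iUnion, Set.mem_Iic, Set.mem_univ, iff_true]; exact ⟨x, le_rfl⟩
    rw [hU, Measure.restrict_univ, div_self hM.ne'] at h
    exact h
  have hbot : Tendsto P atBot (𝓝 0) := by
    have h := (tendsto_setIntegral_of_antitone (f := q) (μ := volume)
      (s := fun x : ℝ => Set.Iic (-x))
      (fun x => measurableSet_Iic) (fun a b h => Set.Iic_subset_Iic.2 (neg_le_neg h))
      ⟨0, hi.integrableOn⟩).div_const (∫ t, q t)
    have hU : (⋂ n : ℝ, Set.Iic (-n)) = ∅ := by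
      ext x; simp only [Set.mem_iInter, Set.mem_Iic, Set.mem_empty_iff_false, iff_false]
      push Not
      exact ⟨-x + 1, by linarith⟩
    rw [hU, Measure.restrict_empty, integral_zero_measure, zero_div] at h
    have := h.comp tendsto_neg_atBot_atTop
    refine this.congr fun x => ?_
    simp [P]
  have hmem : ∀ x, P x ∈ Set.Ioo (0:ℝ) 1 := fun x =>
    ⟨(hmono.monotone.le_of_tendsto hbot (x - 1)).trans_lt (hmono (by linarith)),
      (hmono (by linarith : x < x + 1)).trans_le (hmono.monotone.ge_of_tendsto htop (x + 1))⟩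
  have hmono' : StrictMono (fun x => (⟨P x, hmem x⟩ : Set.Ioo (0:ℝ) 1)) := fun a b h => hmono h
  have hsurj : Function.Surjective (fun x => (⟨P x, hmem x⟩ : Set.Ioo (0:ℝ) 1)) := by
    rintro ⟨y, hy0, hy1⟩
    obtain ⟨x, hx⟩ := mem_range_of_exists_le_of_exists_ge hcont
      ((hbot.eventually_lt_const hy0).exists.imp fun _ h => h.le)
      ((htop.eventually_const_lt hy1).exists.imp fun _ h => h.le)
    exact ⟨x, Subtype.ext hx⟩
  exact ⟨hmono'.orderIsoOfSurjective _ hsurj, fun x => rfl⟩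

/-- `⟨z⟩ = (1 + z²)^{1/2}`. -/
noncomputable def bracket (z : ℝ) : ℝ := √(1 + z ^ 2)

theorem bracket_pos (z : ℝ) : 0 < bracket z := Real.sqrt_pos.2 (by positivity)

theorem bracket_sq (z : ℝ) : bracket z ^ 2 = 1 + z ^ 2 := Real.sq_sqrt (by positivity)

theorem continuous_bracket : Continuous bracket := by unfold bracket; fun_prop

theorem hasDerivAt_bracket (z : ℝ) : HasDerivAt bracket (z / bracket z) z := by
  have h : HasDerivAt bracket _ z := ((hasDerivAt_pow 2 z).const_add 1).sqrt (by positivity)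
  refine h.congr_deriv ?_
  rw [Nat.cast_ofNat, Nat.add_one_sub_one, pow_one, mul_div_mul_left _ _ two_ne_zero, bracket]

theorem integrable_bracket_inv_pow {n : ℕ} (hn : 2 ≤ n) :
    Integrable (fun z : ℝ => (bracket z ^ n)⁻¹) := by
  have h := integrable_rpow_neg_one_add_norm_sq (E := ℝ) (μ := volume) (r := n)
    (by simp; omega)
  refine h.congr (ae_of_all _ fun z => ?_)
  dsimp only
  rw [Real.norm_eq_abs, sq_abs, bracket]
  rw [Real.sqrt_eq_rpow, ← Real.rpow_natCast (_ ^ (1 / 2 : ℝ)) n,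
    ← Real.rpow_mul (by positivity), ← Real.rpow_neg (by positivity)]
  congr 1; ring

/-- `∫ (1 + z²)^{-n/2} dz`. -/
noncomputable def bracketMass (n : ℕ) : ℝ := ∫ z : ℝ, (bracket z ^ n)⁻¹

theorem bracketMass_pos {n : ℕ} (hn : 2 ≤ n) : 0 < bracketMass n := by
  have hp : ∀ z : ℝ, 0 < (bracket z ^ n)⁻¹ := fun z => by have := bracket_pos z; positivity
  unfold bracketMass
  rw [integral_pos_iff_support_of_nonneg (fun x => (hp x).le) (integrable_bracket_inv_pow hn)]
  have : Function.support (fun z : ℝ => (bracket z ^ n)⁻¹) = Set.univ := by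
    ext x; simp only [Function.mem_support, Set.mem_univ, iff_true]; exact (hp x).ne'
  simp [this]

/-- The derivative of z(1 + z²)^{-n/2} has integral zero; n ≥ 3 makes this function itself
integrable. The recursion yields both the moment of the transport map and the Dirichlet integral of
the bubble. -/
theorem bracketMass_rec {n : ℕ} (hn : 3 ≤ n) :
    n * bracketMass (n + 2) = (n - 1) * bracketMass n := by
  have hd : ∀ z : ℝ, HasDerivAt (fun z => z * (bracket z ^ n)⁻¹)
      ((1 - n) * (bracket z ^ n)⁻¹ + n * (bracket z ^ (n + 2))⁻¹) z := by
    intro z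
    have hb := bracket_pos z
    have h : HasDerivAt (fun z => z * (bracket z ^ n)⁻¹) _ z :=
      (hasDerivAt_id z).mul (((hasDerivAt_bracket z).pow n).inv (pow_pos hb n).ne')
    refine h.congr_deriv ?_
    obtain ⟨m, rfl⟩ : ∃ m, n = m + 1 := ⟨n - 1, by omega⟩
    have hz : z ^ 2 = bracket z ^ 2 - 1 := by rw [bracket_sq]; ring
    simp only [id, Nat.add_sub_cancel, Pi.pow_apply]
    field_simp
    rw [hz]
    push_cast
    ring
  have hi1 := (integrable_bracket_inv_pow (n := n) (by omega)).const_mul (1 - n : ℝ)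
  have hi2 := (integrable_bracket_inv_pow (n := n + 2) (by omega)).const_mul (n : ℝ)
  have hi0 : Integrable (fun z : ℝ => z * (bracket z ^ n)⁻¹) := by
    refine (integrable_bracket_inv_pow (n := n - 1) (by omega)).mono'
      (by
        have := continuous_bracket
        exact (continuous_id.mul ((this.pow n).inv₀ fun z => (pow_pos (bracket_pos z) n).ne')).aestronglyMeasurable) (ae_of_all _ fun z => ?_)
    have hb := bracket_pos z
    obtain ⟨m, rfl⟩ : ∃ m, n = m + 1 := ⟨n - 1, by omega⟩
    rw [norm_mul, Real.norm_eq_abs, norm_inv, Real.norm_eq_abs, abs_of_pos (pow_pos hb _),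
      Nat.add_sub_cancel, pow_succ]
    have : |z| ≤ bracket z := Real.abs_le_sqrt (by linarith)
    field_simp
    exact this
  have h0 := integral_eq_zero_of_hasDerivAt_of_integrable hd (hi1.add hi2) hi0
  rw [integral_add hi1 hi2, integral_const_mul, integral_const_mul] at h0
  unfold bracketMass
  linarith

theorem integral_pos_of_continuous_pos {q : ℝ → ℝ} (hp : ∀ x, 0 < q x) (hi : Integrable q) :
    0 < ∫ t, q t := by
  rw [integral_pos_iff_support_of_nonneg (fun x => (hp x).le) hi]
  have : Function.support q = Set.univ := by
    ext x; simp [(hp x).ne']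
  simp [this]

/-- The quantile function of the density proportional to `(1 + z²)^{-n/2}`. -/
theorem exists_quantile {n : ℕ} (hn : 2 ≤ n) : ∃ g : ℝ → ℝ,
    (∀ p ∈ Set.Ioo (0:ℝ) 1, HasDerivAt g (bracketMass n * bracket (g p) ^ n) p) ∧
    Set.BijOn g (Set.Ioo 0 1) Set.univ := by
  have hq : Continuous fun z : ℝ => (bracket z ^ n)⁻¹ :=
    (continuous_bracket.pow n).inv₀ fun z => (pow_pos (bracket_pos z) n).ne'
  have hp : ∀ z, 0 < (bracket z ^ n)⁻¹ := fun z => inv_pos.2 (pow_pos (bracket_pos z) n)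
  have hi := integrable_bracket_inv_pow hn
  obtain ⟨e, he⟩ := exists_cdf_orderIso hq hp hi
  have hM := bracketMass_pos hn
  classical
  -- The value 0 outside (0, 1) plays no role.
  set g : ℝ → ℝ := fun p => if h : p ∈ Set.Ioo (0:ℝ) 1 then e.symm ⟨p, h⟩ else 0 with hg
  have hgval : ∀ p (h : p ∈ Set.Ioo (0:ℝ) 1), g p = e.symm ⟨p, h⟩ := fun p h => by
    simp only [hg, dif_pos h]
  have hcont : ContinuousOn g (Set.Ioo 0 1) := by
    rw [continuousOn_iff_continuous_domRestrict]
    -- The inverse of an order isomorphism is continuous for the order topologies, so no separate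
    -- argument is needed.
    refine e.symm.continuous.congr fun p => ?_
    rw [Set.domRestrict_apply, hgval p.1 p.2]
  have hinv : ∀ p ∈ Set.Ioo (0:ℝ) 1,
      (∫ t in Set.Iic (g p), (bracket t ^ n)⁻¹) / bracketMass n = p := by
    intro p hp
    have := he (e.symm ⟨p, hp⟩)
    rw [OrderIso.apply_symm_apply] at this
    rw [hgval p hp]
    exact this.symm
  refine ⟨g, fun p hp => ?_, fun _ _ => Set.mem_univ _, fun p hp q hq h => ?_, fun z _ => ?_⟩
  · have hd : HasDerivAt (fun x => (∫ t in Set.Iic x, (bracket t ^ n)⁻¹) / bracketMass n)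
        ((bracket (g p) ^ n)⁻¹ / bracketMass n) (g p) :=
      (hasDerivAt_setIntegral_Iic hq hi (g p)).div_const _
    have hb := pow_pos (bracket_pos (g p)) n
    have h := hd.of_local_left_inverse (hcont.continuousAt (isOpen_Ioo.mem_nhds hp)) (by positivity)
      (by filter_upwards [isOpen_Ioo.mem_nhds hp] with q hq using hinv q hq)
    refine h.congr_deriv ?_
    field_simp
  · rw [← hinv p hp, ← hinv q hq, h]
  · exact ⟨e z, (e z).2, by rw [hgval _ (e z).2]; simp⟩

theorem continuous_integral_of_le {Ω : Type*} [TopologicalSpace Ω] [FirstCountableTopology Ω]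
    {F : Ω → ℝ → ℝ} {B : ℝ → ℝ} (hF : Continuous (Function.uncurry F))
    (hpos : ∀ ξ x, 0 ≤ F ξ x) (hle : ∀ ξ x, F ξ x ≤ B x) (hB : Integrable B) :
    Continuous fun ξ => ∫ x, F ξ x :=
  continuous_of_dominated (fun ξ => (hF.comp (by fun_prop : Continuous fun x => (ξ, x))).aestronglyMeasurable)
    (fun ξ => ae_of_all _ fun x => by rw [Real.norm_of_nonneg (hpos ξ x)]; exact hle ξ x) hB
    (ae_of_all _ fun x => hF.comp (by fun_prop : Continuous fun ξ => (ξ, x)))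

/-- Dominated convergence also handles the moving endpoint: near x₀ the indicator of `Set.Iic` at a
point x ≠ x₀ is locally constant in the endpoint, and the exceptional point is null. -/
theorem continuous_setIntegral_Iic_of_le {Ω : Type*} [TopologicalSpace Ω]
    [FirstCountableTopology Ω]
    {F : Ω → ℝ → ℝ} {B : ℝ → ℝ} (hF : Continuous (Function.uncurry F))
    (hpos : ∀ ξ x, 0 ≤ F ξ x) (hle : ∀ ξ x, F ξ x ≤ B x) (hB : Integrable B) :
    Continuous fun p : Ω × ℝ => ∫ x in Set.Iic p.2, F p.1 x := by
  rw [continuous_iff_continuousAt]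
  rintro ⟨ξ₀, x₀⟩
  simp_rw [← integral_indicator (measurableSet_Iic)]
  have hs : ∀ ξ, Continuous (F ξ) := fun ξ => hF.comp (by fun_prop : Continuous fun x => (ξ, x))
  refine continuousAt_of_dominated (bound := B) (Eventually.of_forall fun p =>
    ((hs p.1).stronglyMeasurable.indicator measurableSet_Iic).aestronglyMeasurable)
    (Eventually.of_forall fun p => ae_of_all _ fun x => ?_) hB ?_
  · rw [Real.norm_of_nonneg (Set.indicator_nonneg (fun y _ => hpos _ _) _)]
    exact (Set.indicator_le_self' (fun y _ => hpos _ _) x).trans (hle _ _)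
  · have : ∀ᵐ x : ℝ, x ≠ x₀ := by simp [ae_iff]
    filter_upwards [this] with x hx
    rcases lt_or_gt_of_ne hx with h | h
    · have hev : ∀ᶠ p : Ω × ℝ in 𝓝 (ξ₀, x₀), F p.1 x = (Set.Iic p.2).indicator (F p.1) x := by
        filter_upwards [continuous_snd.continuousAt.eventually (lt_mem_nhds h)] with p hp
        rw [Set.indicator_of_mem (show x ∈ Set.Iic p.2 from le_of_lt hp)]
      exact ((hF.comp (by fun_prop : Continuous fun p : Ω × ℝ => (p.1, x))).continuousAt).congr hev
    · have hev : ∀ᶠ p : Ω × ℝ in 𝓝 (ξ₀, x₀), (0:ℝ) = (Set.Iic p.2).indicator (F p.1) x := by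
        filter_upwards [continuous_snd.continuousAt.eventually (gt_mem_nhds h)] with p hp
        rw [Set.indicator_of_notMem (show x ∉ Set.Iic p.2 from not_le.2 hp)]
      exact continuousAt_const.congr hev

/-- Monotone rearrangement, in one variable and continuously in a parameter, of positive
densities onto the density proportional to `(1 + z²)^{-n/2}`. -/
theorem exists_monotone_transport {Ω : Type*} [TopologicalSpace Ω] [FirstCountableTopology Ω]
    {n : ℕ} (hn : 5 ≤ n) {F : Ω → ℝ → ℝ} {B : ℝ → ℝ} (hF : Continuous (Function.uncurry F))
    (hpos : ∀ ξ x, 0 < F ξ x) (hle : ∀ ξ x, F ξ x ≤ B x) (hB : Integrable B) :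
    ∃ ζ : Ω → ℝ → ℝ, Continuous (Function.uncurry ζ) ∧
      (∀ ξ x, HasDerivAt (ζ ξ)
        (bracketMass n * (F ξ x / ∫ t, F ξ t) * bracket (ζ ξ x) ^ n) x) ∧
      ∀ ξ, ∫⁻ x, ENNReal.ofReal (F ξ x * (1 + ζ ξ x ^ 2)) =
        ENNReal.ofReal ((n - 2) / (n - 3) * ∫ x, F ξ x) := by
  obtain ⟨g, hg, hbij⟩ := exists_quantile (n := n) (by omega)
  have hs : ∀ ξ, Continuous (F ξ) := fun ξ => hF.comp (by fun_prop : Continuous fun x => (ξ, x))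
  have hi : ∀ ξ, Integrable (F ξ) := fun ξ => hB.mono' (hs ξ).aestronglyMeasurable
    (ae_of_all _ fun x => by rw [Real.norm_of_nonneg (hpos ξ x).le]; exact hle ξ x)
  have hM : ∀ ξ, 0 < ∫ t, F ξ t := fun ξ => integral_pos_of_continuous_pos (hpos ξ) (hi ξ)
  have hcdf := fun ξ => exists_cdf_orderIso (hs ξ) (hpos ξ) (hi ξ)
  choose e he using hcdf
  set P : Ω → ℝ → ℝ := fun ξ x => (∫ t in Set.Iic x, F ξ t) / ∫ t, F ξ t with hP
  have hmem : ∀ ξ x, P ξ x ∈ Set.Ioo (0:ℝ) 1 := fun ξ x => by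
    rw [hP]; dsimp only; rw [← he ξ x]; exact (e ξ x).2
  have hPc : Continuous (Function.uncurry P) :=
    (continuous_setIntegral_Iic_of_le hF (fun ξ x => (hpos ξ x).le) hle hB).div
      ((continuous_integral_of_le hF (fun ξ x => (hpos ξ x).le) hle hB).comp continuous_fst)
      fun p => (hM p.1).ne'
  have hPd : ∀ ξ x, HasDerivAt (P ξ) (F ξ x / ∫ t, F ξ t) x := fun ξ x =>
    (hasDerivAt_setIntegral_Iic (hs ξ) (hi ξ) x).div_const _
  have hd : ∀ ξ x, HasDerivAt (fun x => g (P ξ x))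
      (bracketMass n * (F ξ x / ∫ t, F ξ t) * bracket (g (P ξ x)) ^ n) x := fun ξ x =>
    ((hg _ (hmem ξ x)).comp x (hPd ξ x)).congr_deriv (by ring)
  refine ⟨fun ξ x => g (P ξ x), ?_, hd, fun ξ => ?_⟩
  · rw [continuous_iff_continuousAt]
    rintro ⟨ξ, x⟩
    exact ContinuousAt.comp (g := g) (f := Function.uncurry P) (hg _ (hmem ξ x)).continuousAt
      hPc.continuousAt
  · have himg : (fun x => g (P ξ x)) '' Set.univ = Set.univ := by
      refine Set.eq_univ_of_forall fun z => ?_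
      obtain ⟨p, hp, rfl⟩ := hbij.surjOn (Set.mem_univ z)
      refine ⟨(e ξ).symm ⟨p, hp⟩, Set.mem_univ _, ?_⟩
      have := he ξ ((e ξ).symm ⟨p, hp⟩)
      rw [OrderIso.apply_symm_apply] at this
      simp only [hP]
      rw [← this]
    have hinj : Set.InjOn (fun x => g (P ξ x)) Set.univ := by
      intro x _ y _ h
      have := hbij.injOn (hmem ξ x) (hmem ξ y) h
      simp only [hP] at this
      rw [← he, ← he] at this
      exact (e ξ).injective (Subtype.ext this)
    have hc := bracketMass_pos (n := n) (by omega)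
    -- In the variable z = ζ(x) the measure F dx is a multiple of (1 + z²)^{-n/2} dz. The second
    -- moment is therefore governed by the quotient of the masses with exponents n - 2 and n, which
    -- `bracketMass_rec` evaluates.
    have key := lintegral_image_eq_lintegral_abs_deriv_mul MeasurableSet.univ
      (fun x _ => (hd ξ x).hasDerivWithinAt) hinj
      (fun z => ENNReal.ofReal ((∫ t, F ξ t) / bracketMass n * (bracket z ^ (n - 2))⁻¹))
    rw [himg, Measure.restrict_univ] at key
    have hrec := bracketMass_rec (n := n - 2) (by omega)
    rw [Nat.sub_add_cancel (by omega), Nat.cast_sub (by omega)] at hrec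
    have hn' : (5:ℝ) ≤ n := by exact_mod_cast hn
    have hM' := hM ξ
    trans ∫⁻ z, ENNReal.ofReal ((∫ t, F ξ t) / bracketMass n * (bracket z ^ (n - 2))⁻¹)
    · rw [key]
      refine lintegral_congr fun x => ?_
      have hb := bracket_pos (g (P ξ x))
      have hf := hpos ξ x
      rw [← ENNReal.ofReal_mul (abs_nonneg _), abs_of_pos (by positivity), ← bracket_sq]
      congr 1
      have hsplit : bracket (g (P ξ x)) ^ n =
          bracket (g (P ξ x)) ^ (n - 2) * bracket (g (P ξ x)) ^ 2 := by
        rw [← pow_add, Nat.sub_add_cancel (by omega)]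
      rw [hsplit]
      field_simp
    · rw [← ofReal_integral_eq_lintegral_ofReal
        ((integrable_bracket_inv_pow (n := n - 2) (by omega)).const_mul _)
        (ae_of_all _ fun z => by have := bracket_pos z; positivity), integral_const_mul]
      congr 1
      change _ * bracketMass (n - 2) = _
      have h3 : (n : ℝ) - 3 ≠ 0 := by linarith
      push_cast at hrec
      field_simp
      linarith

/-! ### Splitting off the last coordinate, and the Knothe map -/

/-- Append a last coordinate. -/
abbrev append {k : ℕ} (ξ : Fin k → ℝ) (t : ℝ) : Fin (k + 1) → ℝ :=
  Fin.snoc (α := fun _ => ℝ) ξ t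

theorem continuous_append {k : ℕ} : Continuous fun p : (Fin k → ℝ) × ℝ => append p.1 p.2 :=
  Continuous.finSnoc (A := fun _ => ℝ) continuous_fst continuous_snd

theorem continuous_init {k : ℕ} :
    Continuous fun x : Fin (k + 1) → ℝ => (Fin.init x : Fin k → ℝ) :=
  Continuous.finInit (A := fun _ => ℝ) continuous_id

theorem lintegral_fin_succ {k : ℕ} {H : (Fin (k + 1) → ℝ) → ℝ≥0∞} (hH : Measurable H) :
    ∫⁻ x, H x = ∫⁻ ξ : Fin k → ℝ, ∫⁻ t : ℝ, H (append ξ t) := by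
  have h := (volume_preserving_piFinSuccAbove (fun _ : Fin (k + 1) => ℝ) (Fin.last k)).symm
  rw [← h.lintegral_comp hH, Measure.volume_eq_prod, lintegral_prod_symm]
  · refine lintegral_congr fun ξ => lintegral_congr fun t => ?_
    congr 1
    exact Fin.insertNth_last' t ξ
  · exact (hH.comp h.measurable).aemeasurable

theorem hasLineDerivAt_of_init {k : ℕ} {f : (Fin k → ℝ) → ℝ} {f' : ℝ} {x : Fin (k + 1) → ℝ}
    {j : Fin k} (h : HasLineDerivAt ℝ f f' (Fin.init x : Fin k → ℝ) (Pi.single j 1)) :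
    HasLineDerivAt ℝ (fun y : Fin (k + 1) → ℝ => f (Fin.init y : Fin k → ℝ)) f' x
      (Pi.single j.castSucc 1) := by
  unfold HasLineDerivAt at h ⊢
  have e : ∀ t : ℝ, (Fin.init (x + t • Pi.single j.castSucc (1:ℝ) : Fin (k+1) → ℝ) : Fin k → ℝ) =
      (Fin.init x : Fin k → ℝ) + t • Pi.single j 1 := by
    intro t
    ext i
    simp only [Fin.init, Pi.add_apply, Pi.smul_apply, Pi.single_apply, Fin.castSucc_inj]
  simpa only [e] using h

theorem hasLineDerivAt_last {k : ℕ} {f : (Fin k → ℝ) → ℝ → ℝ} {f' : ℝ} {x : Fin (k + 1) → ℝ}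
    (h : HasDerivAt (f (Fin.init x : Fin k → ℝ)) f' (x (Fin.last k))) :
    HasLineDerivAt ℝ (fun y : Fin (k + 1) → ℝ => f (Fin.init y : Fin k → ℝ) (y (Fin.last k))) f' x
      (Pi.single (Fin.last k) 1) := by
  unfold HasLineDerivAt
  have e : ∀ t : ℝ, (Fin.init (x + t • Pi.single (Fin.last k) (1:ℝ) : Fin (k+1) → ℝ) :
      Fin k → ℝ) = (Fin.init x : Fin k → ℝ) := by
    intro t
    ext i
    simp [Fin.init, (Fin.castSucc_lt_last i).ne]
  have e2 : ∀ t : ℝ, (x + t • Pi.single (Fin.last k) (1:ℝ) : Fin (k+1) → ℝ) (Fin.last k) =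
      x (Fin.last k) + t := by
    intro t; simp
  simp only [e, e2]
  rw [← add_zero (x (Fin.last k))] at h
  exact h.comp_const_add (x (Fin.last k)) 0

/-- `⟨x⟩ = (1 + |x|²)^{1/2}`. -/
noncomputable def japanese {k : ℕ} (x : Fin k → ℝ) : ℝ := √(1 + ∑ i, x i ^ 2)

theorem japanese_sq {k : ℕ} (x : Fin k → ℝ) : japanese x ^ 2 = 1 + ∑ i, x i ^ 2 :=
  Real.sq_sqrt (by positivity)

theorem japanese_pos {k : ℕ} (x : Fin k → ℝ) : 0 < japanese x :=
  Real.sqrt_pos.2 (by positivity)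

theorem continuous_japanese {k : ℕ} : Continuous (japanese (k := k)) := by
  unfold japanese; fun_prop

/-- This is 1 + |ξ|² + ⟨ξ⟩²z² = ⟨ξ⟩²(1 + z²). Scaling the last coordinate by ⟨ξ⟩ makes the bubble
density a product, so its conditional densities are all rescalings of one profile. -/
theorem japanese_append_mul {k : ℕ} (ξ : Fin k → ℝ) (z : ℝ) :
    japanese (append ξ (japanese ξ * z)) = japanese ξ * bracket z := by
  rw [← Real.sqrt_sq (japanese_pos ξ).le, bracket, ← Real.sqrt_mul (sq_nonneg _), japanese,
    Real.sqrt_sq (japanese_pos ξ).le]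
  congr 1
  rw [Fin.sum_univ_castSucc]
  simp only [Fin.snoc_castSucc, Fin.snoc_last, append]
  rw [mul_pow, japanese_sq]
  ring

/-- Integrating out the last coordinate with t = ⟨ξ⟩z produces one constant factor and lowers the
exponent by one, which is the same integral in one dimension less. -/
theorem lintegral_japanese (m : ℕ) (hm : 1 ≤ m) : ∀ k : ℕ,
    ∫⁻ x : Fin k → ℝ, ENNReal.ofReal ((japanese x ^ (k + m))⁻¹) =
      ENNReal.ofReal (∏ i : Fin k, bracketMass (i + m + 1)) := by
  intro k
  induction k with
  | zero => simp [japanese, volume_pi]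
  | succ k ih =>
    have hmeas : ∀ (l n : ℕ), Measurable fun x : Fin l → ℝ =>
        ENNReal.ofReal ((japanese x ^ n)⁻¹) := fun l n =>
      ((continuous_japanese.measurable.pow_const n).inv).ennreal_ofReal
    rw [lintegral_fin_succ (hmeas _ _)]
    have hin : ∀ ξ : Fin k → ℝ,
        ∫⁻ t : ℝ, ENNReal.ofReal ((japanese (append ξ t) ^ (k + 1 + m))⁻¹) =
        ENNReal.ofReal ((japanese ξ ^ (k + m))⁻¹) * ENNReal.ofReal (bracketMass (k + m + 1)) := by
      intro ξ
      have hA := japanese_pos ξ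
      have e : ∀ t : ℝ, (japanese (append ξ t) ^ (k + 1 + m))⁻¹ =
          (japanese ξ ^ (k + 1 + m))⁻¹ * (bracket (t / japanese ξ) ^ (k + 1 + m))⁻¹ := by
        intro t
        rw [← mul_inv, ← mul_pow, ← japanese_append_mul, mul_div_cancel₀ _ hA.ne']
      simp_rw [e]
      have hi := ((integrable_bracket_inv_pow (n := k + 1 + m) (by omega)).comp_div
        hA.ne').const_mul (japanese ξ ^ (k + 1 + m))⁻¹
      rw [← ofReal_integral_eq_lintegral_ofReal hi (ae_of_all _ fun t => by
        have := bracket_pos (t / japanese ξ); positivity), integral_const_mul,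
        Measure.integral_comp_div (fun t => (bracket t ^ (k + 1 + m))⁻¹) (japanese ξ),
        ← ENNReal.ofReal_mul (by positivity), abs_of_pos hA, smul_eq_mul]
      change ENNReal.ofReal (_ * (_ * bracketMass (k + 1 + m))) = _
      rw [show k + 1 + m = k + m + 1 by omega]
      congr 1
      field_simp
      ring
    simp_rw [hin]
    rw [lintegral_mul_const _ (hmeas _ _), ih, ← ENNReal.ofReal_mul, Fin.prod_univ_castSucc]
    · simp
    · exact Finset.prod_nonneg fun i _ => (bracketMass_pos (by omega)).le

/-- Knothe's triangular map of a positive density onto the bubble `(1 + |y|²)^{-(k+4)/2}`. -/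
theorem exists_knothe (k : ℕ) : ∀ {F : (Fin k → ℝ) → ℝ} {C : ℝ}, Continuous F → (∀ x, 0 < F x) →
    (∀ x, F x ≤ C * ∏ i, Real.exp (-(x i) ^ 2)) →
    ∃ T D : (Fin k → ℝ) → Fin k → ℝ, Continuous T ∧ Continuous D ∧ (∀ x i, 0 ≤ D x i) ∧
      (∀ x i, HasLineDerivAt ℝ (fun y => T y i) (D x i) x (Pi.single i 1)) ∧
      (∀ x, ∏ i, D x i = (∏ i : Fin k, bracketMass (i + 5)) * (F x / ∫ y, F y) *
        japanese (T x) ^ (k + 4)) ∧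
      ∫⁻ x, ENNReal.ofReal (F x * japanese (T x) ^ 2) =
        ENNReal.ofReal ((k + 2) / 2 * ∫ y, F y) := by
  induction k with
  | zero =>
    intro F C hF hpos hle
    refine ⟨fun _ => 0, fun _ => 0, continuous_const, continuous_const, fun _ _ => le_rfl,
      fun _ i => i.elim0, fun x => ?_, ?_⟩
    · have := (hpos default).ne'
      rw [Subsingleton.elim x default, Measure.volume_pi_eq_dirac default, integral_dirac,
        div_self this]
      simp [japanese]
    · rw [Measure.volume_pi_eq_dirac default, integral_dirac, lintegral_dirac]
      simp [japanese]
  | succ k ih =>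
    intro F C hF hpos hle
    have hC : 0 < C := by
      have h := (hpos 0).trans_le (hle 0)
      have : 0 < ∏ i : Fin (k+1), Real.exp (-((0 : Fin (k+1) → ℝ) i) ^ 2) :=
        Finset.prod_pos fun i _ => Real.exp_pos _
      exact pos_of_mul_pos_left h this.le
    set β : ℝ → ℝ := fun t => Real.exp (-t ^ 2) with hβ
    have hβi : Integrable β := by
      have := integrable_exp_neg_mul_sq (b := 1) one_pos
      simpa using this
    set Fc : (Fin k → ℝ) → ℝ → ℝ := fun ξ t => F (append ξ t) with hFc
    have hFcc : Continuous (Function.uncurry Fc) := hF.comp continuous_append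
    have hFcs : ∀ ξ, Continuous (Fc ξ) := fun ξ =>
      hFcc.comp (by fun_prop : Continuous fun x => (ξ, x))
    have hFle : ∀ ξ t, Fc ξ t ≤ (C * ∏ i, β (ξ i)) * β t := by
      intro ξ t
      refine (hle _).trans (le_of_eq ?_)
      rw [Fin.prod_univ_castSucc]
      simp only [append, Fin.snoc_castSucc, Fin.snoc_last, hβ]
      ring
    have hprod : ∀ ξ : Fin k → ℝ, ∏ i, β (ξ i) ≤ 1 := fun ξ =>
      Finset.prod_le_one (fun i _ => (Real.exp_pos _).le)
        fun i _ => Real.exp_le_one_iff.2 (by nlinarith [sq_nonneg (ξ i)])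
    have hFle' : ∀ ξ t, Fc ξ t ≤ C * β t := fun ξ t => (hFle ξ t).trans <| by
      have := hprod ξ
      have h2 : 0 < β t := Real.exp_pos _
      calc C * (∏ i, β (ξ i)) * β t ≤ C * 1 * β t := by gcongr
        _ = C * β t := by ring
    have hFpos : ∀ ξ t, 0 < Fc ξ t := fun ξ t => hpos _
    have hFi : ∀ ξ, Integrable (Fc ξ) := fun ξ => (hβi.const_mul C).mono'
      (hFcs ξ).aestronglyMeasurable
      (ae_of_all _ fun x => by rw [Real.norm_of_nonneg (hFpos ξ x).le]; exact hFle' ξ x)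
    set F' : (Fin k → ℝ) → ℝ := fun ξ => ∫ t, Fc ξ t with hF'
    have hF'c : Continuous F' :=
      continuous_integral_of_le hFcc (fun ξ x => (hFpos ξ x).le) hFle' (hβi.const_mul C)
    have hF'pos : ∀ ξ, 0 < F' ξ := fun ξ => integral_pos_of_continuous_pos (hFpos ξ) (hFi ξ)
    -- The Gaussian bound is inherited by the marginal, so the induction hypothesis applies to it.
    have hF'le : ∀ ξ, F' ξ ≤ (C * ∫ t, β t) * ∏ i, Real.exp (-(ξ i) ^ 2) := by
      intro ξ
      calc F' ξ ≤ ∫ t, (C * ∏ i, β (ξ i)) * β t :=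
            integral_mono (hFi ξ) (hβi.const_mul _) (hFle ξ)
        _ = _ := by rw [integral_const_mul]; ring
    have hint : ∫ y, F y = ∫ ξ, F' ξ := by
      rw [integral_eq_lintegral_of_nonneg_ae (ae_of_all _ fun x => (hpos x).le)
        hF.aestronglyMeasurable, integral_eq_lintegral_of_nonneg_ae
        (ae_of_all _ fun x => (hF'pos x).le) hF'c.aestronglyMeasurable,
        lintegral_fin_succ hF.measurable.ennreal_ofReal]
      congr 1
      refine lintegral_congr fun ξ => ?_
      rw [hF', ofReal_integral_eq_lintegral_ofReal (hFi ξ) (ae_of_all _ fun x => (hFpos ξ x).le)]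
    obtain ⟨T', D', hT', hD', hD'0, hTD', hdet', hmom'⟩ := ih hF'c hF'pos hF'le
    obtain ⟨ζ, hζc, hζd, hζm⟩ := exists_monotone_transport (n := k + 5) (by omega) hFcc hFpos
      hFle' (hβi.const_mul C)
    have hc := bracketMass_pos (n := k + 5) (by omega)
    have hTi : Continuous fun x : Fin (k + 1) → ℝ => T' (Fin.init x : Fin k → ℝ) :=
      hT'.comp continuous_init
    have hpair : Continuous fun x : Fin (k + 1) → ℝ => ((Fin.init x : Fin k → ℝ), x (Fin.last k)) :=
      continuous_init.prodMk (continuous_apply _)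
    have hζx : Continuous fun x : Fin (k + 1) → ℝ => ζ (Fin.init x : Fin k → ℝ) (x (Fin.last k)) :=
      hζc.comp hpair
    have hJ : Continuous fun x : Fin (k + 1) → ℝ => japanese (T' (Fin.init x : Fin k → ℝ)) :=
      continuous_japanese.comp hTi
    have happ : ∀ x : Fin (k + 1) → ℝ, append (Fin.init x : Fin k → ℝ) (x (Fin.last k)) = x :=
      fun x => Fin.snoc_init_self x
    -- The last component of the map is ⟨T'(ξ)⟩ζ(ξ, t), where T' transports the marginal and ζ
    -- rearranges the fibre over ξ; `d` is its derivative in t. Only diagonal derivatives are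
    -- recorded.
    set d : (Fin (k + 1) → ℝ) → ℝ := fun x => japanese (T' (Fin.init x : Fin k → ℝ)) *
      (bracketMass (k + 5) * (F x / F' (Fin.init x : Fin k → ℝ)) *
        bracket (ζ (Fin.init x : Fin k → ℝ) (x (Fin.last k))) ^ (k + 5)) with hd
    refine ⟨fun x => append (T' (Fin.init x : Fin k → ℝ))
      (japanese (T' (Fin.init x : Fin k → ℝ)) * ζ (Fin.init x : Fin k → ℝ) (x (Fin.last k))),
      fun x => append (D' (Fin.init x : Fin k → ℝ)) (d x),
      continuous_append.comp (hTi.prodMk (hJ.mul hζx)),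
      continuous_append.comp ((hD'.comp continuous_init).prodMk ?_), fun x i => ?_,
      fun x i => ?_, fun x => ?_, ?_⟩
    · exact hJ.mul ((continuous_const.mul (hF.div (hF'c.comp continuous_init)
        fun x => (hF'pos _).ne')).mul ((continuous_bracket.comp hζx).pow _))
    · refine Fin.lastCases ?_ (fun j => ?_) i
      · simp only [append, Fin.snoc_last, hd]
        have h1 := japanese_pos (T' (Fin.init x : Fin k → ℝ))
        have h2 := bracket_pos (ζ (Fin.init x : Fin k → ℝ) (x (Fin.last k)))
        have h3 := hpos x
        have h4 := hF'pos (Fin.init x : Fin k → ℝ)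
        positivity
      · simp only [append, Fin.snoc_castSucc]
        exact hD'0 _ _
    · refine Fin.lastCases ?_ (fun j => ?_) i
      · simp only [append, Fin.snoc_last]
        refine hasLineDerivAt_last (f := fun ξ t => japanese (T' ξ) * ζ ξ t) ?_
        have h := (hζd (Fin.init x : Fin k → ℝ) (x (Fin.last k))).const_mul
          (japanese (T' (Fin.init x : Fin k → ℝ)))
        simp only [hFc, happ] at h
        exact h
      · simp only [append, Fin.snoc_castSucc]
        exact hasLineDerivAt_of_init (f := fun ξ => T' ξ j) (hTD' _ j)
    -- The marginal supplies ⟨T'⟩^{k+4}, the fibre ⟨T'⟩⟨ζ⟩^{k+5}; since ⟨T⟩ = ⟨T'⟩⟨ζ⟩, the product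
    -- is ⟨T⟩^{k+5}. The factors of F' cancel.
    · rw [Fin.prod_univ_castSucc, Fin.prod_univ_castSucc]
      simp only [append, Fin.snoc_castSucc, Fin.snoc_last]
      rw [hdet', ← append, japanese_append_mul, hint, hd]
      simp only [Fin.val_castSucc, Fin.val_last]
      have h4 := (hF'pos (Fin.init x : Fin k → ℝ)).ne'
      field_simp
      ring
    · simp only [japanese_append_mul]
      have hmeas : Measurable fun x : Fin (k + 1) → ℝ => ENNReal.ofReal (F x *
          (japanese (T' (Fin.init x : Fin k → ℝ)) *
            bracket (ζ (Fin.init x : Fin k → ℝ) (x (Fin.last k)))) ^ 2) :=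
        (hF.mul ((hJ.mul (continuous_bracket.comp hζx)).pow 2)).measurable.ennreal_ofReal
      rw [lintegral_fin_succ hmeas]
      -- Each fibre contributes (k + 3)/(k + 2) to the moment, and with the inductive factor (k +
      -- 2)/2 the product telescopes to (k + 3)/2.
      have hin : ∀ ξ : Fin k → ℝ, ∫⁻ t, ENNReal.ofReal (F (append ξ t) *
          (japanese (T' (Fin.init (append ξ t) : Fin k → ℝ)) *
            bracket (ζ (Fin.init (append ξ t) : Fin k → ℝ) (append ξ t (Fin.last k)))) ^ 2) =
          ENNReal.ofReal (((k:ℝ) + 3) / (k + 2)) *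
            ENNReal.ofReal (F' ξ * japanese (T' ξ) ^ 2) := by
        intro ξ
        have h := hζm ξ
        simp only [append, Fin.init_snoc, Fin.snoc_last]
        have e : ∀ t, ENNReal.ofReal (F (append ξ t) * (japanese (T' ξ) * bracket (ζ ξ t)) ^ 2) =
            ENNReal.ofReal (japanese (T' ξ) ^ 2) *
              ENNReal.ofReal (Fc ξ t * (1 + ζ ξ t ^ 2)) := by
          intro t
          rw [← ENNReal.ofReal_mul (sq_nonneg _), ← bracket_sq]
          congr 1
          simp only [hFc]
          ring
        simp only [append] at e
        simp_rw [e]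
        rw [lintegral_const_mul _ (by
          refine ((hFcs ξ).mul (continuous_const.add (Continuous.pow ?_ 2))).measurable.ennreal_ofReal
          exact hζc.comp (by fun_prop : Continuous fun x => (ξ, x))), h,
          ← ENNReal.ofReal_mul (sq_nonneg _), ← ENNReal.ofReal_mul (by positivity)]
        congr 1
        push_cast
        rw [show (k:ℝ) + 5 - 2 = k + 3 by ring, show (k:ℝ) + 5 - 3 = k + 2 by ring]
        ring
      simp_rw [hin]
      have hmeas' : Measurable fun ξ : Fin k → ℝ =>
          ENNReal.ofReal (F' ξ * japanese (T' ξ) ^ 2) :=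
        (hF'c.mul ((continuous_japanese.comp hT').pow 2)).measurable.ennreal_ofReal
      rw [lintegral_const_mul _ hmeas', hmom', ← ENNReal.ofReal_mul (by positivity), hint]
      congr 1
      have : (k:ℝ) + 2 ≠ 0 := by positivity
      push_cast
      field_simp
      ring

/-! ### Cutoff functions -/

/-- A smooth bump function on `ℝ⁴`, equal to `1` on the unit ball and supported in the ball of
radius `2`. -/
noncomputable def unitBump : ContDiffBump (0 : R4) := ⟨1, 2, one_pos, one_lt_two⟩

/-- The cutoff function at scale `R`. -/
noncomputable def cutoff (R : ℝ) (x : R4) : ℝ := unitBump (R⁻¹ • x)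

theorem contDiff_cutoff (R : ℝ) {n : ℕ∞} : ContDiff ℝ n (cutoff R) :=
  unitBump.contDiff.comp (contDiff_const_smul _)

theorem cutoff_nonneg (R : ℝ) (x : R4) : 0 ≤ cutoff R x := unitBump.nonneg

theorem cutoff_le_one (R : ℝ) (x : R4) : cutoff R x ≤ 1 := unitBump.le_one

theorem cutoff_eq_one {R : ℝ} (hR : 0 < R) {x : R4} (hx : ‖x‖ ≤ R) : cutoff R x = 1 := by
  apply unitBump.one_of_mem_closedBall
  rw [mem_closedBall_zero_iff, norm_smul, Real.norm_of_nonneg (inv_nonneg.2 hR.le)]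
  change _ ≤ (1:ℝ)
  rw [inv_mul_le_iff₀ hR]; linarith

theorem cutoff_eq_zero {R : ℝ} (hR : 0 < R) {x : R4} (hx : 2 * R ≤ ‖x‖) : cutoff R x = 0 := by
  apply unitBump.zero_of_le_dist
  rw [dist_zero_right, norm_smul, Real.norm_of_nonneg (inv_nonneg.2 hR.le)]
  change (2:ℝ) ≤ _
  rw [inv_mul_eq_div, le_div_iff₀ hR]; linarith

theorem hasCompactSupport_cutoff {R : ℝ} (hR : 0 < R) : HasCompactSupport (cutoff R) :=
  HasCompactSupport.intro (isCompact_closedBall (0 : R4) (2 * R)) fun x hx =>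
    cutoff_eq_zero hR (by
      rw [mem_closedBall_zero_iff] at hx; linarith)

theorem fderiv_cutoff (R : ℝ) (x : R4) :
    fderiv ℝ (cutoff R) x = R⁻¹ • fderiv ℝ unitBump (R⁻¹ • x) := by
  have h := fderiv_comp_smul (𝕜 := ℝ) (f := (unitBump : R4 → ℝ)) (c := R⁻¹) (x := x)
  exact h

theorem exists_fderiv_cutoff_le :
    ∃ c : ℝ, 0 ≤ c ∧ ∀ R > 0, ∀ x, ‖fderiv ℝ (cutoff R) x‖ ≤ c / R := by
  have hc : HasCompactSupport (fderiv ℝ (unitBump : R4 → ℝ)) := unitBump.hasCompactSupport.fderiv ℝ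
  have hcont : Continuous (fderiv ℝ (unitBump : R4 → ℝ)) :=
    (unitBump.contDiff (n := 1)).continuous_fderiv (by norm_num)
  obtain ⟨c, hc⟩ := hc.exists_bound_of_continuous hcont
  refine ⟨c, (norm_nonneg _).trans (hc 0), fun R hR x => ?_⟩
  rw [fderiv_cutoff, norm_smul, norm_inv, Real.norm_of_nonneg hR.le, div_eq_inv_mul]
  exact mul_le_mul_of_nonneg_left (hc _) (inv_nonneg.2 hR.le)

theorem tendsto_cutoff (x : R4) : Tendsto (fun n : ℕ => cutoff (n + 1) x) atTop (𝓝 1) := by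
  refine tendsto_const_nhds.congr' ?_
  filter_upwards [eventually_ge_atTop ⌈‖x‖⌉₊] with n hn
  rw [cutoff_eq_one (by positivity)]
  have := Nat.ceil_le.1 hn
  linarith

/-! ### The sharp Sobolev inequality for positive functions by mass transport -/

theorem mul_le_pow_four {a b c d : ℝ} (ha : 0 ≤ a) (hb : 0 ≤ b) (hc : 0 ≤ c) (hd : 0 ≤ d) :
    a * b * c * d ≤ ((a + b + c + d) / 4) ^ 4 := by
  have h1 : a * b ≤ ((a + b) / 2) ^ 2 := by nlinarith [sq_nonneg (a - b)]
  have h2 : c * d ≤ ((c + d) / 2) ^ 2 := by nlinarith [sq_nonneg (c - d)]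
  have h3 : (a + b) / 2 * ((c + d) / 2) ≤ ((a + b + c + d) / 4) ^ 2 := by
    nlinarith [sq_nonneg (a + b - c - d)]
  calc a * b * c * d = (a * b) * (c * d) := by ring
    _ ≤ ((a + b) / 2) ^ 2 * ((c + d) / 2) ^ 2 := mul_le_mul h1 h2 (mul_nonneg hc hd) (sq_nonneg _)
    _ = ((a + b) / 2 * ((c + d) / 2)) ^ 2 := by ring
    _ ≤ (((a + b + c + d) / 4) ^ 2) ^ 2 := pow_le_pow_left₀ (by positivity) h3 2
    _ = _ := by ring

theorem integrable_exp_neg_mul_norm_sq {b : ℝ} (hb : 0 < b) :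
    Integrable fun x : R4 => Real.exp (-b * ‖x‖ ^ 2) := by
  have h := (GaussianFourier.integrable_cexp_neg_mul_sq_norm_add (V := R4) (b := b)
    (by simpa using hb) 0 0).norm
  refine h.congr (ae_of_all _ fun x => ?_)
  simp only [Complex.norm_exp]
  congr 1
  norm_cast
  simp

/-- The mass `∫ (1 + |y|²)⁻⁴ dy` of the bubble on `ℝ⁴`, as an iterated integral. -/
noncomputable def bubbleMass : ℝ := ∏ i : Fin 4, bracketMass (i + 5)

theorem bubbleMass_pos : 0 < bubbleMass :=
  Finset.prod_pos fun i _ => bracketMass_pos (by omega)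

/-- The data of a transport map onto the bubble density, on `ℝ⁴`. -/
theorem exists_knothe_R4 {F : R4 → ℝ} {C : ℝ} (hF : Continuous F) (hpos : ∀ x, 0 < F x)
    (hle : ∀ x, F x ≤ C * Real.exp (-‖x‖ ^ 2)) :
    ∃ (T : R4 → R4) (D : R4 → Fin 4 → ℝ), Continuous T ∧ Continuous D ∧ (∀ x i, 0 ≤ D x i) ∧
      (∀ x i, HasLineDerivAt ℝ (fun y => T y i) (D x i) x (EuclideanSpace.single i 1)) ∧
      (∀ x, ∏ i, D x i = bubbleMass * (F x / ∫ y, F y) * (1 + ‖T x‖ ^ 2) ^ 4) ∧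
      Integrable (fun x => F x * (1 + ‖T x‖ ^ 2)) ∧
      ∫ x, F x * (1 + ‖T x‖ ^ 2) = 3 * ∫ y, F y := by
  set G : (Fin 4 → ℝ) → ℝ := fun y => F (WithLp.toLp 2 y) with hG
  have hto : Continuous fun y : Fin 4 → ℝ => (WithLp.toLp 2 y : R4) := PiLp.continuous_toLp 2 _
  have hof : Continuous fun x : R4 => (WithLp.ofLp x : Fin 4 → ℝ) := PiLp.continuous_ofLp 2 _
  have hGle : ∀ y, G y ≤ C * ∏ i, Real.exp (-(y i) ^ 2) := by
    intro y
    refine (hle _).trans (le_of_eq ?_)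
    rw [← Real.exp_sum, EuclideanSpace.norm_sq_eq, Finset.sum_neg_distrib]
    simp
  obtain ⟨T, D, hT, hD, hD0, hTD, hdet, hmom⟩ := exists_knothe 4 (F := G) (hF.comp hto) (fun y => hpos _) hGle
  have hnorm : ∀ y : Fin 4 → ℝ, japanese y ^ 2 = 1 + ‖(WithLp.toLp 2 y : R4)‖ ^ 2 := by
    intro y
    rw [japanese_sq, EuclideanSpace.norm_sq_eq]
    simp
  have hvol := PiLp.volume_preserving_ofLp (Fin 4)
  have hint : ∫ y, G y = ∫ x, F x := by
    rw [← hvol.integral_comp (MeasurableEquiv.toLp 2 (Fin 4 → ℝ)).symm.measurableEmbedding]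
  simp only [hnorm] at hmom
  have hc : Continuous fun x : R4 => F x * (1 + ‖(WithLp.toLp 2 (T (WithLp.ofLp x)) : R4)‖ ^ 2) := by
    fun_prop
  have hlint : ∫⁻ x : R4, ENNReal.ofReal (F x *
      (1 + ‖(WithLp.toLp 2 (T (WithLp.ofLp x)) : R4)‖ ^ 2)) = ENNReal.ofReal (3 * ∫ y, F y) := by
    have hm : Measurable fun y : Fin 4 → ℝ => ENNReal.ofReal (G y *
      (1 + ‖(WithLp.toLp 2 (T y) : R4)‖ ^ 2)) := by
      have : Continuous fun y : Fin 4 → ℝ => G y * (1 + ‖(WithLp.toLp 2 (T y) : R4)‖ ^ 2) := by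
        fun_prop
      exact this.measurable.ennreal_ofReal
    have h := hvol.lintegral_comp hm
    rw [hmom, hint] at h
    refine h.trans ?_
    norm_num
  have hnn : ∀ x : R4, 0 ≤ F x * (1 + ‖(WithLp.toLp 2 (T (WithLp.ofLp x)) : R4)‖ ^ 2) :=
    fun x => mul_nonneg (hpos x).le (by positivity)
  refine ⟨fun x => WithLp.toLp 2 (T (WithLp.ofLp x)), fun x => D (WithLp.ofLp x), by fun_prop,
    by fun_prop, fun x i => hD0 _ i, fun x i => ?_, fun x => ?_, ?_, ?_⟩
  · have h := hTD (WithLp.ofLp x) i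
    unfold HasLineDerivAt at h ⊢
    have e : ∀ t : ℝ, WithLp.ofLp (x + t • EuclideanSpace.single i (1:ℝ)) =
        WithLp.ofLp x + t • Pi.single i 1 := fun t => by simp
    simpa only [e] using h
  · rw [hdet, ← hnorm, hint, ← pow_mul]
    rfl
  · refine ⟨hc.aestronglyMeasurable, ?_⟩
    rw [hasFiniteIntegral_iff_ofReal (ae_of_all _ hnn), hlint]
    exact ENNReal.ofReal_lt_top
  · rw [integral_eq_lintegral_of_nonneg_ae (ae_of_all _ hnn) hc.aestronglyMeasurable, hlint,
      ENNReal.toReal_ofReal]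
    have : 0 ≤ ∫ y, F y := integral_nonneg fun x => (hpos x).le
    positivity

theorem sum_smul_single (v : R4) : ∑ i, v i • EuclideanSpace.single i (1:ℝ) = v := by
  ext j
  simp [Finset.sum_apply, Pi.single_apply]

theorem clm_apply_eq_sum (L : R4 →L[ℝ] ℝ) (v : R4) :
    L v = ∑ i, L (EuclideanSpace.single i 1) * v i := by
  conv_lhs => rw [← sum_smul_single v]
  simp [mul_comm]

/-- Each component is integrated by parts along its own axis, so continuity of T and of its diagonal
line derivatives suffices. This is exactly the regularity provided by the Knothe map. -/
theorem integral_mul_divergence {T : R4 → R4} {D : R4 → Fin 4 → ℝ} (hT : Continuous T)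
    (hD : Continuous D)
    (hTD : ∀ x i, HasLineDerivAt ℝ (fun y => T y i) (D x i) x (EuclideanSpace.single i 1))
    {φ : R4 → ℝ} (hφ : ContDiff ℝ 1 φ) (hc : HasCompactSupport φ) :
    ∫ x, φ x * ∑ i, D x i = -∫ x, fderiv ℝ φ x (T x) := by
  have hφc := hφ.continuous
  have hφ' := hφ.continuous_fderiv (by norm_num)
  have hDi : ∀ i, Continuous fun x => D x i := fun i => by fun_prop
  have hTi : ∀ i, Continuous fun x => T x i := fun i => by fun_prop
  have h1 : ∀ i, Integrable fun x => φ x * D x i := fun i =>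
    (hφc.mul (hDi i)).integrable_of_hasCompactSupport hc.mul_right
  have h2 : ∀ i, Integrable fun x => fderiv ℝ φ x (EuclideanSpace.single i 1) * T x i := fun i =>
    Continuous.integrable_of_hasCompactSupport
      (Continuous.mul (by fun_prop) (hTi i))
      (HasCompactSupport.mul_right (hc.fderiv_apply ℝ _))
  have h3 : ∀ i, Integrable fun x => φ x * T x i := fun i =>
    (hφc.mul (hTi i)).integrable_of_hasCompactSupport hc.mul_right
  have key : ∀ i, ∫ x, φ x * D x i =
      -∫ x, fderiv ℝ φ x (EuclideanSpace.single i 1) * T x i := fun i =>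
    integral_bilinear_hasLineDerivAt_right_eq_neg_left_of_integrable
      (B := ContinuousLinearMap.mul ℝ ℝ) (h2 i) (h1 i) (h3 i)
      (fun x _ => ((hφ.differentiable (by norm_num)) x).hasFDerivAt.hasLineDerivAt _)
      (fun x _ => hTD x i)
  simp_rw [Finset.mul_sum]
  rw [integral_finsetSum _ fun i _ => h1 i]
  rw [integral_congr_ae (ae_of_all _ fun x => clm_apply_eq_sum (fderiv ℝ φ x) (T x)),
    integral_finsetSum _ fun i _ => h2 i, ← Finset.sum_neg_distrib]
  exact Finset.sum_congr rfl fun i _ => key i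

/-- The transport inequality f(1 + |T|²) ≲ div T is multiplied by f³ and integrated; the moments of
T are known exactly because its image density is. The Gaussian bound serves the construction of T,
and the integrability of f² serves to remove the cutoff. -/
theorem sharp_sobolev_of_pos {f : R4 → ℝ} {C : ℝ} (hf : ContDiff ℝ 1 f) (hpos : ∀ x, 0 < f x)
    (hle : ∀ x, f x ^ 4 ≤ C * Real.exp (-‖x‖ ^ 2)) (hf2 : Integrable fun x => f x ^ 2)
    (hG : Integrable fun x => ‖fderiv ℝ f x‖ ^ 2) :
    8 * √(bubbleMass * ∫ x, f x ^ 4) ≤ ∫ x, ‖fderiv ℝ f x‖ ^ 2 := by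
  obtain ⟨T, D, hT, hD, hD0, hTD, hdet, hWi, hW⟩ := exists_knothe_R4 (F := fun x => f x ^ 4)
    (hf.continuous.pow 4) (fun x => pow_pos (hpos x) 4) hle
  set M := ∫ x, f x ^ 4 with hM
  set G := ∫ x, ‖fderiv ℝ f x‖ ^ 2 with hGdef
  have hfc := hf.continuous
  have hf'c := hf.continuous_fderiv (by norm_num)
  have hfd := hf.differentiable (by norm_num)
  have hf4i : Integrable fun x => f x ^ 4 := hWi.mono' (hfc.pow 4).aestronglyMeasurable
    (ae_of_all _ fun x => by
      have := pow_pos (hpos x) 4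
      rw [Real.norm_of_nonneg this.le]
      nlinarith [sq_nonneg ‖T x‖])
  have hMpos : 0 < M := by
    rw [hM, integral_pos_iff_support_of_nonneg (fun x => by have := hpos x; positivity) hf4i]
    have : Function.support (fun x => f x ^ 4) = Set.univ := by
      ext x; simp [(hpos x).ne']
    simp [this]
  have hTi : Integrable fun x => f x ^ 4 * ‖T x‖ ^ 2 := by
    refine (hWi.sub hf4i).congr (ae_of_all _ fun x => ?_)
    simp only [Pi.sub_apply]; ring
  have hT2 : ∫ x, f x ^ 4 * ‖T x‖ ^ 2 = 2 * M := by
    have : ∀ x, f x ^ 4 * ‖T x‖ ^ 2 = f x ^ 4 * (1 + ‖T x‖ ^ 2) - f x ^ 4 := fun x => by ring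
    simp_rw [this]
    rw [integral_sub hWi hf4i, hW]; ring
  have hN := bubbleMass_pos
  -- Here κ⁴ = N/M is the ratio of the total masses, so that (κf(1 + |T|²))⁴ is the Jacobian ∏ Dᵢ.
  set κ := √(√(bubbleMass / M)) with hκ
  have hκpos : 0 < κ := by positivity
  have hκ2 : κ ^ 2 = √(bubbleMass / M) := Real.sq_sqrt (Real.sqrt_nonneg _)
  have hκ4 : κ ^ 4 = bubbleMass / M := by
    rw [show (4:ℕ) = 2 * 2 by norm_num, pow_mul, hκ2, Real.sq_sqrt (by positivity)]
  have hamgm : ∀ x, κ * f x * (1 + ‖T x‖ ^ 2) ≤ (∑ i, D x i) / 4 := by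
    intro x
    have hs : 0 ≤ ∑ i, D x i := Finset.sum_nonneg fun i _ => hD0 x i
    refine (pow_le_pow_iff_left₀ (by have := hpos x; positivity) (by positivity)
      (four_ne_zero)).1 ?_
    calc (κ * f x * (1 + ‖T x‖ ^ 2)) ^ 4 = κ ^ 4 * f x ^ 4 * (1 + ‖T x‖ ^ 2) ^ 4 := by ring
      _ = ∏ i, D x i := by rw [hκ4, hdet]; ring
      _ ≤ _ := by
        rw [Fin.prod_univ_four, Fin.sum_univ_four]
        exact mul_le_pow_four (hD0 x 0) (hD0 x 1) (hD0 x 2) (hD0 x 3)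
  obtain ⟨c, hc0, hc⟩ := exists_fderiv_cutoff_le
  have hE : Integrable fun x => f x ^ 4 * ‖T x‖ ^ 2 + f x ^ 2 := hTi.add hf2
  set E := ∫ x, f x ^ 4 * ‖T x‖ ^ 2 + f x ^ 2 with hEdef
  -- integration by parts against the truncated transport map
  have hcut : ∀ n : ℕ, κ * ∫ x, cutoff (n + 1) x * (f x ^ 4 * (1 + ‖T x‖ ^ 2)) ≤
      3 / 2 * κ * M + 3 / (16 * κ) * G + c / 8 * E * (1 / ((n : ℝ) + 1)) := by
    intro n
    have hR : (0:ℝ) < n + 1 := by positivity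
    set η := cutoff ((n:ℝ) + 1) with hη
    have hηd : ContDiff ℝ 1 η := contDiff_cutoff _
    have hηc : HasCompactSupport η := hasCompactSupport_cutoff hR
    have hφ : ContDiff ℝ 1 fun x => f x ^ 3 * η x := (hf.pow 3).mul hηd
    have hφc : HasCompactSupport fun x => f x ^ 3 * η x := hηc.mul_left
    have hibp := integral_mul_divergence hT hD hTD hφ hφc
    have hfd' : ∀ x, fderiv ℝ (fun x => f x ^ 3 * η x) x (T x) =
        3 * f x ^ 2 * η x * fderiv ℝ f x (T x) + f x ^ 3 * fderiv ℝ η x (T x) := by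
      intro x
      have h1 : HasFDerivAt (fun x => f x ^ 3) _ x := (hfd x).hasFDerivAt.pow 3
      have h2 := h1.mul ((hηd.differentiable (by norm_num)) x).hasFDerivAt
      have h3 : fderiv ℝ (fun x => f x ^ 3 * η x) x = _ := h2.fderiv
      rw [h3]
      simp
      ring
    have hint1 : Integrable fun x => η x * (f x ^ 4 * (1 + ‖T x‖ ^ 2)) :=
      Continuous.integrable_of_hasCompactSupport (by fun_prop) hηc.mul_right
    have hint2 : Integrable fun x => (f x ^ 3 * η x) * ∑ i, D x i :=
      Continuous.integrable_of_hasCompactSupport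
        (hφ.continuous.mul (by fun_prop)) hφc.mul_right
    have hb1 : Integrable fun x => (3 * κ / 4) * (f x ^ 4 * ‖T x‖ ^ 2) +
        3 / (16 * κ) * ‖fderiv ℝ f x‖ ^ 2 := (hTi.const_mul _).add (hG.const_mul _)
    have hb2 : Integrable fun x => (c / 8 * (1 / ((n:ℝ) + 1))) * (f x ^ 4 * ‖T x‖ ^ 2 + f x ^ 2) :=
      hE.const_mul _
    have hint3 : Integrable fun x => fderiv ℝ (fun x => f x ^ 3 * η x) x (T x) := by
      refine Continuous.integrable_of_hasCompactSupport
        ((hφ.continuous_fderiv (by norm_num)).clm_apply hT) ?_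
      refine HasCompactSupport.intro (hφc.fderiv ℝ).isCompact fun x hx => ?_
      rw [image_eq_zero_of_notMem_tsupport hx]; rfl
    calc κ * ∫ x, η x * (f x ^ 4 * (1 + ‖T x‖ ^ 2))
        = ∫ x, κ * (η x * (f x ^ 4 * (1 + ‖T x‖ ^ 2))) := (integral_const_mul _ _).symm
      _ ≤ ∫ x, 1 / 4 * ((f x ^ 3 * η x) * ∑ i, D x i) := by
        refine integral_mono (hint1.const_mul _) (hint2.const_mul _) fun x => ?_
        have h1 := mul_le_mul_of_nonneg_left (hamgm x)
          (mul_nonneg (pow_nonneg (hpos x).le 3) (cutoff_nonneg ((n:ℝ) + 1) x))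
        rw [← hη] at h1
        dsimp only
        linarith
      _ = ∫ x, -(1 / 4) * fderiv ℝ (fun x => f x ^ 3 * η x) x (T x) := by
        rw [integral_const_mul, hibp, integral_const_mul]; ring
      _ ≤ ∫ x, ((3 * κ / 4) * (f x ^ 4 * ‖T x‖ ^ 2) + 3 / (16 * κ) * ‖fderiv ℝ f x‖ ^ 2) +
          (c / 8 * (1 / ((n:ℝ) + 1))) * (f x ^ 4 * ‖T x‖ ^ 2 + f x ^ 2) := by
        refine integral_mono (hint3.const_mul _) (hb1.add hb2) fun x => ?_
        dsimp only
        rw [hfd']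
        have hfx := hpos x
        have hη0 : 0 ≤ η x := cutoff_nonneg _ x
        have hη1 : η x ≤ 1 := cutoff_le_one _ x
        have a1 : -(fderiv ℝ f x (T x)) ≤ ‖fderiv ℝ f x‖ * ‖T x‖ :=
          (neg_le_abs _).trans ((fderiv ℝ f x).le_opNorm _)
        have a2 : -(fderiv ℝ η x (T x)) ≤ c / ((n:ℝ) + 1) * ‖T x‖ :=
          ((neg_le_abs _).trans ((fderiv ℝ η x).le_opNorm _)).trans
            (mul_le_mul_of_nonneg_right (hc _ hR x) (norm_nonneg _))
        -- Young's inequality with the weight that gives equality for the bubble, where T = x, κ = 1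
        -- and |∇f| = 2f²|x|.
        have b1 : f x ^ 2 * η x * -(fderiv ℝ f x (T x)) ≤
            κ * (f x ^ 4 * ‖T x‖ ^ 2) + 1 / (4 * κ) * ‖fderiv ℝ f x‖ ^ 2 := by
          calc f x ^ 2 * η x * -(fderiv ℝ f x (T x))
              ≤ f x ^ 2 * η x * (‖fderiv ℝ f x‖ * ‖T x‖) := by gcongr
            _ ≤ f x ^ 2 * 1 * (‖fderiv ℝ f x‖ * ‖T x‖) := by gcongr
            _ ≤ _ := by
              have := sq_nonneg (2 * κ * (f x ^ 2 * ‖T x‖) - ‖fderiv ℝ f x‖)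
              rw [← sub_nonneg]
              have e : κ * (f x ^ 4 * ‖T x‖ ^ 2) + 1 / (4 * κ) * ‖fderiv ℝ f x‖ ^ 2 -
                f x ^ 2 * 1 * (‖fderiv ℝ f x‖ * ‖T x‖) =
                1 / (4 * κ) * (2 * κ * (f x ^ 2 * ‖T x‖) - ‖fderiv ℝ f x‖) ^ 2 := by
                field_simp; ring
              rw [e]; positivity
        -- The cutoff error: f³|T| = f · f²|T| is dominated by the integrable f² + f⁴|T|², and the
        -- gradient of the cutoff contributes a factor c/(n + 1).
        have b2 : f x ^ 3 * -(fderiv ℝ η x (T x)) ≤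
            c / ((n:ℝ) + 1) * (1 / 2 * (f x ^ 4 * ‖T x‖ ^ 2 + f x ^ 2)) := by
          calc f x ^ 3 * -(fderiv ℝ η x (T x)) ≤ f x ^ 3 * (c / ((n:ℝ) + 1) * ‖T x‖) := by gcongr
            _ = c / ((n:ℝ) + 1) * (f x * (f x ^ 2 * ‖T x‖)) := by ring
            _ ≤ _ := by
              refine mul_le_mul_of_nonneg_left ?_ (by positivity)
              nlinarith [sq_nonneg (f x - f x ^ 2 * ‖T x‖)]
        have e1 : 3 / (16 * κ) = 3 / 4 * (1 / (4 * κ)) := by field_simp; norm_num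
        have e2 : c / 8 * (1 / ((n:ℝ) + 1)) * (f x ^ 4 * ‖T x‖ ^ 2 + f x ^ 2) =
          1 / 4 * (c / ((n:ℝ) + 1) * (1 / 2 * (f x ^ 4 * ‖T x‖ ^ 2 + f x ^ 2))) := by ring
        rw [e1, e2]
        linarith
      _ = _ := by
        rw [integral_add hb1 hb2, integral_add (hTi.const_mul _) (hG.const_mul _),
          integral_const_mul, integral_const_mul, integral_const_mul, hT2]
        ring
  have hlim : Tendsto (fun n : ℕ => κ * ∫ x, cutoff (n + 1) x * (f x ^ 4 * (1 + ‖T x‖ ^ 2)))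
      atTop (𝓝 (κ * (3 * M))) := by
    refine Tendsto.const_mul _ ?_
    rw [← hW]
    refine tendsto_integral_of_dominated_convergence _ (fun n => ?_) hWi
      (fun n => ae_of_all _ fun x => ?_) (ae_of_all _ fun x => ?_)
    · have : Continuous (cutoff ((n:ℝ) + 1)) := (contDiff_cutoff _ (n := 0)).continuous
      exact Continuous.aestronglyMeasurable (by fun_prop)
    · have h1 := cutoff_nonneg ((n:ℝ) + 1) x
      have h2 : 0 ≤ f x ^ 4 * (1 + ‖T x‖ ^ 2) := by have := hpos x; positivity
      rw [Real.norm_of_nonneg (mul_nonneg h1 h2)]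
      exact mul_le_of_le_one_left h2 (cutoff_le_one _ _)
    · simpa using (tendsto_cutoff x).mul_const (f x ^ 4 * (1 + ‖T x‖ ^ 2))
  have hlim2 : Tendsto (fun n : ℕ => 3 / 2 * κ * M + 3 / (16 * κ) * G +
      c / 8 * E * (1 / ((n : ℝ) + 1))) atTop (𝓝 (3 / 2 * κ * M + 3 / (16 * κ) * G + c / 8 * E * 0)) :=
    tendsto_const_nhds.add (tendsto_one_div_add_atTop_nhds_zero_nat.const_mul _)
  have hfin := le_of_tendsto_of_tendsto' hlim hlim2 hcut
  -- In the limit 3κM ≤ (3/2)κM + 3G/(16κ), which rearranges to 8κ²M ≤ G.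
  have h8 : 8 * (κ ^ 2 * M) ≤ G := by
    have e : 3 / (16 * κ) * G = 3 * G / (16 * κ) := by ring
    rw [e] at hfin
    have h := mul_le_mul_of_nonneg_right hfin (by positivity : (0:ℝ) ≤ 16 * κ / 3)
    have e2 : (3 / 2 * κ * M + 3 * G / (16 * κ) + c / 8 * E * 0) * (16 * κ / 3) =
      8 * κ ^ 2 * M + G := by field_simp; ring
    rw [e2] at h
    nlinarith
  have e3 : κ ^ 2 * M = √(bubbleMass * M) := by
    rw [hκ2, Real.sqrt_div hN.le, Real.sqrt_mul hN.le]
    have := Real.sq_sqrt hMpos.le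
    have h0 := (Real.sqrt_pos.2 hMpos).ne'
    field_simp
    linarith
  rwa [e3] at h8

/-! ### From positive functions to test functions -/

/-- The gradient is (φ∇φ + h∇h)/√(φ² + h²), so this is Cauchy–Schwarz. It is used with h a small
Gaussian, to gain positivity, and with h constant, to regularize |φ|. -/
theorem fderiv_sqrt_sq_add_sq_le {φ h : R4 → ℝ} {x : R4} (hφ : DifferentiableAt ℝ φ x)
    (hh : DifferentiableAt ℝ h x) (hpos : 0 < φ x ^ 2 + h x ^ 2) :
    ‖fderiv ℝ (fun y => √(φ y ^ 2 + h y ^ 2)) x‖ ^ 2 ≤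
      ‖fderiv ℝ φ x‖ ^ 2 + ‖fderiv ℝ h x‖ ^ 2 := by
  have h1 : HasFDerivAt (fun y => φ y ^ 2 + h y ^ 2) _ x :=
    (hφ.hasFDerivAt.pow 2).add (hh.hasFDerivAt.pow 2)
  rw [(h1.sqrt hpos.ne').fderiv]
  have hs := Real.sqrt_pos.2 hpos
  have hs2 := Real.sq_sqrt hpos.le
  have e : ((1 / (2 * √(φ x ^ 2 + h x ^ 2))) •
      ((2 • φ x ^ (2 - 1)) • fderiv ℝ φ x + (2 • h x ^ (2 - 1)) • fderiv ℝ h x)) =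
      (√(φ x ^ 2 + h x ^ 2))⁻¹ • (φ x • fderiv ℝ φ x + h x • fderiv ℝ h x) := by
    ext v
    simp
    field_simp
  rw [e, norm_smul, norm_inv, Real.norm_of_nonneg hs.le, mul_pow, inv_pow, hs2,
    inv_mul_le_iff₀ hpos]
  have h2 : ‖φ x • fderiv ℝ φ x + h x • fderiv ℝ h x‖ ≤
      |φ x| * ‖fderiv ℝ φ x‖ + |h x| * ‖fderiv ℝ h x‖ := by
    refine (norm_add_le _ _).trans ?_
    rw [norm_smul, norm_smul, Real.norm_eq_abs, Real.norm_eq_abs]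
  refine (pow_le_pow_left₀ (norm_nonneg _) h2 2).trans ?_
  rw [← sq_abs (φ x), ← sq_abs (h x)]
  nlinarith [sq_nonneg (|φ x| * ‖fderiv ℝ h x‖ - |h x| * ‖fderiv ℝ φ x‖)]

noncomputable def gaussian (x : R4) : ℝ := Real.exp (-(1 / 4) * ‖x‖ ^ 2)

theorem contDiff_gaussian {n : ℕ∞} : ContDiff ℝ n gaussian :=
  (contDiff_const.mul (contDiff_norm_sq ℝ)).exp

theorem norm_fderiv_gaussian_sq_le (x : R4) :
    ‖fderiv ℝ gaussian x‖ ^ 2 ≤ Real.exp (-(1 / 4) * ‖x‖ ^ 2) := by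
  have h : HasFDerivAt gaussian _ x :=
    ((hasStrictFDerivAt_norm_sq x).hasFDerivAt.const_mul (-(1 / 4) : ℝ)).exp
  rw [h.fderiv, ← Nat.cast_smul_eq_nsmul ℝ 2, norm_smul, norm_smul, norm_smul, innerSL_apply_norm, Real.norm_of_nonneg (Real.exp_pos _).le]
  have hs : ‖x‖ ^ 2 / 4 ≤ Real.exp (1 / 4 * ‖x‖ ^ 2) := by
    have := Real.add_one_le_exp (1 / 4 * ‖x‖ ^ 2)
    linarith
  have e : Real.exp (-(1 / 4) * ‖x‖ ^ 2) =
      Real.exp (-(1 / 4) * ‖x‖ ^ 2) ^ 2 * Real.exp (1 / 4 * ‖x‖ ^ 2) := by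
    rw [← Real.exp_nat_mul, ← Real.exp_add]; congr 1; push_cast; ring
  conv_rhs => rw [e]
  have h1 : ‖(-(1 / 4) : ℝ)‖ = 1 / 4 := by norm_num
  calc _ = Real.exp (-(1 / 4) * ‖x‖ ^ 2) ^ 2 * (‖x‖ ^ 2 / 4) := by
        simp only [h1]
        simp
        ring
    _ ≤ _ := by gcongr

/-- The function √(φ² + ε²γ²), with γ the Gaussian, is positive and C¹, has a larger quartic
integral than φ, and has Dirichlet integral larger by at most O(ε²). Its fourth power is still
dominated by γ⁴ = exp(-|x|²), as the transport requires. -/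
theorem sharp_sobolev_test {φ : R4 → ℝ} (hφ : IsTest φ) :
    8 * √(bubbleMass * ∫ x, φ x ^ 4) ≤ ∫ x, ‖fderiv ℝ φ x‖ ^ 2 := by
  have hφ1 : ContDiff ℝ 1 φ := hφ.1.of_le (by exact_mod_cast le_top)
  have hφc := hφ1.continuous
  have hgc : Continuous gaussian := (contDiff_gaussian (n := 0)).continuous
  have hgpos : ∀ x, 0 < gaussian x := fun x => Real.exp_pos _
  have hG1 : Integrable fun x => ‖fderiv ℝ φ x‖ ^ 2 := by
    refine Continuous.integrable_of_hasCompactSupport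
      ((hφ1.continuous_fderiv (by norm_num)).norm.pow 2) ?_
    exact (hφ.2.fderiv ℝ).norm.comp_left (g := fun t : ℝ => t ^ 2) (by norm_num)
  have hG2 : Integrable fun x => ‖fderiv ℝ gaussian x‖ ^ 2 := by
    refine (integrable_exp_neg_mul_norm_sq (b := 1 / 4) (by norm_num)).mono'
      ((contDiff_gaussian (n := 1)).continuous_fderiv (by norm_num) |>.norm.pow 2).aestronglyMeasurable
      (ae_of_all _ fun x => ?_)
    rw [Real.norm_of_nonneg (by positivity)]
    exact norm_fderiv_gaussian_sq_le x
  have h4 : ∀ x, gaussian x ^ 4 = Real.exp (-‖x‖ ^ 2) := fun x => by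
    rw [gaussian, ← Real.exp_nat_mul]; congr 1; push_cast; ring
  have h2 : ∀ x, gaussian x ^ 2 = Real.exp (-(1 / 2) * ‖x‖ ^ 2) := fun x => by
    rw [gaussian, ← Real.exp_nat_mul]; congr 1; push_cast; ring
  obtain ⟨C, hC⟩ : ∃ C, ∀ x, φ x ^ 4 ≤ C * Real.exp (-‖x‖ ^ 2) := by
    have hcs : HasCompactSupport fun x => φ x ^ 4 * Real.exp (‖x‖ ^ 2) :=
      (hφ.2.comp_left (g := fun t : ℝ => t ^ 4) (by norm_num)).mul_right
    obtain ⟨C, hC⟩ := hcs.exists_bound_of_continuous (by fun_prop)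
    refine ⟨C, fun x => ?_⟩
    have h := (le_abs_self _).trans (hC x)
    rw [Real.exp_neg, ← div_eq_mul_inv, le_div_iff₀ (Real.exp_pos _)]
    exact h
  have hφ4 : Integrable fun x => φ x ^ 4 := Continuous.integrable_of_hasCompactSupport
    (hφc.pow 4) (hφ.2.comp_left (g := fun t : ℝ => t ^ 4) (by norm_num))
  have hφ2 : Integrable fun x => φ x ^ 2 := Continuous.integrable_of_hasCompactSupport
    (hφc.pow 2) (hφ.2.comp_left (g := fun t : ℝ => t ^ 2) (by norm_num))
  have hg2 : Integrable fun x => gaussian x ^ 2 := by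
    simp_rw [h2]
    exact integrable_exp_neg_mul_norm_sq (by norm_num)
  have hg4 : Integrable fun x => gaussian x ^ 4 := by
    simp_rw [h4]
    simpa using integrable_exp_neg_mul_norm_sq (b := 1) (by norm_num)
  have key : ∀ ε > 0, 8 * √(bubbleMass * ∫ x, φ x ^ 4) ≤
      (∫ x, ‖fderiv ℝ φ x‖ ^ 2) + ε ^ 2 * ∫ x, ‖fderiv ℝ gaussian x‖ ^ 2 := by
    intro ε hε
    set h : R4 → ℝ := fun x => ε * gaussian x with hh
    have hhd : ContDiff ℝ 1 h := contDiff_const.mul contDiff_gaussian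
    have hpos : ∀ x, 0 < φ x ^ 2 + h x ^ 2 := fun x => by
      have : 0 < h x := mul_pos hε (hgpos x)
      positivity
    set f : R4 → ℝ := fun x => √(φ x ^ 2 + h x ^ 2) with hf
    have hfd : ContDiff ℝ 1 f := ((hφ1.pow 2).add (hhd.pow 2)).sqrt fun x => (hpos x).ne'
    have hf2 : ∀ x, f x ^ 2 = φ x ^ 2 + h x ^ 2 := fun x => Real.sq_sqrt (hpos x).le
    have hf4 : ∀ x, f x ^ 4 = (φ x ^ 2 + h x ^ 2) ^ 2 := fun x => by
      rw [← hf2]; ring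
    have hfle : ∀ x, f x ^ 4 ≤ 2 * φ x ^ 4 + 2 * ε ^ 4 * gaussian x ^ 4 := fun x => by
      rw [hf4, hh]
      dsimp only
      nlinarith [sq_nonneg (φ x ^ 2 - (ε * gaussian x) ^ 2)]
    have hgr : ∀ x, ‖fderiv ℝ f x‖ ^ 2 ≤
        ‖fderiv ℝ φ x‖ ^ 2 + ε ^ 2 * ‖fderiv ℝ gaussian x‖ ^ 2 := fun x => by
      have hgd : DifferentiableAt ℝ gaussian x :=
        (contDiff_gaussian (n := 1)).differentiable (by norm_num) x
      have h1 := fderiv_sqrt_sq_add_sq_le ((hφ1.differentiable (by norm_num)) x)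
        ((hhd.differentiable (by norm_num)) x) (hpos x)
      have h3 : fderiv ℝ h x = ε • fderiv ℝ gaussian x := fderiv_const_mul hgd ε
      rwa [h3, norm_smul, mul_pow, Real.norm_eq_abs, sq_abs] at h1
    have hGi : Integrable fun x => ‖fderiv ℝ f x‖ ^ 2 := by
      refine (hG1.add (hG2.const_mul (ε ^ 2))).mono'
        ((hfd.continuous_fderiv (by norm_num)).norm.pow 2).aestronglyMeasurable
        (ae_of_all _ fun x => ?_)
      rw [Real.norm_of_nonneg (by positivity)]
      exact hgr x
    have hf2i : Integrable fun x => f x ^ 2 := by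
      simp_rw [hf2, hh, mul_pow]
      exact hφ2.add (hg2.const_mul _)
    have hf4i : Integrable fun x => f x ^ 4 :=
      ((hφ4.const_mul 2).add (hg4.const_mul (2 * ε ^ 4))).mono'
        (hfd.continuous.pow 4).aestronglyMeasurable (ae_of_all _ fun x => by
          rw [Real.norm_of_nonneg (by positivity)]; exact hfle x)
    have hs := sharp_sobolev_of_pos (C := 2 * C + 2 * ε ^ 4) hfd
      (fun x => Real.sqrt_pos.2 (hpos x)) (fun x => (hfle x).trans (by
        rw [h4]; linarith [hC x])) hf2i hGi
    have hmono : ∫ x, φ x ^ 4 ≤ ∫ x, f x ^ 4 := integral_mono hφ4 hf4i fun x => by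
      dsimp only
      rw [hf4]
      nlinarith [mul_nonneg (sq_nonneg (φ x)) (sq_nonneg (h x)), sq_nonneg (h x ^ 2)]
    calc 8 * √(bubbleMass * ∫ x, φ x ^ 4) ≤ 8 * √(bubbleMass * ∫ x, f x ^ 4) := by
          have := bubbleMass_pos
          gcongr
      _ ≤ ∫ x, ‖fderiv ℝ f x‖ ^ 2 := hs
      _ ≤ ∫ x, ‖fderiv ℝ φ x‖ ^ 2 + ε ^ 2 * ‖fderiv ℝ gaussian x‖ ^ 2 :=
          integral_mono hGi (hG1.add (hG2.const_mul _)) hgr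
      _ = _ := by rw [integral_add hG1 (hG2.const_mul _), integral_const_mul]
  have hlim : Tendsto (fun ε : ℝ => (∫ x, ‖fderiv ℝ φ x‖ ^ 2) +
      ε ^ 2 * ∫ x, ‖fderiv ℝ gaussian x‖ ^ 2) (𝓝[>] 0) (𝓝 (∫ x, ‖fderiv ℝ φ x‖ ^ 2)) := by
    refine tendsto_nhdsWithin_of_tendsto_nhds ?_
    have : Continuous fun ε : ℝ => (∫ x, ‖fderiv ℝ φ x‖ ^ 2) +
      ε ^ 2 * ∫ x, ‖fderiv ℝ gaussian x‖ ^ 2 := by fun_prop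
    simpa using this.tendsto 0
  exact ge_of_tendsto hlim (by filter_upwards [self_mem_nhdsWithin] with ε hε using key ε hε)

/-! ### Mollification, and passage to H¹ -/

open scoped Convolution

/-- `|ρ ⋆ v|² ≤ ρ ⋆ |v|²`. -/
theorem enorm_convolution_sq_le {E : Type*} [NormedAddCommGroup E] [NormedSpace ℝ E]
    {v : R4 → E} (hv : AEStronglyMeasurable v) (ρ : ContDiffBump (0 : R4)) (x : R4) :
    ‖(ρ.normed volume ⋆[ContinuousLinearMap.lsmul ℝ ℝ, volume] v) x‖ₑ ^ 2 ≤
      ∫⁻ t, ENNReal.ofReal (ρ.normed volume t) * ‖v (x - t)‖ₑ ^ 2 := by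
  set r : R4 → ℝ≥0∞ := fun t => ENNReal.ofReal (ρ.normed volume t) with hr
  have hrm : Measurable r := ρ.continuous_normed.measurable.ennreal_ofReal
  set ν := (volume : Measure R4).withDensity r with hν
  have hprob : IsProbabilityMeasure ν := ⟨by
    rw [hν, withDensity_apply _ MeasurableSet.univ, Measure.restrict_univ, hr,
      ← ofReal_integral_eq_lintegral_ofReal ρ.integrable_normed (ae_of_all _ ρ.nonneg_normed),
      ρ.integral_normed, ENNReal.ofReal_one]⟩
  have hvx : AEStronglyMeasurable (fun t => v (x - t)) volume :=
    hv.comp_quasiMeasurePreserving (quasiMeasurePreserving_sub_left volume x)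
  have hvν : AEStronglyMeasurable (fun t => v (x - t)) ν :=
    hvx.mono_ac (withDensity_absolutelyContinuous _ _)
  have hconv : ‖(ρ.normed volume ⋆[ContinuousLinearMap.lsmul ℝ ℝ, volume] v) x‖ₑ ≤
      eLpNorm (fun t => v (x - t)) 1 ν := by
    rw [eLpNorm_one_eq_lintegral_enorm, hν,
      lintegral_withDensity_eq_lintegral_mul₀ hrm.aemeasurable hvx.enorm]
    refine (enorm_integral_le_lintegral_enorm _).trans (le_of_eq (lintegral_congr fun t => ?_))
    simp only [ContinuousLinearMap.lsmul_apply, enorm_smul, Pi.mul_apply, hr]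
    rw [Real.enorm_of_nonneg (ρ.nonneg_normed t)]
  have h12 := eLpNorm_le_eLpNorm_of_exponent_le (p := 1) (q := 2) (by norm_num) hvν
  calc _ ≤ (eLpNorm (fun t => v (x - t)) 2 ν) ^ 2 := by
        gcongr
        exact hconv.trans h12
    _ = ∫⁻ t, ‖v (x - t)‖ₑ ^ 2 ∂ν := by
        rw [eLpNorm_eq_lintegral_rpow_enorm_toReal two_ne_zero ENNReal.ofNat_ne_top]
        rw [← ENNReal.rpow_natCast, ← ENNReal.rpow_mul]
        norm_num
    _ = _ := by
        rw [hν, lintegral_withDensity_eq_lintegral_mul₀ hrm.aemeasurable (hvx.enorm.pow_const 2)]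
        rfl

/-- Jensen's inequality and Tonelli, localized: B only has to contain the points reached from A by
steps shorter than the radius of the mollifier. The local form controls the mass of the
approximations far out. -/
theorem lintegral_convolution_sq_le {E : Type*} [NormedAddCommGroup E] [NormedSpace ℝ E]
    {v : R4 → E} (hv : AEStronglyMeasurable v) (ρ : ContDiffBump (0 : R4)) {A B : Set R4}
    (hA : MeasurableSet A) (hB : MeasurableSet B)
    (hAB : ∀ x ∈ A, ∀ t, ‖t‖ < ρ.rOut → x - t ∈ B) :
    ∫⁻ x in A, ‖(ρ.normed volume ⋆[ContinuousLinearMap.lsmul ℝ ℝ, volume] v) x‖ₑ ^ 2 ≤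
      ∫⁻ x in B, ‖v x‖ₑ ^ 2 := by
  refine (lintegral_mono fun x => enorm_convolution_sq_le hv ρ x).trans ?_
  have hrm : Measurable fun t => ENNReal.ofReal (ρ.normed volume t) :=
    ρ.continuous_normed.measurable.ennreal_ofReal
  have hac : ((volume : Measure R4).restrict A).prod (volume : Measure R4) ≪
      (volume : Measure R4).prod volume :=
    Measure.restrict_le_self.absolutelyContinuous.prod Measure.AbsolutelyContinuous.rfl
  have hjm : AEMeasurable (fun p : R4 × R4 => ‖v (p.1 - p.2)‖ₑ ^ 2)
      (((volume : Measure R4).restrict A).prod (volume : Measure R4)) :=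
    (((hv.comp_quasiMeasurePreserving
      (quasiMeasurePreserving_sub (μ := volume) (ν := volume))).enorm.pow_const 2).mono_ac hac)
  rw [lintegral_lintegral_swap
    ((hrm.comp measurable_snd).aemeasurable.mul hjm)]
  have hinner : ∀ t, ∫⁻ x in A, ENNReal.ofReal (ρ.normed volume t) * ‖v (x - t)‖ₑ ^ 2 ≤
      ENNReal.ofReal (ρ.normed volume t) * ∫⁻ x in B, ‖v x‖ₑ ^ 2 := by
    intro t
    rw [lintegral_const_mul' _ _ ENNReal.ofReal_ne_top]
    by_cases ht : ‖t‖ < ρ.rOut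
    · refine mul_le_mul_right ?_ _
      rw [← lintegral_indicator hA, ← lintegral_indicator hB,
        ← lintegral_sub_right_eq_self (B.indicator fun x => ‖v x‖ₑ ^ 2) t]
      refine lintegral_mono fun x => ?_
      by_cases hx : x ∈ A
      · rw [Set.indicator_of_mem hx, Set.indicator_of_mem (hAB x hx t ht)]
      · rw [Set.indicator_of_notMem hx]; exact zero_le
    · have : ρ.normed volume t = 0 := by
        by_contra h
        have : t ∈ Function.support (ρ.normed volume) := h
        rw [ρ.support_normed_eq, mem_ball_zero_iff] at this
        exact ht this
      simp [this]
  refine (lintegral_mono hinner).trans ?_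
  rw [lintegral_mul_const _ hrm, ← ofReal_integral_eq_lintegral_ofReal ρ.integrable_normed
    (ae_of_all _ ρ.nonneg_normed), ρ.integral_normed, ENNReal.ofReal_one, one_mul]

theorem isTest_comp_sub {ρ : R4 → ℝ} (hρ : IsTest ρ) (x : R4) : IsTest fun y => ρ (x - y) :=
  ⟨hρ.1.comp (contDiff_const.sub contDiff_id),
    hρ.2.comp_homeomorph (Homeomorph.subLeft x)⟩

/-- The classical gradient of a mollified function is the mollified weak gradient. -/
theorem fderiv_convolution {u : R4 → ℝ} {g : R4 → R4} (hug : IsWeakGrad u g)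
    (ρ : ContDiffBump (0 : R4)) (x : R4) :
    HasFDerivAt (ρ.normed volume ⋆[ContinuousLinearMap.lsmul ℝ ℝ, volume] u)
      (InnerProductSpace.toDual ℝ R4
        ((ρ.normed volume ⋆[ContinuousLinearMap.lsmul ℝ ℝ, volume] g) x)) x := by
  have hρ1 : ContDiff ℝ 1 (ρ.normed volume) := ρ.contDiff_normed
  have hρt : IsTest (ρ.normed volume) := ⟨ρ.contDiff_normed, ρ.hasCompactSupport_normed⟩
  have h := ρ.hasCompactSupport_normed (μ := volume) |>.hasFDerivAt_convolution_left
    (ContinuousLinearMap.lsmul ℝ ℝ) hρ1 hug.1 x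
  refine h.congr_fderiv ?_
  refine ContinuousLinearMap.ext fun w => ?_
  rw [clm_apply_eq_sum, clm_apply_eq_sum (InnerProductSpace.toDual ℝ R4 _)]
  refine Finset.sum_congr rfl fun i _ => ?_
  congr 1
  have hconvg : ConvolutionExistsAt (ρ.normed volume) g x (ContinuousLinearMap.lsmul ℝ ℝ) volume :=
    ρ.hasCompactSupport_normed.convolutionExists_left _ ρ.continuous_normed hug.2.1 x
  have hconvu : ConvolutionExistsAt (fderiv ℝ (ρ.normed volume)) u x
      ((ContinuousLinearMap.lsmul ℝ ℝ).precompL R4) volume :=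
    (ρ.hasCompactSupport_normed.fderiv ℝ).convolutionExists_left _
      (hρ1.continuous_fderiv (by norm_num)) hug.1 x
  have hl : ((fderiv ℝ (ρ.normed volume) ⋆[(ContinuousLinearMap.lsmul ℝ ℝ).precompL R4, volume] u) x)
      (EuclideanSpace.single i 1) =
      ∫ y, u y * fderiv ℝ (ρ.normed volume) (x - y) (EuclideanSpace.single i 1) := by
    rw [convolution_eq_swap, ContinuousLinearMap.integral_apply hconvu.integrable_swap]
    refine integral_congr_ae (ae_of_all _ fun y => ?_)
    simp [ContinuousLinearMap.precompL_apply, mul_comm]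
  have hr : (InnerProductSpace.toDual ℝ R4
      ((ρ.normed volume ⋆[ContinuousLinearMap.lsmul ℝ ℝ, volume] g) x)) (EuclideanSpace.single i 1) =
      ∫ y, g y i * ρ.normed volume (x - y) := by
    rw [InnerProductSpace.toDual_apply_apply, EuclideanSpace.inner_single_right, convolution_eq_swap]
    have := (EuclideanSpace.proj i : R4 →L[ℝ] ℝ).integral_comp_comm hconvg.integrable_swap
    simp only [one_mul, conj_trivial]
    refine this.symm.trans (integral_congr_ae (ae_of_all _ fun y => ?_))
    simp [mul_comm]
  have hw := hug.2.2 _ (isTest_comp_sub hρt x) i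
  have hd : ∀ y, fderiv ℝ (fun y => ρ.normed volume (x - y)) y (EuclideanSpace.single i 1) =
      -fderiv ℝ (ρ.normed volume) (x - y) (EuclideanSpace.single i 1) := by
    intro y
    have h1 : HasFDerivAt (fun y => ρ.normed volume (x - y)) _ y :=
      ((hρ1.differentiable (by norm_num)) (x - y)).hasFDerivAt.comp y
        ((hasFDerivAt_id y).const_sub x)
    rw [h1.fderiv]
    simp
  simp only [hd, mul_neg, integral_neg, neg_inj] at hw
  rw [hl, hr, hw]

theorem eLpNorm_two_sq {X E : Type*} [MeasurableSpace X] [NormedAddCommGroup E] (f : X → E)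
    (μ : Measure X) : eLpNorm f 2 μ ^ 2 = ∫⁻ x, ‖f x‖ₑ ^ 2 ∂μ := by
  rw [eLpNorm_eq_lintegral_rpow_enorm_toReal two_ne_zero ENNReal.ofNat_ne_top]
  rw [← ENNReal.rpow_natCast, ← ENNReal.rpow_mul]
  norm_num

theorem integral_norm_sq {X E : Type*} [MeasurableSpace X] [NormedAddCommGroup E] {f : X → E}
    {μ : Measure X} (hf : AEStronglyMeasurable f μ) :
    ∫ x, ‖f x‖ ^ 2 ∂μ = (eLpNorm f 2 μ).toReal ^ 2 := by
  rw [integral_eq_lintegral_of_nonneg_ae (f := fun x => ‖f x‖ ^ 2)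
    (ae_of_all _ fun x => by positivity) (hf.norm.pow 2), ← ENNReal.toReal_pow, eLpNorm_two_sq]
  congr 1
  refine lintegral_congr fun x => ?_
  rw [ENNReal.ofReal_pow (norm_nonneg _), ofReal_norm]

theorem integrable_norm_sq {X E : Type*} [MeasurableSpace X] [NormedAddCommGroup E] {f : X → E}
    {μ : Measure X} (hf : MemLp f 2 μ) : Integrable (fun x => ‖f x‖ ^ 2) μ :=
  hf.integrable_norm_pow two_ne_zero

/-- The mollifier at scale `1 / (n + 1)`. -/
noncomputable def mollifier (n : ℕ) : ContDiffBump (0 : R4) :=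
  ⟨((n : ℝ) + 1)⁻¹ / 2, ((n : ℝ) + 1)⁻¹, by positivity, half_lt_self (by positivity)⟩

theorem eLpNorm_convolution_le {E : Type*} [NormedAddCommGroup E] [NormedSpace ℝ E]
    {v : R4 → E} (hv : AEStronglyMeasurable v) (ρ : ContDiffBump (0 : R4)) {A B : Set R4}
    (hA : MeasurableSet A) (hB : MeasurableSet B)
    (hAB : ∀ x ∈ A, ∀ t, ‖t‖ < ρ.rOut → x - t ∈ B) :
    eLpNorm (ρ.normed volume ⋆[ContinuousLinearMap.lsmul ℝ ℝ, volume] v) 2 (volume.restrict A) ≤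
      eLpNorm v 2 (volume.restrict B) := by
  have h := lintegral_convolution_sq_le hv ρ hA hB hAB
  rw [← eLpNorm_two_sq, ← eLpNorm_two_sq] at h
  exact (ENNReal.pow_le_pow_left_iff two_ne_zero).1 h

/-- Functions of `H¹` are approximated by test functions, almost everywhere and without increase
of the Dirichlet integral in the limit. -/
theorem exists_test_approx {u : R4 → ℝ} {g : R4 → R4} (hu : MemLp u 2 volume)
    (hug : IsWeakGrad u g) (hg : MemLp g 2 volume) :
    ∃ (φ : ℕ → R4 → ℝ) (B : ℕ → ℝ), (∀ n, IsTest (φ n)) ∧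
      (∀ᵐ x, Tendsto (fun n => φ n x) atTop (𝓝 (u x))) ∧
      Tendsto B atTop (𝓝 (∫ x, ‖g x‖ ^ 2)) ∧ (∀ n, ∫ x, ‖fderiv ℝ (φ n) x‖ ^ 2 ≤ B n) ∧
      ∀ n r, eLpNorm (φ n) 2 (volume.restrict {x | r < ‖x‖}) ≤
        eLpNorm u 2 (volume.restrict {x | r - 1 < ‖x‖}) := by
  set v : ℕ → R4 → ℝ := fun n =>
    ((mollifier n).normed volume ⋆[ContinuousLinearMap.lsmul ℝ ℝ, volume] u) with hv
  set w : ℕ → R4 → R4 := fun n =>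
    ((mollifier n).normed volume ⋆[ContinuousLinearMap.lsmul ℝ ℝ, volume] g) with hw
  have hvd : ∀ n, ContDiff ℝ ∞ (v n) := fun n =>
    (mollifier n).hasCompactSupport_normed.contDiff_convolution_left _
      (mollifier n).contDiff_normed hug.1
  have hwc : ∀ n, Continuous (w n) := fun n =>
    (mollifier n).hasCompactSupport_normed.continuous_convolution_left _
      (mollifier n).continuous_normed hug.2.1
  have hφt : ∀ n : ℕ, IsTest fun x => cutoff ((n:ℝ) + 1) x * v n x := fun n =>
    ⟨(contDiff_cutoff _ (n := ⊤)).mul (hvd n), (hasCompactSupport_cutoff (by positivity)).mul_right⟩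
  obtain ⟨c, hc0, hc⟩ := exists_fderiv_cutoff_le
  set a := (eLpNorm g 2 volume).toReal with ha
  set b := (eLpNorm u 2 volume).toReal with hb
  -- Mollifying does not increase the L² norm of the gradient, and the cutoff adds at most c/(n + 1)
  -- times the L² norm of u.
  refine ⟨fun n x => cutoff ((n:ℝ) + 1) x * v n x, fun n => (a + c * (1 / ((n:ℝ) + 1)) * b) ^ 2,
    hφt, ?_, ?_, fun n => ?_, fun n r => ?_⟩
  · have h0 : Tendsto (fun n => (mollifier n).rOut) atTop (𝓝 0) := by
      have := tendsto_one_div_add_atTop_nhds_zero_nat (𝕜 := ℝ)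
      refine this.congr fun n => ?_
      simp [mollifier]
    have h1 : ∀ᶠ n in atTop, (mollifier n).rOut ≤ 2 * (mollifier n).rIn :=
      Eventually.of_forall fun n => by simp [mollifier]; linarith
    filter_upwards [ContDiffBump.ae_convolution_tendsto_right_of_locallyIntegrable h0 h1 hug.1]
      with x hx
    simpa using (tendsto_cutoff x).mul hx
  · rw [integral_norm_sq hg.1]
    have h := (((tendsto_one_div_add_atTop_nhds_zero_nat (𝕜 := ℝ)).const_mul c).mul_const
      b).const_add a
    simpa using h.pow 2
  · have hR : (0:ℝ) < n + 1 := by positivity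
    have hfd : ∀ x, ‖fderiv ℝ (fun x => cutoff ((n:ℝ) + 1) x * v n x) x‖ ≤
        ‖w n x‖ + c / (n + 1) * ‖v n x‖ := by
      intro x
      have h2 := ((contDiff_cutoff ((n:ℝ) + 1) (n := 1)).differentiable (by norm_num)
        x).hasFDerivAt.mul (fderiv_convolution hug (mollifier n) x)
      have h3 : fderiv ℝ (fun x => cutoff ((n:ℝ) + 1) x * v n x) x = _ := h2.fderiv
      rw [h3]
      refine (norm_add_le _ _).trans ?_
      rw [norm_smul, norm_smul, LinearIsometryEquiv.norm_map,
        Real.norm_of_nonneg (cutoff_nonneg _ _)]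
      have h4 := hc _ hR x
      refine add_le_add (mul_le_of_le_one_left (norm_nonneg _) (cutoff_le_one _ _)) ?_
      rw [mul_comm]
      exact mul_le_mul_of_nonneg_right h4 (norm_nonneg _)
    have hsm : AEStronglyMeasurable (fderiv ℝ fun x => cutoff ((n:ℝ) + 1) x * v n x) volume :=
      ((hφt n).1.continuous_fderiv (by norm_num)).aestronglyMeasurable
    have hW : eLpNorm (w n) 2 volume ≤ eLpNorm g 2 volume := by
      simpa using eLpNorm_convolution_le hg.1 (mollifier n) MeasurableSet.univ MeasurableSet.univ
        (fun _ _ _ _ => Set.mem_univ _)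
    have hV : eLpNorm (v n) 2 volume ≤ eLpNorm u 2 volume := by
      simpa using eLpNorm_convolution_le hu.1 (mollifier n) MeasurableSet.univ MeasurableSet.univ
        (fun _ _ _ _ => Set.mem_univ _)
    have key : eLpNorm (fderiv ℝ fun x => cutoff ((n:ℝ) + 1) x * v n x) 2 volume ≤
        eLpNorm g 2 volume + ENNReal.ofReal (c / (n + 1)) * eLpNorm u 2 volume := by
      refine (eLpNorm_mono_real hfd).trans ?_
      refine (eLpNorm_add_le (hwc n).norm.aestronglyMeasurable
        ((hvd n).continuous.norm.const_mul _).aestronglyMeasurable (by norm_num)).trans ?_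
      refine add_le_add ((eLpNorm_norm _).trans_le hW) ?_
      have := eLpNorm_const_smul (c / ((n:ℝ) + 1)) (fun x => ‖v n x‖) 2 (volume : Measure R4)
      simp only [Pi.smul_def, smul_eq_mul] at this
      rw [this, Real.enorm_of_nonneg (by positivity), eLpNorm_norm]
      gcongr
    rw [integral_norm_sq hsm]
    have hne : ENNReal.ofReal (c / (n + 1)) * eLpNorm u 2 volume ≠ ⊤ :=
      ENNReal.mul_ne_top ENNReal.ofReal_ne_top hu.2.ne
    have h5 := ENNReal.toReal_mono (ENNReal.add_ne_top.2 ⟨hg.2.ne, hne⟩) key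
    rw [ENNReal.toReal_add hg.2.ne hne, ENNReal.toReal_mul,
      ENNReal.toReal_ofReal (by positivity)] at h5
    refine pow_le_pow_left₀ ENNReal.toReal_nonneg (h5.trans (le_of_eq ?_)) 2
    rw [ha, hb]; ring
  · refine (eLpNorm_mono (g := v n) fun x => ?_).trans (eLpNorm_convolution_le hu.1 (mollifier n)
      (measurableSet_lt measurable_const measurable_norm)
      (measurableSet_lt measurable_const measurable_norm) fun x hx t ht => ?_)
    · rw [norm_mul, Real.norm_of_nonneg (cutoff_nonneg _ _)]
      exact mul_le_of_le_one_left (norm_nonneg _) (cutoff_le_one _ _)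
    · simp only [Set.mem_ofPred_eq] at hx ⊢
      have h1 : (mollifier n).rOut ≤ 1 := by
        simp only [mollifier]
        exact inv_le_one_of_one_le₀ (by linarith [Nat.cast_nonneg (α := ℝ) n])
      have h2 := norm_sub_norm_le x t
      linarith

/-- A Sobolev inequality for test functions passes to almost everywhere limits. -/
theorem sobolev_of_tendsto {κ : ℝ} (hκ : 0 < κ)
    (hS : ∀ φ, IsTest φ → κ * √(∫ x, φ x ^ 4) ≤ ∫ x, ‖fderiv ℝ φ x‖ ^ 2)
    {w : ℕ → R4 → ℝ} {u : R4 → ℝ} {B : ℕ → ℝ} {b : ℝ}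
    (hw : ∀ n, IsTest (w n)) (hlim : ∀ᵐ x, Tendsto (fun n => w n x) atTop (𝓝 (u x)))
    (hB : Tendsto B atTop (𝓝 b)) (hle : ∀ n, ∫ x, ‖fderiv ℝ (w n) x‖ ^ 2 ≤ B n) :
    Integrable (fun x => u x ^ 4) ∧ κ * √(∫ x, u x ^ 4) ≤ b := by
  have hwc : ∀ n, Continuous (w n) := fun n => (hw n).1.continuous
  have hum : AEStronglyMeasurable u volume :=
    aestronglyMeasurable_of_tendsto_ae _ (fun n => (hwc n).aestronglyMeasurable) hlim
  have hwi : ∀ n, Integrable fun x => w n x ^ 4 := fun n =>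
    Continuous.integrable_of_hasCompactSupport ((hwc n).pow 4)
      ((hw n).2.comp_left (g := fun t : ℝ => t ^ 4) (by norm_num))
  have hb0 : ∀ n, 0 ≤ B n := fun n =>
    (integral_nonneg fun x => by positivity).trans (hle n)
  have hb : 0 ≤ b := ge_of_tendsto' hB hb0
  have hn : ∀ n, ∫ x, w n x ^ 4 ≤ (B n / κ) ^ 2 := fun n => by
    have h := (hS _ (hw n)).trans (hle n)
    rw [← Real.sqrt_le_left (div_nonneg (hb0 n) hκ.le), le_div_iff₀ hκ]
    linarith
  -- Fatou's lemma; it also provides the integrability of u⁴, which is not assumed.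
  have hlint : ∫⁻ x, ENNReal.ofReal (u x ^ 4) ≤ ENNReal.ofReal ((b / κ) ^ 2) := by
    calc ∫⁻ x, ENNReal.ofReal (u x ^ 4)
        = ∫⁻ x, liminf (fun n => ENNReal.ofReal (w n x ^ 4)) atTop := by
          refine lintegral_congr_ae ?_
          filter_upwards [hlim] with x hx
          exact ((ENNReal.continuous_ofReal.tendsto _).comp (hx.pow 4)).liminf_eq.symm
      _ ≤ liminf (fun n => ∫⁻ x, ENNReal.ofReal (w n x ^ 4)) atTop :=
          lintegral_liminf_le fun n => ((hwc n).pow 4).measurable.ennreal_ofReal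
      _ ≤ liminf (fun n => ENNReal.ofReal ((B n / κ) ^ 2)) atTop := by
          refine liminf_le_liminf (Eventually.of_forall fun n => ?_)
          rw [← ofReal_integral_eq_lintegral_ofReal (hwi n) (ae_of_all _ fun x => by positivity)]
          exact ENNReal.ofReal_le_ofReal (hn n)
      _ = _ := Tendsto.liminf_eq ((ENNReal.continuous_ofReal.tendsto _).comp
          ((hB.div_const κ).pow 2))
  have hint : Integrable fun x => u x ^ 4 := by
    refine ⟨hum.pow 4, ?_⟩
    rw [hasFiniteIntegral_iff_ofReal (ae_of_all _ fun x => by positivity)]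
    exact hlint.trans_lt ENNReal.ofReal_lt_top
  refine ⟨hint, ?_⟩
  rw [← ofReal_integral_eq_lintegral_ofReal hint (ae_of_all _ fun x => by positivity),
    ENNReal.ofReal_le_ofReal_iff (by positivity), ← Real.sqrt_le_left (by positivity),
    le_div_iff₀ hκ] at hlint
  linarith

/-- The sharp Sobolev constant of `ℝ⁴`. -/
noncomputable def sharpS : ℝ := 8 * √bubbleMass

theorem sharpS_pos : 0 < sharpS := mul_pos (by norm_num) (Real.sqrt_pos.2 bubbleMass_pos)

theorem sharpS_sq : sharpS ^ 2 = 64 * bubbleMass := by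
  rw [sharpS, mul_pow, Real.sq_sqrt bubbleMass_pos.le]; norm_num

theorem sharpS_mul_sqrt_le (φ : R4 → ℝ) (hφ : IsTest φ) :
    sharpS * √(∫ x, φ x ^ 4) ≤ ∫ x, ‖fderiv ℝ φ x‖ ^ 2 := by
  rw [sharpS, mul_assoc, ← Real.sqrt_mul bubbleMass_pos.le]
  exact sharp_sobolev_test hφ

/-- The constant is left free because the result serves twice: for the transport constant `sharpS`,
and for `sobolevS` before the two are known to agree. -/
theorem sobolev_H1 {κ : ℝ} (hκ : 0 < κ)
    (hS : ∀ φ, IsTest φ → κ * √(∫ x, φ x ^ 4) ≤ ∫ x, ‖fderiv ℝ φ x‖ ^ 2)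
    {u : R4 → ℝ} {g : R4 → R4} (hu : MemLp u 2 volume)
    (hug : IsWeakGrad u g) (hg : MemLp g 2 volume) :
    Integrable (fun x => u x ^ 4) ∧ κ * √(∫ x, u x ^ 4) ≤ ∫ x, ‖g x‖ ^ 2 := by
  obtain ⟨φ, B, hφ, hlim, hB, hle, -⟩ := exists_test_approx hu hug hg
  exact sobolev_of_tendsto hκ hS hφ hlim hB hle

/-! ### Strictness of the Sobolev inequality on H¹ -/

theorem norm_clm_sq (L : R4 →L[ℝ] ℝ) : ‖L‖ ^ 2 = ∑ i, L (EuclideanSpace.single i 1) ^ 2 := by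
  rw [← (InnerProductSpace.toDual ℝ R4).symm.norm_map L, EuclideanSpace.norm_sq_eq]
  refine Finset.sum_congr rfl fun i _ => ?_
  rw [Real.norm_eq_abs, sq_abs]
  congr 1
  have h := InnerProductSpace.toDual_symm_apply (𝕜 := ℝ) (x := EuclideanSpace.single i (1:ℝ)) (y := L)
  rw [← h, EuclideanSpace.inner_single_right]
  simp

/-- The Laplacian of the cutoff function at scale `R`. -/
noncomputable def lapCutoff (R : ℝ) (x : R4) : ℝ :=
  ∑ i, fderiv ℝ (fun y => fderiv ℝ (cutoff R) y (EuclideanSpace.single i 1)) x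
    (EuclideanSpace.single i 1)

theorem contDiff_fderiv_cutoff_apply (R : ℝ) (v : R4) {n : ℕ∞} :
    ContDiff ℝ n fun y => fderiv ℝ (cutoff R) y v :=
  ((contDiff_cutoff R (n := ⊤)).fderiv_right (by exact_mod_cast le_top)).clm_apply contDiff_const

theorem continuous_lapCutoff (R : ℝ) : Continuous (lapCutoff R) :=
  continuous_finsetSum _ fun i _ =>
    ((contDiff_fderiv_cutoff_apply R _ (n := 1)).continuous_fderiv (by norm_num)).clm_apply
      continuous_const

theorem hasCompactSupport_lapCutoff {R : ℝ} (hR : 0 < R) : HasCompactSupport (lapCutoff R) := by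
  refine HasCompactSupport.intro (isCompact_closedBall (0 : R4) (2 * R)) fun x hx => ?_
  rw [lapCutoff]
  refine Finset.sum_eq_zero fun i _ => ?_
  have hev : cutoff R =ᶠ[𝓝 x] fun _ => 0 := by
    filter_upwards [Metric.isClosed_closedBall.isOpen_compl.mem_nhds hx] with y hy
    rw [Set.mem_compl_iff, mem_closedBall_zero_iff] at hy
    exact cutoff_eq_zero hR (by linarith)
  have h1 := hev.fderiv (𝕜 := ℝ)
  have h2 : (fun y => fderiv ℝ (cutoff R) y (EuclideanSpace.single i 1)) =ᶠ[𝓝 x] fun _ => 0 := by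
    filter_upwards [h1] with y hy
    rw [hy]; simp
  rw [h2.fderiv_eq]; simp

theorem lapCutoff_eq_zero {R : ℝ} (hR : 0 < R) {x : R4} (hx : ‖x‖ < R) : lapCutoff R x = 0 := by
  rw [lapCutoff]
  refine Finset.sum_eq_zero fun i _ => ?_
  have hev : cutoff R =ᶠ[𝓝 x] fun _ => 1 := by
    filter_upwards [Metric.isOpen_ball.mem_nhds (mem_ball_zero_iff.2 hx)] with y hy
    exact cutoff_eq_one hR (mem_ball_zero_iff.1 hy).le
  have h1 := hev.fderiv (𝕜 := ℝ)
  have h2 : (fun y => fderiv ℝ (cutoff R) y (EuclideanSpace.single i 1)) =ᶠ[𝓝 x] fun _ => 0 := by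
    filter_upwards [h1] with y hy
    rw [hy]; simp
  rw [h2.fderiv_eq]; simp

theorem lapCutoff_scale (R : ℝ) (x : R4) :
    lapCutoff R x = (R⁻¹) ^ 2 * lapCutoff 1 (R⁻¹ • x) := by
  have h1 : ∀ y, cutoff 1 y = unitBump y := fun y => by simp [cutoff]
  have h1' : cutoff 1 = unitBump := funext h1
  rw [lapCutoff, lapCutoff, Finset.mul_sum]
  refine Finset.sum_congr rfl fun i _ => ?_
  have h2 : (fun y => fderiv ℝ (cutoff R) y (EuclideanSpace.single i 1)) = fun y =>
      R⁻¹ * (fun z => fderiv ℝ (cutoff 1) z (EuclideanSpace.single i 1)) (R⁻¹ • y) := by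
    funext y
    rw [fderiv_cutoff, h1']
    simp
  rw [h2]
  have hd := (contDiff_fderiv_cutoff_apply 1 (EuclideanSpace.single i 1) (n := 1)).differentiable
    (by norm_num)
  have h3 := fderiv_comp_smul (𝕜 := ℝ)
    (f := fun z => fderiv ℝ (cutoff 1) z (EuclideanSpace.single i 1)) (c := R⁻¹) (x := x)
  have hd' : DifferentiableAt ℝ
      (fun y : R4 => (fun z => fderiv ℝ (cutoff 1) z (EuclideanSpace.single i 1)) (R⁻¹ • y)) x :=
    (hd (R⁻¹ • x)).comp x (differentiableAt_id.const_smul R⁻¹)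
  rw [fderiv_const_mul hd', h3]
  simp
  ring

/-- The factors R⁻⁴ (from squaring the Laplacian) and R⁴ (from the volume) cancel precisely in
dimension four. -/
theorem integral_lapCutoff_sq {R : ℝ} (hR : 0 < R) :
    ∫ x, lapCutoff R x ^ 2 = ∫ x, lapCutoff 1 x ^ 2 := by
  simp_rw [lapCutoff_scale R, mul_pow]
  rw [integral_const_mul, Measure.integral_comp_smul volume (fun x => lapCutoff 1 x ^ 2)]
  simp only [finrank_euclideanSpace, Fintype.card_fin, smul_eq_mul]
  rw [abs_of_pos (by positivity)]
  field_simp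

theorem integral_fderiv_mul_fderiv_cutoff {ψ : R4 → ℝ} (hψ : IsTest ψ) (R : ℝ) :
    ∫ x, ∑ i, fderiv ℝ ψ x (EuclideanSpace.single i 1) *
      fderiv ℝ (cutoff R) x (EuclideanSpace.single i 1) = -∫ x, ψ x * lapCutoff R x := by
  have hψ1 : ContDiff ℝ 1 ψ := hψ.1.of_le (by exact_mod_cast le_top)
  have hψc := hψ1.continuous
  have hψd := hψ1.continuous_fderiv (by norm_num)
  have hη := fun i : Fin 4 =>
    contDiff_fderiv_cutoff_apply R (EuclideanSpace.single i 1) (n := 1)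
  have hηd := fun i : Fin 4 => (hη i).continuous_fderiv (by norm_num)
  have i1 : ∀ i : Fin 4, Integrable fun x => fderiv ℝ ψ x (EuclideanSpace.single i 1) *
      fderiv ℝ (cutoff R) x (EuclideanSpace.single i 1) := fun i =>
    Continuous.integrable_of_hasCompactSupport
      ((hψd.clm_apply continuous_const).mul (hη i).continuous) (hψ.2.fderiv_apply ℝ _).mul_right
  have i2 : ∀ i : Fin 4, Integrable fun x => ψ x *
      fderiv ℝ (fun y => fderiv ℝ (cutoff R) y (EuclideanSpace.single i 1)) x
        (EuclideanSpace.single i 1) := fun i =>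
    Continuous.integrable_of_hasCompactSupport
      (hψc.mul ((hηd i).clm_apply continuous_const)) hψ.2.mul_right
  have i3 : ∀ i : Fin 4, Integrable fun x => ψ x *
      fderiv ℝ (cutoff R) x (EuclideanSpace.single i 1) := fun i =>
    Continuous.integrable_of_hasCompactSupport (hψc.mul (hη i).continuous) hψ.2.mul_right
  rw [integral_finsetSum _ fun i _ => i1 i]
  simp only [lapCutoff, Finset.mul_sum]
  rw [integral_finsetSum _ fun i _ => i2 i, ← Finset.sum_neg_distrib]
  refine Finset.sum_congr rfl fun i _ => ?_
  rw [integral_mul_fderiv_eq_neg_fderiv_mul_of_integrable (i1 i) (i2 i) (i3 i)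
    (fun x _ => hψ1.differentiable (by norm_num) x)
    (fun x _ => (hη i).differentiable (by norm_num) x), neg_neg]

theorem isTest_sqrt_sub {φ : R4 → ℝ} (hφ : IsTest φ) {ε : ℝ} (hε : 0 < ε) :
    IsTest fun x => √(φ x ^ 2 + ε ^ 2) - ε :=
  ⟨((hφ.1.pow 2).add contDiff_const).sqrt (fun x => by positivity) |>.sub contDiff_const,
    hφ.2.comp_left (g := fun t : ℝ => √(t ^ 2 + ε ^ 2) - ε) (by
      simp [Real.sqrt_sq hε.le])⟩

theorem norm_fderiv_sqrt_sub_sq_le {φ : R4 → ℝ} (hφ : IsTest φ) {ε : ℝ} (hε : 0 < ε) (x : R4) :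
    ‖fderiv ℝ (fun x => √(φ x ^ 2 + ε ^ 2) - ε) x‖ ^ 2 ≤ ‖fderiv ℝ φ x‖ ^ 2 := by
  have h := fderiv_sqrt_sq_add_sq_le (h := fun _ => ε)
    (hφ.1.differentiable (by norm_num) x) (differentiableAt_const (c := ε) (x := x))
    (by positivity)
  rw [fderiv_sub_const]
  simpa using h

theorem sqrt_sub_nonneg (a ε : ℝ) : 0 ≤ √(a ^ 2 + ε ^ 2) - ε := by
  rw [sub_nonneg]
  exact Real.le_sqrt_of_sq_le (by nlinarith [sq_nonneg a])

theorem sqrt_sub_le_abs (a : ℝ) {ε : ℝ} (hε : 0 < ε) : √(a ^ 2 + ε ^ 2) - ε ≤ |a| := by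
  rw [sub_le_iff_le_add, Real.sqrt_le_left (by positivity), ← sq_abs a]
  nlinarith [abs_nonneg a]

theorem integrable_norm_fderiv_sq {φ : R4 → ℝ} (hφ : IsTest φ) :
    Integrable fun x => ‖fderiv ℝ φ x‖ ^ 2 :=
  Continuous.integrable_of_hasCompactSupport
    ((hφ.1.continuous_fderiv (by norm_num)).norm.pow 2)
    ((hφ.2.fderiv ℝ).norm.comp_left (g := fun t : ℝ => t ^ 2) (by norm_num))

/-- The Dirichlet integral of a small perturbation of the regularized modulus of `φ`. -/
theorem dirichlet_perturbation_le {φ : R4 → ℝ} (hφ : IsTest φ) {ε t s R : ℝ} (hε : 0 < ε)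
    (ht : 0 ≤ t) (hs : 0 < s) (hR : 0 < R) {r : ℝ} (hr : r < R) :
    ∫ x, ‖fderiv ℝ (fun x => √(φ x ^ 2 + ε ^ 2) - ε + t * cutoff R x) x‖ ^ 2 ≤
      (∫ x, ‖fderiv ℝ φ x‖ ^ 2) +
      t * (s * (∫ x in {x | r < ‖x‖}, φ x ^ 2) + s⁻¹ * ∫ x, lapCutoff 1 x ^ 2) +
      t ^ 2 * ∫ x, ‖fderiv ℝ (cutoff R) x‖ ^ 2 := by
  set ψ : R4 → ℝ := fun x => √(φ x ^ 2 + ε ^ 2) - ε with hψdef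
  have hψ : IsTest ψ := isTest_sqrt_sub hφ hε
  have hη : IsTest (cutoff R) := ⟨contDiff_cutoff R (n := ⊤), hasCompactSupport_cutoff hR⟩
  have hψd := hψ.1.continuous_fderiv (by norm_num)
  have hηd := hη.1.continuous_fderiv (by norm_num)
  have i1 := integrable_norm_fderiv_sq hψ
  have i2 := integrable_norm_fderiv_sq hη
  have i3 : Integrable fun x => ∑ i, fderiv ℝ ψ x (EuclideanSpace.single i 1) *
      fderiv ℝ (cutoff R) x (EuclideanSpace.single i 1) :=
    integrable_finsetSum _ fun i _ => Continuous.integrable_of_hasCompactSupport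
      ((hψd.clm_apply continuous_const).mul (hηd.clm_apply continuous_const))
      (hψ.2.fderiv_apply ℝ _).mul_right
  have hexp : ∀ x, ‖fderiv ℝ (fun x => ψ x + t * cutoff R x) x‖ ^ 2 =
      ‖fderiv ℝ ψ x‖ ^ 2 + 2 * t * (∑ i, fderiv ℝ ψ x (EuclideanSpace.single i 1) *
      fderiv ℝ (cutoff R) x (EuclideanSpace.single i 1)) + t ^ 2 * ‖fderiv ℝ (cutoff R) x‖ ^ 2 := by
    intro x
    have h1 : fderiv ℝ (fun x => ψ x + t * cutoff R x) x =
        fderiv ℝ ψ x + t • fderiv ℝ (cutoff R) x :=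
      ((hψ.1.differentiable (by norm_num) x).hasFDerivAt.add
        ((hη.1.differentiable (by norm_num) x).hasFDerivAt.const_mul t)).fderiv
    rw [h1, norm_clm_sq, norm_clm_sq, norm_clm_sq, Finset.mul_sum, Finset.mul_sum,
      ← Finset.sum_add_distrib, ← Finset.sum_add_distrib]
    refine Finset.sum_congr rfl fun i _ => ?_
    simp
    ring
  change ∫ x, ‖fderiv ℝ (fun x => ψ x + t * cutoff R x) x‖ ^ 2 ≤ _
  simp_rw [hexp]
  have i13 : Integrable fun x => ‖fderiv ℝ ψ x‖ ^ 2 +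
      2 * t * ∑ i, fderiv ℝ ψ x (EuclideanSpace.single i 1) *
        fderiv ℝ (cutoff R) x (EuclideanSpace.single i 1) := i1.add (i3.const_mul _)
  rw [integral_add i13 (i2.const_mul _), integral_add i1 (i3.const_mul _),
    integral_const_mul, integral_const_mul, integral_fderiv_mul_fderiv_cutoff hψ]
  have hG : ∫ x, ‖fderiv ℝ ψ x‖ ^ 2 ≤ ∫ x, ‖fderiv ℝ φ x‖ ^ 2 :=
    integral_mono i1 (integrable_norm_fderiv_sq hφ) fun x => norm_fderiv_sqrt_sub_sq_le hφ hε x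
  have hmA : MeasurableSet {x : R4 | r < ‖x‖} := measurableSet_lt measurable_const measurable_norm
  have hφ2 : Integrable fun x => φ x ^ 2 := Continuous.integrable_of_hasCompactSupport
    (hφ.1.continuous.pow 2) (hφ.2.comp_left (g := fun t : ℝ => t ^ 2) (by norm_num))
  have hlap2 : Integrable fun x => lapCutoff R x ^ 2 := Continuous.integrable_of_hasCompactSupport
    ((continuous_lapCutoff R).pow 2)
    ((hasCompactSupport_lapCutoff hR).comp_left (g := fun t : ℝ => t ^ 2) (by norm_num))
  have hψl : Integrable fun x => ψ x * lapCutoff R x := Continuous.integrable_of_hasCompactSupport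
    (hψ.1.continuous.mul (continuous_lapCutoff R)) hψ.2.mul_right
  -- After integration by parts the cross term is the pairing with Δη_R, which vanishes for |x| < R;
  -- only the tail of φ enters, through Young's inequality with weight s.
  have hL : 2 * -∫ x, ψ x * lapCutoff R x ≤
      s * (∫ x in {x | r < ‖x‖}, φ x ^ 2) + s⁻¹ * ∫ x, lapCutoff 1 x ^ 2 := by
    rw [← integral_lapCutoff_sq hR, ← integral_indicator hmA, ← integral_const_mul,
      ← integral_const_mul, ← integral_neg, ← integral_const_mul,
      ← integral_add ((hφ2.indicator hmA).const_mul _) (hlap2.const_mul _)]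
    refine integral_mono (hψl.neg.const_mul 2)
      (((hφ2.indicator hmA).const_mul _).add (hlap2.const_mul _)) fun x => ?_
    dsimp only
    by_cases hx : r < ‖x‖
    · rw [Set.indicator_of_mem (show x ∈ {x : R4 | r < ‖x‖} from hx)]
      have h1 : 0 ≤ ψ x := sqrt_sub_nonneg _ _
      have h2 : ψ x ≤ |φ x| := sqrt_sub_le_abs _ hε
      have h3 : ψ x ^ 2 ≤ φ x ^ 2 := by rw [← sq_abs (φ x)]; gcongr
      have h4 : 2 * -(ψ x * lapCutoff R x) ≤ s * ψ x ^ 2 + s⁻¹ * lapCutoff R x ^ 2 := by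
        rw [← sub_nonneg]
        have : s * ψ x ^ 2 + s⁻¹ * lapCutoff R x ^ 2 - 2 * -(ψ x * lapCutoff R x) =
          s⁻¹ * (s * ψ x + lapCutoff R x) ^ 2 := by field_simp; ring
        rw [this]; positivity
      have h5 := mul_le_mul_of_nonneg_left h3 hs.le
      linarith
    · rw [Set.indicator_of_notMem (show x ∉ {x : R4 | r < ‖x‖} from hx),
        lapCutoff_eq_zero hR (by linarith [not_lt.1 hx])]
      simp
  have := mul_le_mul_of_nonneg_left hL ht
  linarith

/-- The sharp Sobolev inequality is strict on `H¹(ℝ⁴) ∖ {0}`. -/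
theorem sharp_sobolev_strict {u : R4 → ℝ} {g : R4 → R4} (hu : MemLp u 2 volume)
    (hug : IsWeakGrad u g) (hg : MemLp g 2 volume) (hne : ¬ u =ᵐ[volume] 0) :
    sharpS * √(∫ x, u x ^ 4) < ∫ x, ‖g x‖ ^ 2 := by
  obtain ⟨hu4, hle⟩ := sobolev_H1 sharpS_pos sharpS_mul_sqrt_le hu hug hg
  refine lt_of_le_of_ne hle fun heq => ?_
  have hN := bubbleMass_pos
  obtain ⟨φ, B, hφ, hlim, hB, hBle, hloc⟩ := exists_test_approx hu hug hg
  set G := ∫ x, ‖g x‖ ^ 2 with hG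
  set A := ∫ x, u x ^ 4 with hA
  have hG0 : 0 ≤ G := integral_nonneg fun x => by positivity
  have hA0 : 0 ≤ A := integral_nonneg fun x => by positivity
  have hGA : G ^ 2 = 64 * bubbleMass * A := by
    rw [← heq, mul_pow, Real.sq_sqrt (by positivity), sharpS_sq]
  have hu2 : Integrable fun x => u x ^ 2 := by
    refine (integrable_norm_sq hu).congr (ae_of_all _ fun x => ?_)
    simp
  set m : ℝ → ℝ := fun r => ∫ x in {x : R4 | r < ‖x‖}, u x ^ 2 with hm
  set Q := ∫ x, lapCutoff 1 x ^ 2 with hQ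
  have hlocal : ∀ n r, ∫ x in {x | r < ‖x‖}, φ n x ^ 2 ≤ m (r - 1) := by
    intro n r
    have h1 := integral_norm_sq (f := φ n) (μ := volume.restrict {x | r < ‖x‖})
      (hφ n).1.continuous.aestronglyMeasurable
    have h2 := integral_norm_sq (f := u) (μ := volume.restrict {x | r - 1 < ‖x‖}) hu.1.restrict
    simp only [Real.norm_eq_abs, sq_abs] at h1 h2
    change _ ≤ ∫ x in {x : R4 | r - 1 < ‖x‖}, u x ^ 2
    rw [h1, h2]
    refine pow_le_pow_left₀ ENNReal.toReal_nonneg (ENNReal.toReal_mono ?_ (hloc n r)) 2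
    exact hu.restrict _ |>.2.ne
  -- first variation of the quartic integral in the direction of the cutoff
  have hvar : ∀ R > 0, ∀ s > 0, ∀ t > 0,
      Integrable (fun x => (|u x| + t * cutoff R x) ^ 4) ∧
      sharpS * √(∫ x, (|u x| + t * cutoff R x) ^ 4) ≤
        G + t * (s * m (R - 2) + s⁻¹ * Q) + t ^ 2 * ∫ x, ‖fderiv ℝ (cutoff R) x‖ ^ 2 := by
    intro R hR s hs t ht
    set ε : ℕ → ℝ := fun n => 1 / ((n:ℝ) + 1) with hε
    have hε0 : ∀ n, 0 < ε n := fun n => by positivity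
    have hεl : Tendsto ε atTop (𝓝 0) := tendsto_one_div_add_atTop_nhds_zero_nat
    refine sobolev_of_tendsto sharpS_pos sharpS_mul_sqrt_le
      (w := fun n x => √(φ n x ^ 2 + ε n ^ 2) - ε n + t * cutoff R x)
      (B := fun n => B n + t * (s * m (R - 2) + s⁻¹ * Q) +
        t ^ 2 * ∫ x, ‖fderiv ℝ (cutoff R) x‖ ^ 2) (fun n => ?_) ?_ ?_ (fun n => ?_)
    · have h1 := isTest_sqrt_sub (hφ n) (hε0 n)
      exact ⟨h1.1.add (contDiff_const.mul (contDiff_cutoff R (n := ⊤))),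
        h1.2.add (hasCompactSupport_cutoff hR).mul_left⟩
    · filter_upwards [hlim] with x hx
      have h1 := (((hx.pow 2).add (hεl.pow 2)).sqrt.sub hεl).add_const (t * cutoff R x)
      simpa [Real.sqrt_sq_eq_abs] using h1
    · exact (hB.add_const _).add_const _
    -- One unit of radius is given up because the tail must begin at some r < R, another because
    -- mollification spreads mass by up to 1; hence R - 2.
    · refine (dirichlet_perturbation_le (hφ n) (hε0 n) ht.le hs hR (r := R - 1)
        (by linarith)).trans ?_
      have h1 := hlocal n (R - 1)
      rw [show R - 1 - 1 = R - 2 by ring] at h1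
      have h2 := hBle n
      gcongr
  have hum := hu.1
  -- a region where `u` does not vanish
  obtain ⟨n₀, hn₀⟩ : ∃ n₀ : ℕ, 0 < ∫ x, |u x| ^ 3 * cutoff ((n₀:ℝ) + 1) x := by
    by_contra! hcon
    apply hne
    have hz : ∀ n : ℕ, ∀ᵐ x, |u x| ^ 3 * cutoff ((n:ℝ) + 1) x = 0 := by
      intro n
      have hnn : ∀ x, 0 ≤ |u x| ^ 3 * cutoff ((n:ℝ) + 1) x := fun x =>
        mul_nonneg (by positivity) (cutoff_nonneg _ _)
      have hi : Integrable fun x => |u x| ^ 3 * cutoff ((n:ℝ) + 1) x := by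
        refine (hu4.add hu2).mono' ((hum.norm.pow 3).mul
          (contDiff_cutoff _ (n := 0)).continuous.aestronglyMeasurable) (ae_of_all _ fun x => ?_)
        rw [Real.norm_of_nonneg (hnn x)]
        have h1 := cutoff_le_one ((n:ℝ) + 1) x
        have h2 : |u x| ^ 3 * cutoff ((n:ℝ) + 1) x ≤ |u x| ^ 3 :=
          mul_le_of_le_one_right (by positivity) h1
        simp only [Pi.add_apply]
        have e4 : u x ^ 4 = |u x| ^ 4 := by rw [← abs_pow, abs_of_nonneg (by positivity)]
        have e2 : u x ^ 2 = |u x| ^ 2 := (sq_abs _).symm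
        rw [e4, e2]
        nlinarith [sq_nonneg (|u x| ^ 2 - |u x|), abs_nonneg (u x), sq_nonneg (|u x|)]
      exact (integral_eq_zero_iff_of_nonneg hnn hi).1
        (le_antisymm (hcon n) (integral_nonneg hnn))
    filter_upwards [ae_all_iff.2 hz] with x hx
    have h1 := tendsto_nhds_unique ((tendsto_cutoff x).const_mul (|u x| ^ 3))
      (tendsto_const_nhds.congr fun n => (hx n).symm)
    simpa using h1
  set J := ∫ x, |u x| ^ 3 * cutoff ((n₀:ℝ) + 1) x with hJ
  have hR₀ : (0:ℝ) < n₀ + 1 := by positivity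
  have hJle : ∀ R, 2 * ((n₀:ℝ) + 1) ≤ R → ∀ s > 0, 64 * bubbleMass * (4 * J) ≤
      2 * G * (s * m (R - 2) + s⁻¹ * Q) := by
    intro R hR s hs
    have hR0 : 0 < R := by linarith
    set δ := s * m (R - 2) + s⁻¹ * Q with hδ
    set H := ∫ x, ‖fderiv ℝ (cutoff R) x‖ ^ 2 with hH
    have hcc : ∀ x, cutoff ((n₀:ℝ) + 1) x ≤ cutoff R x := fun x => by
      rcases le_or_gt (2 * ((n₀:ℝ) + 1)) ‖x‖ with h | h
      · rw [cutoff_eq_zero hR₀ h]; exact cutoff_nonneg _ _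
      · rw [cutoff_eq_one hR0 (by linarith)]; exact cutoff_le_one _ _
    -- By extremality G² = S²A, so the terms of order zero in (G + tδ + t²H)² ≥ S²(A + 4tJ) cancel;
    -- the rest is divided by t.
    have hpoly : ∀ t > 0, 64 * bubbleMass * (4 * J) ≤
        2 * G * δ + t * (δ ^ 2 + 2 * G * H) + t ^ 2 * (2 * δ * H) + t ^ 3 * H ^ 2 := by
      intro t ht
      obtain ⟨hi, hv⟩ := hvar R hR0 s hs t ht
      have hlow : ∀ x, u x ^ 4 + 4 * t * (|u x| ^ 3 * cutoff ((n₀:ℝ) + 1) x) ≤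
          (|u x| + t * cutoff R x) ^ 4 := by
        intro x
        have e4 : u x ^ 4 = |u x| ^ 4 := by rw [← abs_pow, abs_of_nonneg (by positivity)]
        have h1 := hcc x
        have h2 := cutoff_nonneg R x
        have h3 : 4 * t * (|u x| ^ 3 * cutoff ((n₀:ℝ) + 1) x) ≤ 4 * t * (|u x| ^ 3 * cutoff R x) := by
          gcongr
        have h4 : 0 ≤ 6 * |u x| ^ 2 * (t * cutoff R x) ^ 2 + 4 * |u x| * (t * cutoff R x) ^ 3 +
          (t * cutoff R x) ^ 4 := by positivity
        rw [e4]
        nlinarith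
      have hi3 : Integrable fun x => |u x| ^ 3 * cutoff ((n₀:ℝ) + 1) x := by
        refine (hi.const_mul (4 * t)⁻¹).mono' ((hum.norm.pow 3).mul
          (contDiff_cutoff _ (n := 0)).continuous.aestronglyMeasurable) (ae_of_all _ fun x => ?_)
        have hnn : 0 ≤ |u x| ^ 3 * cutoff ((n₀:ℝ) + 1) x :=
          mul_nonneg (by positivity) (cutoff_nonneg _ _)
        rw [Real.norm_of_nonneg hnn, inv_mul_eq_div, le_div_iff₀ (by positivity)]
        have : 0 ≤ u x ^ 4 := by positivity
        linarith [hlow x]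
      have hint : A + 4 * t * J ≤ ∫ x, (|u x| + t * cutoff R x) ^ 4 := by
        rw [hA, hJ, ← integral_const_mul, ← integral_add hu4 (hi3.const_mul _)]
        exact integral_mono (hu4.add (hi3.const_mul _)) hi hlow
      have hsq : 64 * bubbleMass * (A + 4 * t * J) ≤ (G + t * δ + t ^ 2 * H) ^ 2 := by
        have hv2 := pow_le_pow_left₀ (mul_nonneg sharpS_pos.le (Real.sqrt_nonneg _)) hv 2
        rw [mul_pow, Real.sq_sqrt (integral_nonneg fun x => by positivity), sharpS_sq] at hv2
        have := mul_le_mul_of_nonneg_left hint (by positivity : (0:ℝ) ≤ 64 * bubbleMass)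
        linarith
      have h6 : t * (64 * bubbleMass * (4 * J)) ≤ t * (2 * G * δ + t * (δ ^ 2 + 2 * G * H) +
          t ^ 2 * (2 * δ * H) + t ^ 3 * H ^ 2) := by
        nlinarith
      exact le_of_mul_le_mul_left h6 ht
    have hcont : Tendsto (fun t : ℝ => 2 * G * δ + t * (δ ^ 2 + 2 * G * H) + t ^ 2 * (2 * δ * H) +
        t ^ 3 * H ^ 2) (𝓝[>] 0) (𝓝 (2 * G * δ)) := by
      refine tendsto_nhdsWithin_of_tendsto_nhds ?_
      have : Continuous fun t : ℝ => 2 * G * δ + t * (δ ^ 2 + 2 * G * H) + t ^ 2 * (2 * δ * H) +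
        t ^ 3 * H ^ 2 := by fun_prop
      simpa using this.tendsto 0
    exact ge_of_tendsto hcont (by filter_upwards [self_mem_nhdsWithin] with t ht using hpoly t ht)
  have hmlim : Tendsto (fun R => m (R - 2)) atTop (𝓝 0) := by
    have h := tendsto_setIntegral_of_antitone (μ := volume) (f := fun x : R4 => u x ^ 2)
      (s := fun r : ℝ => {x : R4 | r - 2 < ‖x‖})
      (fun r => measurableSet_lt measurable_const measurable_norm)
      (fun a b hab x hx => lt_of_le_of_lt (by linarith : a - 2 ≤ b - 2) hx) ⟨0, hu2.integrableOn⟩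
    have he : (⋂ r : ℝ, {x : R4 | r - 2 < ‖x‖}) = ∅ := by
      ext x
      simp only [Set.mem_iInter, Set.mem_ofPred_eq, Set.mem_empty_iff_false, iff_false]
      push Not
      exact ⟨‖x‖ + 2, by linarith⟩
    rw [he] at h
    simpa using h
  -- Order of limits: with s fixed, R → ∞ removes the tail of u; afterwards s → ∞ removes the
  -- Laplacian term and forces J ≤ 0.
  have hs : ∀ s > 0, 64 * bubbleMass * (4 * J) ≤ 2 * G * (s⁻¹ * Q) := by
    intro s hs
    have h1 : Tendsto (fun R => 2 * G * (s * m (R - 2) + s⁻¹ * Q)) atTop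
        (𝓝 (2 * G * (s * 0 + s⁻¹ * Q))) := ((hmlim.const_mul s).add_const _).const_mul _
    rw [mul_zero, zero_add] at h1
    exact ge_of_tendsto h1 (by
      filter_upwards [eventually_ge_atTop (2 * ((n₀:ℝ) + 1))] with R hR using hJle R hR s hs)
  have hfin : 64 * bubbleMass * (4 * J) ≤ 2 * G * (0 * Q) := by
    have h1 : Tendsto (fun s : ℝ => 2 * G * (s⁻¹ * Q)) atTop (𝓝 (2 * G * (0 * Q))) :=
      (tendsto_inv_atTop_zero.mul_const Q).const_mul _
    exact ge_of_tendsto h1 (by filter_upwards [eventually_gt_atTop 0] with s h using hs s h)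
  have : 0 < 64 * bubbleMass * (4 * J) := by positivity
  simp at hfin
  linarith

/-! ### Classical gradients and the bubbles -/

/-- `u ∈ H¹(ℝ⁴)` with weak gradient `g`. -/
def H1With (u : R4 → ℝ) (g : R4 → R4) : Prop :=
  MemLp u 2 volume ∧ IsWeakGrad u g ∧ MemLp g 2 volume

theorem gradient_apply_eq (f : R4 → ℝ) (x : R4) (i : Fin 4) :
    gradient f x i = fderiv ℝ f x (EuclideanSpace.single i 1) := by
  have h := InnerProductSpace.toDual_symm_apply (𝕜 := ℝ) (x := EuclideanSpace.single i (1:ℝ))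
    (y := fderiv ℝ f x)
  rw [← h, EuclideanSpace.inner_single_right]
  simp [gradient]

theorem norm_gradient (f : R4 → ℝ) (x : R4) : ‖gradient f x‖ = ‖fderiv ℝ f x‖ :=
  LinearIsometryEquiv.norm_map _ _

theorem continuous_gradient {f : R4 → ℝ} (hf : ContDiff ℝ 1 f) : Continuous (gradient f) :=
  (InnerProductSpace.toDual ℝ R4).symm.continuous.comp (hf.continuous_fderiv (by norm_num))

theorem isWeakGrad_gradient {f : R4 → ℝ} (hf : ContDiff ℝ 1 f) : IsWeakGrad f (gradient f) := by
  refine ⟨hf.continuous.locallyIntegrable, (continuous_gradient hf).locallyIntegrable,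
    fun φ hφ i => ?_⟩
  have hφd := hφ.1.continuous_fderiv (by norm_num)
  have hfd := hf.continuous_fderiv (by norm_num)
  have hfc := hf.continuous
  have hφc := hφ.1.continuous
  simp_rw [gradient_apply_eq]
  refine integral_mul_fderiv_eq_neg_fderiv_mul_of_integrable ?_ ?_ ?_
    (fun x _ => hf.differentiable (by norm_num) x) (fun x _ => hφ.1.differentiable (by norm_num) x)
  · exact Continuous.integrable_of_hasCompactSupport
      ((hfd.clm_apply continuous_const).mul hφc) hφ.2.mul_left
  · exact Continuous.integrable_of_hasCompactSupport
      (hfc.mul (hφd.clm_apply continuous_const)) (hφ.2.fderiv_apply ℝ _).mul_left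
  · exact Continuous.integrable_of_hasCompactSupport (hfc.mul hφc) hφ.2.mul_left

theorem one_add_norm_sq_pos (x : R4) : 0 < 1 + ‖x‖ ^ 2 := by positivity

theorem integrable_one_add_norm_sq_inv_pow {n : ℕ} (hn : 3 ≤ n) :
    Integrable fun x : R4 => ((1 + ‖x‖ ^ 2) ^ n)⁻¹ := by
  have h := integrable_rpow_neg_one_add_norm_sq (E := R4) (μ := volume) (r := 2 * n) (by
    rw [finrank_euclideanSpace, Fintype.card_fin]
    have : (3:ℝ) ≤ n := by exact_mod_cast hn
    push_cast; linarith)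
  refine h.congr (ae_of_all _ fun x => ?_)
  dsimp only
  rw [show -(2 * (n:ℝ)) / 2 = -n by ring, Real.rpow_neg (one_add_norm_sq_pos x).le,
    Real.rpow_natCast]

theorem integral_one_add_norm_sq_inv_pow {m : ℕ} (hm : 1 ≤ m) :
    ∫ x : R4, ((1 + ‖x‖ ^ 2) ^ (2 + m))⁻¹ = ∏ i : Fin 4, bracketMass (i + 2 * m + 1) := by
  have h := lintegral_japanese (2 * m) (by omega) 4
  have hvol := PiLp.volume_preserving_ofLp (Fin 4)
  have hmeas : Measurable fun y : Fin 4 → ℝ => ENNReal.ofReal ((japanese y ^ (4 + 2 * m))⁻¹) :=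
    ((continuous_japanese.measurable.pow_const _).inv).ennreal_ofReal
  rw [← hvol.lintegral_comp hmeas] at h
  have e : ∀ x : R4, (japanese (WithLp.ofLp x) ^ (4 + 2 * m))⁻¹ = ((1 + ‖x‖ ^ 2) ^ (2 + m))⁻¹ := by
    intro x
    rw [show 4 + 2 * m = 2 * (2 + m) by ring, pow_mul, japanese_sq, EuclideanSpace.norm_sq_eq]
    simp
  rw [integral_eq_lintegral_of_nonneg_ae (ae_of_all _ fun x => by
    have := one_add_norm_sq_pos x; positivity)
    (integrable_one_add_norm_sq_inv_pow (by omega)).aestronglyMeasurable]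
  have h' : ∫⁻ x : R4, ENNReal.ofReal ((1 + ‖x‖ ^ 2) ^ (2 + m))⁻¹ =
      ENNReal.ofReal (∏ i : Fin 4, bracketMass (i + 2 * m + 1)) := by
    rw [← h]
    exact lintegral_congr fun x => by rw [← e]
  rw [h', ENNReal.toReal_ofReal]
  exact Finset.prod_nonneg fun i _ => (bracketMass_pos (by omega)).le

theorem integral_bubble_four : ∫ x : R4, ((1 + ‖x‖ ^ 2) ^ 4)⁻¹ = bubbleMass :=
  integral_one_add_norm_sq_inv_pow (m := 2) (by norm_num)

theorem integral_bubble_three : ∫ x : R4, ((1 + ‖x‖ ^ 2) ^ 3)⁻¹ = 3 * bubbleMass := by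
  rw [integral_one_add_norm_sq_inv_pow (m := 1) (by norm_num), bubbleMass, Fin.prod_univ_four,
    Fin.prod_univ_four]
  have h3 := bracketMass_rec (n := 3) le_rfl
  have h4 := bracketMass_rec (n := 4) (by norm_num)
  have h5 := bracketMass_rec (n := 5) (by norm_num)
  have h6 := bracketMass_rec (n := 6) (by norm_num)
  norm_num at h3 h4 h5 h6 ⊢
  have e3 : bracketMass 3 = 3 / 2 * bracketMass 5 := by linarith
  have e4 : bracketMass 4 = 4 / 3 * bracketMass 6 := by linarith
  have e5 : bracketMass 7 = 4 / 5 * bracketMass 5 := by linarith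
  have e6 : bracketMass 8 = 5 / 6 * bracketMass 6 := by linarith
  rw [e3, e4, e5, e6]
  ring

/-- The bubble `(1 + |x|²)⁻¹`, with its decay improved by a factor `(1 + |x|²)^{-δ}`. -/
noncomputable def bubble (δ : ℝ) (x : R4) : ℝ := (1 + ‖x‖ ^ 2) ^ (-(1 + δ))

theorem contDiff_bubble (δ : ℝ) : ContDiff ℝ 1 (bubble δ) :=
  (contDiff_const.add (contDiff_norm_sq ℝ)).rpow_const_of_ne fun x => (one_add_norm_sq_pos x).ne'

theorem norm_gradient_bubble_sq {δ : ℝ} (x : R4) :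
    ‖gradient (bubble δ) x‖ ^ 2 =
      4 * (1 + δ) ^ 2 * ‖x‖ ^ 2 * ((1 + ‖x‖ ^ 2) ^ (-(2 + δ))) ^ 2 := by
  have h : HasFDerivAt (bubble δ) _ x :=
    ((hasStrictFDerivAt_norm_sq x).hasFDerivAt.const_add 1).rpow_const (p := -(1 + δ))
      (Or.inl (one_add_norm_sq_pos x).ne')
  rw [norm_gradient, h.fderiv, ← Nat.cast_smul_eq_nsmul ℝ 2, norm_smul, norm_smul,
    innerSL_apply_norm, mul_pow, mul_pow, Real.norm_eq_abs, sq_abs, Real.norm_eq_abs, sq_abs,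
    show -(1 + δ) - 1 = -(2 + δ) by ring]
  push_cast
  ring

theorem one_add_norm_sq_rpow_le {δ : ℝ} (hδ : 0 ≤ δ) (n : ℕ) (x : R4) :
    (1 + ‖x‖ ^ 2) ^ (-((n:ℝ) + δ)) ≤ ((1 + ‖x‖ ^ 2) ^ n)⁻¹ := by
  rw [← Real.rpow_natCast (1 + ‖x‖ ^ 2) n, ← Real.rpow_neg (one_add_norm_sq_pos x).le]
  exact Real.rpow_le_rpow_of_exponent_le (by nlinarith [sq_nonneg ‖x‖]) (by linarith)

theorem bubble_pos (δ : ℝ) (x : R4) : 0 < bubble δ x := Real.rpow_pos_of_pos (one_add_norm_sq_pos x) _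

theorem bubble_le {δ : ℝ} (hδ : 0 ≤ δ) (x : R4) : bubble δ x ≤ (1 + ‖x‖ ^ 2)⁻¹ := by
  have := one_add_norm_sq_rpow_le hδ 1 x
  simpa [bubble] using this

theorem norm_gradient_bubble_sq_le {δ : ℝ} (hδ : 0 ≤ δ) (hδ1 : δ ≤ 1) (x : R4) :
    ‖gradient (bubble δ) x‖ ^ 2 ≤ 16 * ((1 + ‖x‖ ^ 2) ^ 3)⁻¹ := by
  rw [norm_gradient_bubble_sq]
  have h := one_add_norm_sq_rpow_le hδ 2 x
  have h0 := one_add_norm_sq_pos x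
  have h1 : (1 + δ) ^ 2 ≤ 4 := by nlinarith
  have h2 : 0 ≤ (1 + ‖x‖ ^ 2) ^ (-(2 + δ)) := Real.rpow_nonneg h0.le _
  calc 4 * (1 + δ) ^ 2 * ‖x‖ ^ 2 * ((1 + ‖x‖ ^ 2) ^ (-(2 + δ))) ^ 2
      ≤ 4 * 4 * (1 + ‖x‖ ^ 2) * (((1 + ‖x‖ ^ 2) ^ 2)⁻¹) ^ 2 := by
        gcongr
        · linarith
        · exact_mod_cast h
    _ = _ := by field_simp; norm_num

/-- The square of the bubble itself decays like |x|⁻⁴, which just fails to be integrable on ℝ⁴; any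
δ > 0 repairs this. -/
theorem h1With_bubble {δ : ℝ} (hδ : 0 < δ) (hδ1 : δ ≤ 1) :
    H1With (bubble δ) (gradient (bubble δ)) := by
  have hc := contDiff_bubble δ
  refine ⟨?_, isWeakGrad_gradient hc, ?_⟩
  · rw [memLp_two_iff_integrable_sq hc.continuous.aestronglyMeasurable]
    have h := integrable_rpow_neg_one_add_norm_sq (E := R4) (μ := volume) (r := 4 + 4 * δ) (by
      rw [finrank_euclideanSpace, Fintype.card_fin]; push_cast; linarith)
    refine h.congr (ae_of_all _ fun x => ?_)
    dsimp only [bubble]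
    rw [← Real.rpow_natCast ((1 + ‖x‖ ^ 2) ^ (-(1 + δ))) 2, ← Real.rpow_mul (one_add_norm_sq_pos x).le]
    congr 1; push_cast; ring
  · rw [memLp_two_iff_integrable_sq_norm (continuous_gradient hc).aestronglyMeasurable]
    exact ((integrable_one_add_norm_sq_inv_pow (n := 3) le_rfl).const_mul 16).mono'
      ((continuous_gradient hc).norm.pow 2).aestronglyMeasurable (ae_of_all _ fun x => by
        rw [Real.norm_of_nonneg (by positivity)]
        exact norm_gradient_bubble_sq_le hδ.le hδ1 x)

theorem isRadial_bubble (δ : ℝ) : IsRadial (bubble δ) :=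
  ⟨fun s => (1 + s ^ 2) ^ (-(1 + δ)), ae_of_all _ fun _ => rfl⟩

theorem tendsto_integral_bubble {δ : ℕ → ℝ} (h0 : ∀ n, 0 ≤ δ n)
    (hδ : Tendsto δ atTop (𝓝 0)) :
    Tendsto (fun n => ∫ x, bubble (δ n) x ^ 4) atTop (𝓝 bubbleMass) := by
  rw [← integral_bubble_four]
  refine tendsto_integral_of_dominated_convergence _
    (fun n => ((contDiff_bubble _).continuous.pow 4).aestronglyMeasurable)
    (integrable_one_add_norm_sq_inv_pow (n := 4) (by norm_num))
    (fun n => ae_of_all _ fun x => ?_) (ae_of_all _ fun x => ?_)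
  · rw [Real.norm_of_nonneg (by positivity), ← inv_pow]
    exact pow_le_pow_left₀ (bubble_pos _ x).le (bubble_le (h0 n) x) 4
  · have hp := one_add_norm_sq_pos x
    have h1 : Tendsto (fun n => (1 + ‖x‖ ^ 2) ^ (-(1 + δ n))) atTop
        (𝓝 ((1 + ‖x‖ ^ 2) ^ (-(1 + (0:ℝ))))) :=
      tendsto_const_nhds.rpow ((hδ.const_add 1).neg) (Or.inl hp.ne')
    have h2 := h1.pow 4
    rw [add_zero, Real.rpow_neg_one, inv_pow] at h2
    exact h2

/-- The limit integrand is 4|x|²(1 + |x|²)⁻⁴ = 4(1 + |x|²)⁻³ - 4(1 + |x|²)⁻⁴, whose integral is (12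
- 4)N. -/
theorem tendsto_integral_norm_gradient_bubble {δ : ℕ → ℝ} (h0 : ∀ n, 0 ≤ δ n)
    (h1 : ∀ n, δ n ≤ 1) (hδ : Tendsto δ atTop (𝓝 0)) :
    Tendsto (fun n => ∫ x, ‖gradient (bubble (δ n)) x‖ ^ 2) atTop (𝓝 (8 * bubbleMass)) := by
  have i3 := integrable_one_add_norm_sq_inv_pow (n := 3) le_rfl
  have i4 := integrable_one_add_norm_sq_inv_pow (n := 4) (by norm_num)
  have e : 8 * bubbleMass =
      ∫ x : R4, (4 * ((1 + ‖x‖ ^ 2) ^ 3)⁻¹ - 4 * ((1 + ‖x‖ ^ 2) ^ 4)⁻¹) := by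
    rw [integral_sub (i3.const_mul 4) (i4.const_mul 4), integral_const_mul, integral_const_mul,
      integral_bubble_three, integral_bubble_four]
    ring
  rw [e]
  refine tendsto_integral_of_dominated_convergence _
    (fun n => ((continuous_gradient (contDiff_bubble _)).norm.pow 2).aestronglyMeasurable)
    (i3.const_mul 16) (fun n => ae_of_all _ fun x => ?_) (ae_of_all _ fun x => ?_)
  · rw [Real.norm_of_nonneg (by positivity)]
    exact norm_gradient_bubble_sq_le (h0 n) (h1 n) x
  · have hp := one_add_norm_sq_pos x
    simp_rw [norm_gradient_bubble_sq]
    have h2 : Tendsto (fun n => (1 + ‖x‖ ^ 2) ^ (-(2 + δ n))) atTop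
        (𝓝 ((1 + ‖x‖ ^ 2) ^ (-(2 + (0:ℝ))))) :=
      tendsto_const_nhds.rpow ((hδ.const_add 2).neg) (Or.inl hp.ne')
    have h3 := (((((hδ.const_add 1).pow 2).const_mul 4).mul_const (‖x‖ ^ 2))).mul (h2.pow 2)
    convert h3 using 2
    rw [add_zero, add_zero, Real.rpow_neg hp.le, Real.rpow_ofNat]
    field_simp
    ring

/-! ### Norms as integrals, and the value of the best Sobolev constant -/

theorem weakGrad_ae_eq {u : R4 → ℝ} {g : R4 → R4} (h : IsWeakGrad u g) :
    weakGrad u =ᵐ[volume] g := by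
  have hex : ∃ g, IsWeakGrad u g := ⟨g, h⟩
  rw [weakGrad, dif_pos hex]
  exact hex.choose_spec.ae_eq h

theorem gradNorm_sq {u : R4 → ℝ} {g : R4 → R4} (h : IsWeakGrad u g) :
    gradNorm u ^ 2 = ∫ x, ‖g x‖ ^ 2 := by
  have e := weakGrad_ae_eq h
  have hm : AEStronglyMeasurable g volume := h.2.1.aestronglyMeasurable
  rw [gradNorm, ← toReal_eLpNorm (hm.congr e.symm), eLpNorm_congr_ae e, integral_norm_sq hm]

theorem norm4_pow_four {u : R4 → ℝ} (h : AEStronglyMeasurable u volume) :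
    norm4 u ^ 4 = ∫ x, u x ^ 4 := by
  have h0 : 0 ≤ ∫ x, u x ^ 4 := integral_nonneg fun x => by positivity
  have e : ∀ x, ‖u x‖ ^ (4:ℝ) = u x ^ 4 := fun x => by
    rw [Real.rpow_ofNat, Real.norm_eq_abs, Even.pow_abs (by decide)]
  rw [norm4, lpNorm_eq_integral_norm_rpow_toReal (by norm_num) (by norm_num) h]
  simp_rw [ENNReal.toReal_ofNat, e]
  rw [← Real.rpow_natCast, ← Real.rpow_mul h0]
  norm_num

theorem norm4_sq {u : R4 → ℝ} (h : AEStronglyMeasurable u volume) :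
    norm4 u ^ 2 = √(∫ x, u x ^ 4) := by
  rw [← norm4_pow_four h, show norm4 u ^ 4 = (norm4 u ^ 2) ^ 2 by ring,
    Real.sqrt_sq (by positivity)]

theorem IsTest.memLp {φ : R4 → ℝ} (hφ : IsTest φ) (p : ℝ≥0∞) : MemLp φ p volume :=
  hφ.1.continuous.memLp_of_hasCompactSupport hφ.2

theorem IsTest.memLp_gradient {φ : R4 → ℝ} (hφ : IsTest φ) : MemLp (gradient φ) 2 volume := by
  have hc := continuous_gradient (hφ.1.of_le (m := 1) (by simp))
  rw [memLp_two_iff_integrable_sq_norm hc.aestronglyMeasurable]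
  simp_rw [norm_gradient]
  exact integrable_norm_fderiv_sq hφ

theorem IsTest.memD12 {φ : R4 → ℝ} (hφ : IsTest φ) : MemD12 φ :=
  ⟨hφ.memLp 4, gradient φ, isWeakGrad_gradient (hφ.1.of_le (by simp)), hφ.memLp_gradient,
    fun _ => φ, fun _ => hφ, by simp, by simp⟩

/-- The sharp Sobolev inequality on `D^{1,2}(ℝ⁴)`. -/
theorem sharp_sobolev_D12 {u : R4 → ℝ} (hu : MemD12 u) :
    sharpS * norm4 u ^ 2 ≤ gradNorm u ^ 2 := by
  obtain ⟨hu4, g, hug, hg, φ, hφ, hgrad, hlim⟩ := hu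
  have hm := tendstoInMeasure_of_tendsto_eLpNorm (by norm_num : (4:ℝ≥0∞) ≠ 0)
    (fun n => (hφ n).1.continuous.aestronglyMeasurable) hu4.1 hlim
  obtain ⟨ns, hns, hae⟩ := hm.exists_seq_tendsto_ae
  rw [norm4_sq hu4.1, gradNorm_sq hug]
  have hB : Tendsto (fun n => ((eLpNorm (fun x => gradient (φ (ns n)) x - g x) 2 volume).toReal +
      (eLpNorm g 2 volume).toReal) ^ 2) atTop (𝓝 (∫ x, ‖g x‖ ^ 2)) := by
    have h1 := (ENNReal.tendsto_toReal ENNReal.zero_ne_top).comp (hgrad.comp hns.tendsto_atTop)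
    have h2 := (h1.add_const (eLpNorm g 2 volume).toReal).pow 2
    rw [ENNReal.toReal_zero, zero_add, ← integral_norm_sq hg.1] at h2
    exact h2
  refine (sobolev_of_tendsto sharpS_pos sharpS_mul_sqrt_le (fun n => hφ (ns n)) hae hB
    fun n => ?_).2
  have hφg := (hφ (ns n)).memLp_gradient
  have hd : MemLp (fun x => gradient (φ (ns n)) x - g x) 2 volume := hφg.sub hg
  simp_rw [← norm_gradient]
  rw [integral_norm_sq hφg.1]
  have h := eLpNorm_add_le hd.1 hg.1 (by norm_num : (1:ℝ≥0∞) ≤ 2)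
  have e : (fun x => gradient (φ (ns n)) x - g x) + g = gradient (φ (ns n)) := by
    ext1 x; simp
  rw [e] at h
  have h' := ENNReal.toReal_mono (ENNReal.add_ne_top.2 ⟨hd.2.ne, hg.2.ne⟩) h
  rw [ENNReal.toReal_add hd.2.ne hg.2.ne] at h'
  gcongr

theorem norm4_pos {u : R4 → ℝ} (hu : MemLp u 4 volume) (hne : ¬ u =ᵐ[volume] 0) : 0 < norm4 u :=
  lt_of_le_of_ne lpNorm_nonneg fun h => hne ((lpNorm_eq_zero hu (by norm_num)).1 h.symm)

theorem sharpS_le_sobolevS : sharpS ≤ sobolevS := by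
  have hη : IsTest (cutoff 1) := ⟨contDiff_cutoff 1, hasCompactSupport_cutoff one_pos⟩
  -- A nonzero competitor is needed: over an empty set the real infimum would be 0.
  refine le_csInf ⟨_, cutoff 1, hη.memD12, fun h => ?_, rfl⟩ ?_
  · have h0 : cutoff 1 = 0 := hη.1.continuous.ae_eq_iff_eq volume continuous_zero |>.1 h
    have h1 : cutoff 1 0 = 1 := cutoff_eq_one one_pos (by simp)
    rw [h0] at h1
    simp at h1
  · rintro r ⟨u, hu, hne, rfl⟩
    rw [le_div_iff₀ (pow_pos (norm4_pos hu.1 hne) 2)]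
    exact sharp_sobolev_D12 hu

theorem sobolevS_pos : 0 < sobolevS := sharpS_pos.trans_le sharpS_le_sobolevS

theorem sobolevS_mul_sqrt_le (φ : R4 → ℝ) (hφ : IsTest φ) :
    sobolevS * √(∫ x, φ x ^ 4) ≤ ∫ x, ‖fderiv ℝ φ x‖ ^ 2 := by
  by_cases hne : φ =ᵐ[volume] 0
  · have : ∫ x, φ x ^ 4 = 0 := integral_eq_zero_of_ae (by
      filter_upwards [hne] with x hx
      simp [hx])
    rw [this, Real.sqrt_zero, mul_zero]
    positivity
  · have h : sobolevS ≤ gradNorm φ ^ 2 / norm4 φ ^ 2 :=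
      csInf_le ⟨0, by rintro r ⟨u, -, -, rfl⟩; positivity⟩ ⟨φ, hφ.memD12, hne, rfl⟩
    rw [le_div_iff₀ (pow_pos (norm4_pos (hφ.memLp 4) hne) 2), norm4_sq (hφ.memLp 4).1,
      gradNorm_sq (isWeakGrad_gradient (hφ.1.of_le (by simp)))] at h
    simpa only [norm_gradient] using h

/-- A minimizing sequence for the Sobolev quotient, in `H¹`. -/
noncomputable def bubbleSeq (n : ℕ) : R4 → ℝ := bubble (1 / ((n:ℝ) + 1))

theorem h1With_bubbleSeq (n : ℕ) : H1With (bubbleSeq n) (gradient (bubbleSeq n)) :=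
  h1With_bubble (by positivity) (by rw [div_le_one (by positivity)]; linarith [n.cast_nonneg (α := ℝ)])

theorem tendsto_integral_bubbleSeq :
    Tendsto (fun n => ∫ x, bubbleSeq n x ^ 4) atTop (𝓝 bubbleMass) :=
  tendsto_integral_bubble (fun n => by positivity) tendsto_one_div_add_atTop_nhds_zero_nat

theorem tendsto_integral_norm_gradient_bubbleSeq :
    Tendsto (fun n => ∫ x, ‖gradient (bubbleSeq n) x‖ ^ 2) atTop (𝓝 (8 * bubbleMass)) :=
  tendsto_integral_norm_gradient_bubble (fun n => by positivity)
    (fun n => by rw [div_le_one (by positivity)]; linarith [n.cast_nonneg (α := ℝ)])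
    tendsto_one_div_add_atTop_nhds_zero_nat

/-- The best Sobolev constant is the one of the bubble. -/
theorem sobolevS_eq : sobolevS = sharpS := by
  refine le_antisymm ?_ sharpS_le_sobolevS
  have hN := bubbleMass_pos
  -- The bubbles obey the inequality with constant S through the density of test functions, so their
  -- membership in D^{1,2} is not required.
  have h := le_of_tendsto_of_tendsto' (tendsto_integral_bubbleSeq.sqrt.const_mul sobolevS)
    tendsto_integral_norm_gradient_bubbleSeq fun n =>
      (sobolev_H1 sobolevS_pos sobolevS_mul_sqrt_le (h1With_bubbleSeq n).1 (h1With_bubbleSeq n).2.1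
        (h1With_bubbleSeq n).2.2).2
  have hs := Real.sqrt_pos.2 hN
  refine le_of_mul_le_mul_right (h.trans_eq ?_) hs
  rw [sharpS, mul_assoc, Real.mul_self_sqrt hN.le]

/-! ### Rescalings -/

theorem quasiMeasurePreserving_smul_R4 {r : ℝ} (hr : r ≠ 0) :
    Measure.QuasiMeasurePreserving (fun x : R4 => r • x) volume volume :=
  Measure.quasiMeasurePreserving_smul volume hr

theorem integral_comp_smul_R4 (f : R4 → ℝ) {r : ℝ} (hr : 0 < r) :
    ∫ x, f (r • x) = (r ^ 4)⁻¹ * ∫ x, f x := by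
  rw [Measure.integral_comp_smul, finrank_euclideanSpace, Fintype.card_fin, abs_of_pos (by positivity),
    smul_eq_mul]

theorem IsTest.comp_smul {φ : R4 → ℝ} (hφ : IsTest φ) {r : ℝ} (hr : r ≠ 0) :
    IsTest fun x => φ (r • x) :=
  ⟨hφ.1.comp (contDiff_const_smul r), hφ.2.comp_homeomorph (Homeomorph.smulOfNeZero r hr)⟩

theorem IsWeakGrad.rescale {u : R4 → ℝ} {g : R4 → R4} (h : IsWeakGrad u g) (k : ℝ) {r : ℝ} (hr : 0 < r)
    (hu' : MemLp (fun x => k * u (r • x)) 2 volume)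
    (hg' : MemLp (fun x => (k * r) • g (r • x)) 2 volume) :
    IsWeakGrad (fun x => k * u (r • x)) (fun x => (k * r) • g (r • x)) := by
  refine ⟨hu'.locallyIntegrable (by norm_num), hg'.locallyIntegrable (by norm_num),
    fun φ hφ i => ?_⟩
  set ψ : R4 → ℝ := fun y => φ (r⁻¹ • y) with hψ
  have hψt : IsTest ψ := hφ.comp_smul (inv_ne_zero hr.ne')
  have hφψ : ∀ x, φ x = ψ (r • x) := fun x => by simp [hψ, smul_smul, hr.ne']
  have hd : ∀ x v, fderiv ℝ φ x v = r * fderiv ℝ ψ (r • x) v := by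
    intro x v
    have e : φ = fun x => ψ (r • x) := funext hφψ
    have h3 := fderiv_comp_smul (𝕜 := ℝ) (f := ψ) (c := r) (x := x)
    rw [e, h3]
    simp
  have key := h.2.2 ψ hψt i
  calc ∫ x, k * u (r • x) * fderiv ℝ φ x (EuclideanSpace.single i 1)
      = ∫ x, (fun y => k * r * (u y * fderiv ℝ ψ y (EuclideanSpace.single i 1))) (r • x) := by
        congr 1; ext x; rw [hd]; ring
    _ = -((r ^ 4)⁻¹ * ∫ y, k * r * (g y i * ψ y)) := by
        rw [integral_comp_smul_R4 (fun y => k * r * (u y * fderiv ℝ ψ y (EuclideanSpace.single i 1))) hr,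
          integral_const_mul, integral_const_mul, key]
        ring
    _ = -∫ x, (fun y => k * r * (g y i * ψ y)) (r • x) := by
        rw [integral_comp_smul_R4 (fun y => k * r * (g y i * ψ y)) hr]
    _ = _ := by
        congr 2; ext x
        simp only [hφψ x, PiLp.smul_apply, smul_eq_mul]
        ring

theorem H1With.rescale {u : R4 → ℝ} {g : R4 → R4} (h : H1With u g) (k : ℝ) {r : ℝ} (hr : 0 < r) :
    H1With (fun x => k * u (r • x)) (fun x => (k * r) • g (r • x)) := by
  obtain ⟨hu, hug, hg⟩ := h
  have hq := quasiMeasurePreserving_smul_R4 hr.ne'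
  have hu' : MemLp (fun x => u (r • x)) 2 volume := by
    refine (memLp_two_iff_integrable_sq_norm (hu.1.comp_quasiMeasurePreserving hq)).2 ?_
    exact ((memLp_two_iff_integrable_sq_norm hu.1).1 hu).comp_smul hr.ne'
  have hg' : MemLp (fun x => g (r • x)) 2 volume := by
    refine (memLp_two_iff_integrable_sq_norm (hg.1.comp_quasiMeasurePreserving hq)).2 ?_
    exact ((memLp_two_iff_integrable_sq_norm hg.1).1 hg).comp_smul hr.ne'
  exact ⟨hu'.const_mul k, hug.rescale k hr (hu'.const_mul k) (hg'.const_smul (k * r)),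
    hg'.const_smul (k * r)⟩

theorem integral_rescale_pow (u : R4 → ℝ) (k : ℝ) {r : ℝ} (hr : 0 < r) (n : ℕ) :
    ∫ x, (k * u (r • x)) ^ n = k ^ n * (r ^ 4)⁻¹ * ∫ x, u x ^ n := by
  simp_rw [mul_pow]
  rw [integral_const_mul, integral_comp_smul_R4 (fun x => u x ^ n) hr, mul_assoc]

theorem integral_rescale_grad (g : R4 → R4) (k : ℝ) {r : ℝ} (hr : 0 < r) :
    ∫ x, ‖(k * r) • g (r • x)‖ ^ 2 = (k * r) ^ 2 * (r ^ 4)⁻¹ * ∫ x, ‖g x‖ ^ 2 := by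
  simp_rw [norm_smul, mul_pow, Real.norm_eq_abs, sq_abs]
  rw [integral_const_mul, integral_comp_smul_R4 (fun x => ‖g x‖ ^ 2) hr, mul_assoc, mul_pow]

theorem IsRadial.rescale {u : R4 → ℝ} (h : IsRadial u) (k : ℝ) {r : ℝ} (hr : 0 < r) :
    IsRadial fun x => k * u (r • x) := by
  obtain ⟨f, hf⟩ := h
  refine ⟨fun s => k * f (r * s), ?_⟩
  filter_upwards [(quasiMeasurePreserving_smul_R4 hr.ne').ae hf] with x hx
  rw [hx, norm_smul, Real.norm_of_nonneg hr.le]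

/-- The two-parameter rescalings move every radial function to the sphere of mass `c` with a
prescribed Dirichlet energy. -/
theorem exists_mem_sphere {u : R4 → ℝ} {g : R4 → R4} (h : H1With u g) (hrad : IsRadial u)
    (hm : 0 < ∫ x, u x ^ 2) {c t : ℝ} (hc : 0 < c) (ht : 0 < t) :
    ∃ v ∈ sphere c, gradNorm v ^ 2 = t * ∫ x, ‖g x‖ ^ 2 ∧
      norm4 v ^ 4 = t ^ 2 * ∫ x, u x ^ 4 := by
  set m := ∫ x, u x ^ 2 with hmdef
  -- Under u ↦ k u(r·) the mass scales by k²r⁻⁴, the Dirichlet integral by k²r⁻² and the quartic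
  -- integral by k⁴r⁻⁴. Requiring mass c and k²r⁻² = t determines r and k, and the last factor is
  -- then t².
  set r := √(t * m / c) with hrdef
  have hr : 0 < r := Real.sqrt_pos.2 (by positivity)
  have hr2 : r ^ 2 = t * m / c := Real.sq_sqrt (by positivity)
  set k := √(c * r ^ 4 / m) with hkdef
  have hk2 : k ^ 2 = c * r ^ 4 / m := Real.sq_sqrt (by positivity)
  have hv := h.rescale k hr
  refine ⟨fun x => k * u (r • x), ⟨⟨hv.1, _, hv.2⟩, hrad.rescale k hr, ?_⟩, ?_, ?_⟩
  · simp_rw [sq_abs]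
    rw [integral_rescale_pow u k hr 2, ← hmdef, hk2]
    field_simp
  · rw [gradNorm_sq hv.2.1, integral_rescale_grad g k hr, mul_pow, hk2, hr2]
    field_simp
  · rw [norm4_pow_four hv.1.1, integral_rescale_pow u k hr 4, show k ^ 4 = (k ^ 2) ^ 2 by ring, hk2,
      show t ^ 2 = (r ^ 2 * c / m) ^ 2 by rw [hr2]; field_simp]
    field_simp

theorem H1With.gradNorm_dilate_sq {u : R4 → ℝ} {g : R4 → R4} (h : H1With u g) (s : ℝ) :
    gradNorm (dilate s u) ^ 2 = Real.exp (2 * s) * gradNorm u ^ 2 := by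
  have hv := h.rescale (Real.exp (2 * s)) (Real.exp_pos s)
  have e : Real.exp (2 * s) = Real.exp s ^ 2 := by rw [← Real.exp_nat_mul]; norm_num
  unfold dilate
  rw [gradNorm_sq hv.2.1, integral_rescale_grad g _ (Real.exp_pos s), gradNorm_sq h.2.1, e]
  have := Real.exp_pos s
  field_simp

theorem H1With.norm4_dilate_pow_four {u : R4 → ℝ} {g : R4 → R4} (h : H1With u g) (s : ℝ) :
    norm4 (dilate s u) ^ 4 = Real.exp (4 * s) * norm4 u ^ 4 := by
  have hv := h.rescale (Real.exp (2 * s)) (Real.exp_pos s)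
  have e : Real.exp (2 * s) = Real.exp s ^ 2 := by rw [← Real.exp_nat_mul]; norm_num
  have e4 : Real.exp (4 * s) = Real.exp s ^ 4 := by rw [← Real.exp_nat_mul]; norm_num
  unfold dilate
  rw [norm4_pow_four hv.1.1, integral_rescale_pow u _ (Real.exp_pos s) 4, norm4_pow_four h.1.1, e,
    e4]
  have := Real.exp_pos s
  field_simp

/-! ### Lower bounds for the energy, and the Pohozaev manifold -/

theorem sobolevS_sq : sobolevS ^ 2 = 64 * bubbleMass := by rw [sobolevS_eq, sharpS_sq]

theorem exists_h1With_of_mem_sphere {c : ℝ} {u : R4 → ℝ} (hu : u ∈ sphere c) :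
    ∃ g, H1With u g := by
  obtain ⟨⟨h2, g, hg⟩, -, -⟩ := hu
  exact ⟨g, h2, hg.1, hg.2⟩

theorem H1With.sobolev_strict {u : R4 → ℝ} {g : R4 → R4} (h : H1With u g)
    (hm : 0 < ∫ x, u x ^ 2) :
    0 < ∫ x, ‖g x‖ ^ 2 ∧ sobolevS ^ 2 * ∫ x, u x ^ 4 < (∫ x, ‖g x‖ ^ 2) ^ 2 := by
  have hne : ¬ u =ᵐ[volume] 0 := fun h0 => by
    refine hm.ne' (integral_eq_zero_of_ae ?_)
    filter_upwards [h0] with x hx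
    simp [hx]
  have hs := sharp_sobolev_strict h.1 h.2.1 h.2.2 hne
  rw [← sobolevS_eq] at hs
  have h0 : 0 ≤ ∫ x, u x ^ 4 := integral_nonneg fun x => by positivity
  have h1 : 0 ≤ sobolevS * √(∫ x, u x ^ 4) := mul_nonneg sobolevS_pos.le (Real.sqrt_nonneg _)
  refine ⟨h1.trans_lt hs, ?_⟩
  have h2 := pow_lt_pow_left₀ hs h1 two_ne_zero
  rwa [mul_pow, Real.sq_sqrt h0] at h2

theorem sobolev_strict_of_mem_sphere {c : ℝ} (hc : 0 < c) {u : R4 → ℝ} (hu : u ∈ sphere c) :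
    0 < gradNorm u ^ 2 ∧ sobolevS ^ 2 * norm4 u ^ 4 < (gradNorm u ^ 2) ^ 2 := by
  obtain ⟨g, hg⟩ := exists_h1With_of_mem_sphere hu
  have hm := hu.2.2
  simp_rw [sq_abs] at hm
  rw [gradNorm_sq hg.2.1, norm4_pow_four hg.1.1]
  exact hg.sobolev_strict (hm ▸ hc)

theorem energy_eq (a b : ℝ) (u : R4 → ℝ) :
    energy a b u = a / 2 * gradNorm u ^ 2 + (b * (gradNorm u ^ 2) ^ 2 - norm4 u ^ 4) / 4 := by
  rw [energy]; ring

theorem pohozaev_eq (a b : ℝ) (u : R4 → ℝ) :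
    pohozaev a b u = a * gradNorm u ^ 2 + (b * (gradNorm u ^ 2) ^ 2 - norm4 u ^ 4) := by
  rw [pohozaev]; ring

theorem iteratedDeriv_two_fiber (a b : ℝ) {u : R4 → ℝ} {g : R4 → R4} (h : H1With u g) :
    iteratedDeriv 2 (fiber a b u) 0 =
      2 * a * gradNorm u ^ 2 + 4 * (b * (gradNorm u ^ 2) ^ 2 - norm4 u ^ 4) := by
  set A := a / 2 * gradNorm u ^ 2 with hA
  set B := (b * (gradNorm u ^ 2) ^ 2 - norm4 u ^ 4) / 4 with hB
  have hf : fiber a b u = fun s => A * Real.exp (2 * s) + B * Real.exp (4 * s) := by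
    funext s
    have e : Real.exp (4 * s) = Real.exp (2 * s) ^ 2 := by
      rw [← Real.exp_nat_mul]; congr 1; push_cast; ring
    rw [fiber, energy_eq, h.gradNorm_dilate_sq, h.norm4_dilate_pow_four, e, hA, hB]
    ring
  have hexp : ∀ k s : ℝ, HasDerivAt (fun s => Real.exp (k * s)) (Real.exp (k * s) * k) s :=
    fun k s => by simpa using ((hasDerivAt_id s).const_mul k).exp
  have hd : ∀ A B s : ℝ, deriv (fun s => A * Real.exp (2 * s) + B * Real.exp (4 * s)) s =
      2 * A * Real.exp (2 * s) + 4 * B * Real.exp (4 * s) := fun A B s => by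
    have h : HasDerivAt (fun s => A * Real.exp (2 * s) + B * Real.exp (4 * s)) _ s :=
      ((hexp 2 s).const_mul A).add ((hexp 4 s).const_mul B)
    rw [h.deriv]
    ring
  rw [iteratedDeriv_succ, iteratedDeriv_one, hf, funext (hd A B), hd, hA, hB]
  simp
  ring

/-- On 𝒫₀ one has bX² - Y = -aX, so Ψ_u''(0) = 2aX + 4(bX² - Y) = -2aX < 0. -/
theorem pohozaevSetNeg_eq {a : ℝ} (ha : 0 < a) (b : ℝ) {c : ℝ} (hc : 0 < c) :
    pohozaevSetNeg a b c = pohozaevSet a b c := by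
  refine Set.Subset.antisymm (fun u hu => hu.1) fun u hu => ⟨hu, ?_⟩
  obtain ⟨g, hg⟩ := exists_h1With_of_mem_sphere hu.1
  have hX := (sobolev_strict_of_mem_sphere hc hu.1).1
  have hP := hu.2
  rw [pohozaev_eq] at hP
  rw [iteratedDeriv_two_fiber a b hg]
  nlinarith [mul_pos ha hX]

theorem energy_pos_of_mem_sphere {a b c : ℝ} (ha : 0 < a) (hb : (sobolevS ^ 2)⁻¹ ≤ b) (hc : 0 < c)
    {u : R4 → ℝ} (hu : u ∈ sphere c) : 0 < energy a b u := by
  obtain ⟨hX, hY⟩ := sobolev_strict_of_mem_sphere hc hu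
  have hS : 0 < sobolevS ^ 2 := pow_pos sobolevS_pos 2
  have h1 : norm4 u ^ 4 < (sobolevS ^ 2)⁻¹ * (gradNorm u ^ 2) ^ 2 := by
    rwa [lt_inv_mul_iff₀ hS]
  have h2 := mul_le_mul_of_nonneg_right hb (sq_nonneg (gradNorm u ^ 2))
  rw [energy_eq]
  nlinarith [mul_pos ha hX]

theorem one_sub_mul_sobolevS_sq_pos {b : ℝ} (hb : b < (sobolevS ^ 2)⁻¹) :
    0 < 1 - b * sobolevS ^ 2 := by
  have hS : 0 < sobolevS ^ 2 := pow_pos sobolevS_pos 2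
  have := mul_lt_mul_of_pos_right hb hS
  rw [inv_mul_cancel₀ hS.ne'] at this
  linarith

/-- Inserting Y = aX + bX² into S²Y < X² and dividing by X gives aS² < X(1 - bS²), while the energy
on 𝒫₀ equals aX/4. -/
theorem levelL_lt_energy {a b c : ℝ} (ha : 0 < a) (hb : b < (sobolevS ^ 2)⁻¹) (hc : 0 < c)
    {u : R4 → ℝ} (hu : u ∈ pohozaevSet a b c) : levelL a b < energy a b u := by
  obtain ⟨hX, hY⟩ := sobolev_strict_of_mem_sphere hc hu.1
  have hS : 0 < sobolevS ^ 2 := pow_pos sobolevS_pos 2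
  have hP := hu.2
  rw [pohozaev_eq] at hP
  have hbS : 0 < 1 - b * sobolevS ^ 2 := by
    have := mul_lt_mul_of_pos_right hb hS
    rw [inv_mul_cancel₀ hS.ne'] at this
    linarith
  rw [energy_eq, levelL]
  set X := gradNorm u ^ 2
  set Y := norm4 u ^ 4
  set T := sobolevS ^ 2
  have hYX : Y = a * X + b * X ^ 2 := by linarith
  rw [hYX] at hY ⊢
  have h1 : a * T < X * (1 - b * T) := by
    refine lt_of_mul_lt_mul_right ?_ hX.le
    nlinarith
  rw [div_lt_iff₀ (by linarith)]
  nlinarith [mul_lt_mul_of_pos_left h1 ha]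

/-! ### Upper bounds for the infima from rescaled bubbles -/

theorem iInf_le_of_eventually {s : Set (R4 → ℝ)} {f : (R4 → ℝ) → ℝ} {e : ℕ → ℝ} {l : ℝ}
    (h : ∀ᶠ n in atTop, ∃ u ∈ s, f u = e n) (he : Tendsto e atTop (𝓝 l)) :
    (⨅ u ∈ s, (f u : EReal)) ≤ l := by
  refine ge_of_tendsto ((continuous_coe_real_ereal.tendsto l).comp he) ?_
  filter_upwards [h] with n ⟨u, hu, hn⟩
  exact (iInf₂_le u hu).trans_eq (by rw [hn]; rfl)

theorem integral_bubbleSeq_sq_pos (n : ℕ) : 0 < ∫ x, bubbleSeq n x ^ 2 := by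
  have hp : ∀ x, 0 < bubbleSeq n x := fun x => bubble_pos _ x
  have hi : Integrable fun x => bubbleSeq n x ^ 2 := (h1With_bubbleSeq n).1.integrable_sq
  refine (integral_pos_iff_support_of_nonneg (fun x => by positivity) hi).2 ?_
  have hsupp : Function.support (fun x => bubbleSeq n x ^ 2) = Set.univ :=
    Set.eq_univ_of_forall fun x => (pow_pos (hp x) 2).ne'
  rw [hsupp]
  exact Measure.measure_univ_pos.2 NeZero.out

/-- One fixed profile, spread out at constant mass so that its Dirichlet energy tends to 0. -/
theorem iInf_energy_sphere_le {a b c : ℝ} (hc : 0 < c) :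
    (⨅ u ∈ sphere c, (energy a b u : EReal)) ≤ 0 := by
  set X := ∫ x, ‖gradient (bubbleSeq 0) x‖ ^ 2
  set Y := ∫ x, bubbleSeq 0 x ^ 4
  have ht := tendsto_one_div_add_atTop_nhds_zero_nat (𝕜 := ℝ)
  have he : Tendsto (fun n : ℕ => a / 2 * (1 / ((n:ℝ) + 1) * X) +
      (b * (1 / ((n:ℝ) + 1) * X) ^ 2 - (1 / ((n:ℝ) + 1)) ^ 2 * Y) / 4) atTop (𝓝 0) := by
    have := ((ht.mul_const X).const_mul (a / 2)).add
      (((((ht.mul_const X).pow 2).const_mul b).sub ((ht.pow 2).mul_const Y)).div_const 4)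
    simpa using this
  refine iInf_le_of_eventually (Eventually.of_forall fun n => ?_) he
  obtain ⟨v, hv, h1, h2⟩ := exists_mem_sphere (h1With_bubbleSeq 0) (isRadial_bubble _)
    (integral_bubbleSeq_sq_pos 0) hc (t := 1 / ((n:ℝ) + 1)) (by positivity)
  exact ⟨v, hv, by rw [energy_eq, h1, h2]⟩

/-- In the limit the inequality reads 64bN² < N, which is bS² < 1. -/
theorem eventually_supercritical {b : ℝ} (hb : b < (sobolevS ^ 2)⁻¹) :
    ∀ᶠ n in atTop, b * (∫ x, ‖gradient (bubbleSeq n) x‖ ^ 2) ^ 2 < ∫ x, bubbleSeq n x ^ 4 := by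
  have hN := bubbleMass_pos
  refine ((tendsto_integral_norm_gradient_bubbleSeq.pow 2).const_mul b).eventually_lt
    tendsto_integral_bubbleSeq ?_
  have h := one_sub_mul_sobolevS_sq_pos hb
  rw [sobolevS_sq] at h
  nlinarith

theorem iInf_energy_sphere_eq_bot {a b c : ℝ} (ha : 0 < a) (hb : b < (sobolevS ^ 2)⁻¹)
    (hc : 0 < c) : (⨅ u ∈ sphere c, (energy a b u : EReal)) = ⊥ := by
  obtain ⟨n, hn⟩ := (eventually_supercritical hb).exists
  set X := ∫ x, ‖gradient (bubbleSeq n) x‖ ^ 2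
  set Y := ∫ x, bubbleSeq n x ^ 4
  have hX : 0 < X := ((h1With_bubbleSeq n).sobolev_strict (integral_bubbleSeq_sq_pos n)).1
  rw [EReal.eq_bot_iff_forall_lt]
  intro y
  set q := (Y - b * X ^ 2) / 4 with hq
  have hq0 : 0 < q := by rw [hq]; linarith
  -- The energy of the rescaled profile is t(aX/2 - qt). With this t it equals -t(|y| + 1 + q),
  -- which is below y because t ≥ 1.
  set t := (a / 2 * X + |y| + 1) / q + 1 with ht
  have hfrac : 0 < (a / 2 * X + |y| + 1) / q := by positivity
  have hqt : q * t = a / 2 * X + |y| + 1 + q := by rw [ht]; field_simp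
  obtain ⟨v, hv, h1, h2⟩ := exists_mem_sphere (h1With_bubbleSeq n) (isRadial_bubble _)
    (integral_bubbleSeq_sq_pos n) hc (t := t) (by linarith)
  refine (iInf₂_le v hv).trans_lt (EReal.coe_lt_coe_iff.2 ?_)
  have e : energy a b v = t * (a / 2 * X - q * t) := by
    rw [energy_eq, h1, h2, hq]; ring
  rw [e, hqt]
  have hy := neg_abs_le y
  nlinarith [abs_nonneg y]

theorem iInf_energy_pohozaevSet_le {a b c : ℝ} (ha : 0 < a) (hb : b < (sobolevS ^ 2)⁻¹)
    (hc : 0 < c) : (⨅ u ∈ pohozaevSet a b c, (energy a b u : EReal)) ≤ levelL a b := by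
  have hN := bubbleMass_pos
  have hbS := one_sub_mul_sobolevS_sq_pos hb
  rw [sobolevS_sq] at hbS
  have hX := tendsto_integral_norm_gradient_bubbleSeq
  have hY := tendsto_integral_bubbleSeq
  have hden : 0 < 4 * (bubbleMass - b * (8 * bubbleMass) ^ 2) := by nlinarith
  have he := ((hX.pow 2).const_mul (a ^ 2)).div
    ((hY.sub ((hX.pow 2).const_mul b)).const_mul 4) hden.ne'
  have hl : a ^ 2 * (8 * bubbleMass) ^ 2 / (4 * (bubbleMass - b * (8 * bubbleMass) ^ 2)) =
      levelL a b := by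
    rw [levelL, sobolevS_sq, div_eq_div_iff hden.ne' (by linarith)]
    ring
  rw [hl] at he
  refine iInf_le_of_eventually ?_ he
  filter_upwards [eventually_supercritical hb] with n hn
  simp only [Pi.div_apply]
  set X := ∫ x, ‖gradient (bubbleSeq n) x‖ ^ 2
  set Y := ∫ x, bubbleSeq n x ^ 4
  have hX : 0 < X := ((h1With_bubbleSeq n).sobolev_strict (integral_bubbleSeq_sq_pos n)).1
  have hD : 0 < Y - b * X ^ 2 := by linarith
  -- This t solves a tX + b(tX)² = t²Y, which places the rescaled bubble on 𝒫₀.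
  obtain ⟨v, hv, h1, h2⟩ := exists_mem_sphere (h1With_bubbleSeq n) (isRadial_bubble _)
    (integral_bubbleSeq_sq_pos n) hc (t := a * X / (Y - b * X ^ 2)) (by positivity)
  rw [show (∫ x, ‖gradient (bubbleSeq n) x‖ ^ 2) = X from rfl] at h1
  rw [show (∫ x, bubbleSeq n x ^ 4) = Y from rfl] at h2
  set t := a * X / (Y - b * X ^ 2) with ht
  have htD : t * (Y - b * X ^ 2) = a * X := div_mul_cancel₀ _ hD.ne'
  have e : b * (t * X) ^ 2 - t ^ 2 * Y = -(t * (a * X)) := by rw [← htD]; ring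
  refine ⟨v, ⟨hv, ?_⟩, ?_⟩
  · rw [pohozaev_eq, h1, h2, e]
    ring
  · rw [energy_eq, h1, h2, e, ht]
    field_simp
    ring

theorem iInf_energy_pohozaevSet {a b c : ℝ} (ha : 0 < a) (hb : b < (sobolevS ^ 2)⁻¹)
    (hc : 0 < c) : (⨅ u ∈ pohozaevSet a b c, (energy a b u : EReal)) = levelL a b :=
  le_antisymm (iInf_energy_pohozaevSet_le ha hb hc)
    (le_iInf₂ fun _ hu => EReal.coe_le_coe_iff.2 (levelL_lt_energy ha hb hc hu).le)

end Kirchhoff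

theorem theorem2p4 (a b c : ℝ) (ha : 0 < a) (hc : 0 < c) :
    (Kirchhoff.sobolevS ^ (-2 : ℤ) ≤ b →
      (⨅ u ∈ Kirchhoff.sphere c, (Kirchhoff.energy a b u : EReal)) = 0 ∧
      ¬ ∃ u ∈ Kirchhoff.sphere c, Kirchhoff.energy a b u = 0) ∧
    (0 < b → b < Kirchhoff.sobolevS ^ (-2 : ℤ) →
      (⨅ u ∈ Kirchhoff.sphere c, (Kirchhoff.energy a b u : EReal)) = ⊥ ∧
      (⨅ u ∈ Kirchhoff.pohozaevSet a b c, (Kirchhoff.energy a b u : EReal)) =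
        (Kirchhoff.levelL a b : EReal) ∧
      (⨅ u ∈ Kirchhoff.pohozaevSetNeg a b c, (Kirchhoff.energy a b u : EReal)) =
        (Kirchhoff.levelL a b : EReal) ∧
      (¬ ∃ u ∈ Kirchhoff.pohozaevSet a b c, Kirchhoff.energy a b u = Kirchhoff.levelL a b) ∧
      ¬ ∃ u ∈ Kirchhoff.pohozaevSetNeg a b c, Kirchhoff.energy a b u = Kirchhoff.levelL a b) := by
  have hz : Kirchhoff.sobolevS ^ (-2 : ℤ) = (Kirchhoff.sobolevS ^ 2)⁻¹ := zpow_neg _ 2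
  rw [hz, Kirchhoff.pohozaevSetNeg_eq ha b hc]
  refine ⟨fun hb => ⟨le_antisymm (Kirchhoff.iInf_energy_sphere_le hc) ?_, ?_⟩, fun _ hb => ?_⟩
  · exact le_iInf₂ fun u hu => by
      exact_mod_cast (Kirchhoff.energy_pos_of_mem_sphere ha hb hc hu).le
  · rintro ⟨u, hu, h0⟩
    exact (Kirchhoff.energy_pos_of_mem_sphere ha hb hc hu).ne' h0
  · have hinf := Kirchhoff.iInf_energy_pohozaevSet ha hb hc
    have hna : ¬ ∃ u ∈ Kirchhoff.pohozaevSet a b c,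
        Kirchhoff.energy a b u = Kirchhoff.levelL a b := by
      rintro ⟨u, hu, h0⟩
      exact (Kirchhoff.levelL_lt_energy ha hb hc hu).ne' h0
    exact ⟨Kirchhoff.iInf_energy_sphere_eq_bot ha hb hc, hinf, hinf, hna, hna⟩
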